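/- **Trees and patterns.** Let $\mathcal T_n$ be the set of binary trees with vertex set $[n]=\{1,\dots,n\}$ labelled by the search tree property (left descendants of a vertex are smaller, right descendants are larger). Write $r(T)$ for the root, and $c_L(i),c_R(i),p(i)$ for the left child, right child and parent of $i$ ($\varepsilon$ if it does not exist). A tree pattern $(P,e)$ consists of $P\in\mathcal T_k$ and $e\colon[k]\setminus r(P)\to\{0,1\}$. A tree $T\in\mathcal T_n$ contains $(P,e)$ if there is an injection $f\colon[k]\to[n]$ such that for every edge $(i,p(i))$ of $P$: if $e(i)=1$, then $f(i)$ is the left (right) child of $f(p(i))$ if $i$ is the left (right) child of $p(i)$; if $e(i)=0$, then $f(i)$ lies in the left (right) subtree of $f(p(i))$ if $i$ is the left (right) child of $p(i)$. Let $\mathcal T_n((P_1,e_1),\dots,(P_\ell,e_\ell))$ be the set of trees in $\mathcal T_n$ that contain none of the patterns. The pattern $(P,e)$ is friendly if (i) $p(k)\neq\varepsilon$ and $c_L(k)\ne\varepsilon$; (ii) $e(j)=0$ for all vertices $j$ on the right branch starting at the root of $P$, other than the first and the last vertex of that branch; (iii) $e(k)=1$ implies $e(c_L(k))=0$. **Slides.**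 The up-rotation of $j$ is defined if $j=c_R(i)$ for some $i$; it replaces $i$ by $j$, makes $i$ the left child of $j$, and makes the former left subtree of $j$ the right subtree of $i$. The down-rotation of $j$ is the inverse operation, defined if $c_L(j)\ne\varepsilon$. An up-slide (down-slide) of $j$ by $d\ge1$ steps is a sequence of $d$ up-rotations (down-rotations) of $j$. It is minimal with respect to $\mathcal L\subseteq\mathcal T_n$ if every slide of $j$ in the same direction by fewer (and at least one) steps gives a tree outside $\mathcal L$. **Algorithm S** (for $\mathcal L$). Visit the right path, i.e. the tree in $\mathcal T_n$ in which no vertex has a left child. Then repeatedly visit the unvisited tree of $\mathcal L$ that arises from the most recently visited tree by a minimal slide of the largest possible vertex; terminate if there is no such slide or if both directions are possible for that vertex. **Algorithm H** (for $\mathcal L$). Let $T$ be the right path in $\mathcal T_n$, and $o_j\gets{\rm up}$, $s_j\gets j$ for $j=1,\dots,n$. Repeat: visit $T$; set $j\gets s_n$ and terminate if $j=1$; perform in $T$ the minimal slide of $j$ in direction $o_j$ that yields a tree of $\mathcal L$; set $s_n\gets n$; if $o_j={\rm up}$ and $j$ is the root or has a parent larger than $j$, or if $o_j={\rm down}$ and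 $j$ has no left child, reverse $o_j$ and set $s_j\gets s_{j-1}$ and then $s_{j-1}\gets j-1$. **Theorem.** Let $n\ge1$, let $(P_1,e_1),\dots,(P_\ell,e_\ell)$ be friendly tree patterns with $P_i\in\mathcal T_{k_i}$, and let $\mathcal L_n:=\mathcal T_n((P_1,e_1),\dots,(P_\ell,e_\ell))$. Then Algorithm H for $\mathcal L_n$ runs to termination and visits every tree of $\mathcal L_n$, and no other tree, exactly once, in the same order as Algorithm S for $\mathcal L_n$. Moreover, it can be implemented in time $O(n^2\sum_{i=1}^\ell k_i^2)$ per tree: there are one word RAM program (registers and arrays of words; unit cost for every memory access, addition, subtraction, multiplication, comparison and test) and one absolute constant $C$ such that for all $n\ge1$, $\ell\ge1$, all friendly patterns as above, and every word size $M\ge(n+\sum_i k_i)^C$ (arithmetic is modulo $M$), the program, given $n$ and the patterns as input, halts, its memory at the successive visits holds exactly the successive trees $T$ and arrays $o,s$ of Algorithm H, and at most $C\,n^2\sum_{i=1}^\ell k_i^2$ steps pass before the first visit, between any two consecutive visits, and after the last visit. -/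

import Mathlib

namespace FriendlyTrees

/-! ### Binary trees labelled by the search tree property -/

/-- Binary trees with natural numbers as vertices; `nil` is the empty tree. -/
abbrev BTree := BinaryTree ℕ

namespace BTree

open BinaryTree

/-- The vertex set of a tree. -/
def verts : BTree → Finset ℕ
  | nil => ∅
  | node a l r => insert a (verts l ∪ verts r)

/-- The search tree property: left descendants of a vertex are smaller than it, right
descendants are larger. -/
def IsSearch : BTree → Prop
  | nil => True
  | node a l r => (∀ x ∈ verts l, x < a) ∧ (∀ x ∈ verts r, a < x) ∧ IsSearch l ∧ IsSearch r

/-- The set `𝒯_n` of binary trees with vertex set `{1, …, n}` and the search tree property. -/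
def onVertices (n : ℕ) : Set BTree :=
  {T | IsSearch T ∧ verts T = Finset.Icc 1 n}

/-- The root, `none` for the empty tree. -/
def root? : BTree → Option ℕ
  | nil => none
  | node a _ _ => some a

/-- `L(T)`, the left subtree of the root. -/
def leftSub : BTree → BTree
  | nil => nil
  | node _ l _ => l

/-- `R(T)`, the right subtree of the root. -/
def rightSub : BTree → BTree
  | nil => nil
  | node _ _ r => r

/-- `T(i)`, the subtree of the search tree `T` rooted at the vertex `i` (empty if `i` is not a
vertex). -/
def subAt : BTree → ℕ → BTree
  | nil, _ => nil
  | node a l r, i => if i = a then node a l r else if i < a then subAt l i else subAt r i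

/-- `c_L(i)`, with `none` for `ε`. -/
def leftChild (T : BTree) (i : ℕ) : Option ℕ := root? (leftSub (subAt T i))

/-- `c_R(i)`, with `none` for `ε`. -/
def rightChild (T : BTree) (i : ℕ) : Option ℕ := root? (rightSub (subAt T i))

/-- `p(i)`, the parent of `i` in the search tree `T`, with `none` for `ε`. -/
def parent : BTree → ℕ → Option ℕ
  | nil, _ => none
  | node a l r, i =>
      if root? l = some i ∨ root? r = some i then some a
      else if i < a then parent l i else parent r i

/-- The vertices on the right branch starting at the root, from top to bottom. -/
def rightBranch : BTree → List ℕ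
  | nil => []
  | node a _ r => a :: rightBranch r

/-- The right path with the `m` vertices `a, a + 1, …, a + m - 1`. -/
def rightPath (a : ℕ) : ℕ → BTree
  | 0 => nil
  | m + 1 => node a nil (rightPath (a + 1) m)

/-- The preorder traversal `τ(T)`. -/
def preorder : BTree → List ℕ
  | nil => []
  | node a l r => a :: (preorder l ++ preorder r)

/-- The preorder of the right path is the identity permutation. -/
theorem preorder_rightPath (a m : ℕ) : preorder (rightPath a m) = List.range' a m := by
  induction m generalizing a with
  | zero => rfl
  | succ m ih => simp [rightPath, preorder, ih, List.range'_succ]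

/-! ### Rotations and slides -/

/-- The two directions in which a vertex can move. -/
inductive Dir
  | up
  | down
  deriving DecidableEq

/-- The opposite direction. -/
def Dir.flip : Dir → Dir
  | .up => .down
  | .down => .up

/-- The up-rotation of `j` in a search tree; defined if and only if `j` is the right child of its
parent. -/
def upRot (j : ℕ) : BTree → Option BTree
  | nil => none
  | node a l r =>
      match r with
      | node b y z =>
          if b = j then some (node j (node a l y) z)
          else if j < a then (upRot j l).map (fun l' => node a l' (node b y z))
          else if a < j then (upRot j (node b y z)).map (fun r' => node a l r')
          else none
      | nil => if j < a then (upRot j l).map (fun l' => node a l' nil) else none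

/-- The down-rotation of `j` in a search tree; defined if and only if `j` has a left child. -/
def downRot (j : ℕ) : BTree → Option BTree
  | nil => none
  | node a l r =>
      if j = a then
        match l with
        | node b x y => some (node b x (node a y r))
        | nil => none
      else if j < a then (downRot j l).map (fun l' => node a l' r)
      else (downRot j r).map (fun r' => node a l r')

/-- A rotation of `j` in direction `d`. -/
def rot (d : Dir) (j : ℕ) (T : BTree) : Option BTree :=
  match d with
  | .up => upRot j T
  | .down => downRot j T

/-- The slide of `j` in direction `d` by a number of steps, `none` if some step is undefined. -/
def slide (d : Dir) (j : ℕ) : ℕ → BTree → Option BTree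
  | 0, T => some T
  | m + 1, T => (rot d j T).bind (slide d j m)

/-- `T'` arises from `T` by a slide of `j` in direction `d` by at least one step that is minimal
with respect to `𝓛`: every such slide by fewer steps yields a tree outside `𝓛`. -/
def IsMinSlide (𝓛 : Set BTree) (d : Dir) (j : ℕ) (T T' : BTree) : Prop :=
  ∃ m, 1 ≤ m ∧ slide d j m T = some T' ∧
    ∀ m', 1 ≤ m' → m' < m → ∀ T'', slide d j m' T = some T'' → T'' ∉ 𝓛

end BTree

open BTree

/-! ### Tree patterns -/

/-- A tree pattern `(P, e)` with `P ∈ 𝒯_k`. The edge from a non-root vertex `i` to its parent is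
contiguous if `e i = true` and non-contiguous if `e i = false`; only the values of `e` at non-root
vertices are ever used. -/
structure TreePattern where
  k : ℕ
  tree : BTree
  tree_mem : tree ∈ onVertices k
  e : ℕ → Bool

/-- The tree `T` contains the pattern `(P, e)`. -/
def Contains (T : BTree) (P : TreePattern) : Prop :=
  ∃ f : ℕ → ℕ,
    Set.MapsTo f (verts P.tree) (verts T) ∧
    Set.InjOn f (verts P.tree) ∧
    ∀ i ∈ verts P.tree, ∀ p ∈ verts P.tree,
      (leftChild P.tree p = some i →
        (P.e i = true → leftChild T (f p) = some (f i)) ∧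
        (P.e i = false → f i ∈ verts (leftSub (subAt T (f p))))) ∧
      (rightChild P.tree p = some i →
        (P.e i = true → rightChild T (f p) = some (f i)) ∧
        (P.e i = false → f i ∈ verts (rightSub (subAt T (f p)))))

/-- The set `𝒯_n((P₁, e₁), …, (P_ℓ, e_ℓ))` of trees on `{1, …, n}` avoiding all given patterns. -/
def avoiders (n : ℕ) (pats : List TreePattern) : Set BTree :=
  {T | T ∈ onVertices n ∧ ∀ P ∈ pats, ¬ Contains T P}

/-- Friendly tree patterns. -/
structure TreePattern.Friendly (P : TreePattern) : Prop where
  /-- The largest vertex is neither the root nor does it lack a left child. -/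
  parent_ne : parent P.tree P.k ≠ none
  left_ne : leftChild P.tree P.k ≠ none
  /-- The edges on the right branch starting at the root, except possibly the last one, are
  non-contiguous. -/
  branch : ∀ j ∈ (rightBranch P.tree).dropLast, root? P.tree ≠ some j → P.e j = false
  /-- If the edge from `k` to its parent is contiguous, then the one to its left child is not. -/
  last : P.e P.k = true → ∀ c, leftChild P.tree P.k = some c → P.e c = false

/-! ### The greedy algorithm (Algorithm S) -/

/-- A minimal slide of `j` in direction `d` in `T` creates the tree `T' ∈ 𝓛`, which is not in the
list `visited`. -/
def SCandidate (𝓛 : Set BTree) (visited : List BTree) (T : BTree) (j : ℕ) (d : Dir)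
    (T' : BTree) : Prop :=
  IsMinSlide 𝓛 d j T T' ∧ T' ∈ 𝓛 ∧ T' ∉ visited

/-- The greedy algorithm, having visited the trees in `visited`, the last of them being `T`, visits
`T'` next: `T'` is created by a slide of the largest possible vertex `j`, and no slide of `j` in
the opposite direction is possible. -/
def SNext (𝓛 : Set BTree) (visited : List BTree) (T T' : BTree) : Prop :=
  ∃ j d, SCandidate 𝓛 visited T j d T' ∧
    (∀ j' d' T'', SCandidate 𝓛 visited T j' d' T'' → j' ≤ j) ∧
    (∀ T'', ¬ SCandidate 𝓛 visited T j d.flip T'')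

/-- `vs` is the list of trees, in this order, that the greedy algorithm for `𝓛` with initial tree
`T₀` visits until it terminates. -/
def IsSRun (𝓛 : Set BTree) (T₀ : BTree) (vs : List BTree) : Prop :=
  vs.head? = some T₀ ∧
  (∀ (i : ℕ) (hi : i + 1 < vs.length), SNext 𝓛 (vs.take (i + 1)) vs[i] vs[i + 1]) ∧
  (∀ T ∈ vs.getLast?, ∀ T', ¬ SNext 𝓛 vs T T')

/-! ### The history-free algorithm (Algorithm H) -/

/-- The data maintained by the history-free algorithm: the current tree and the two auxiliary
arrays, of which only the entries with indices `1, …, n` matter. -/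
structure HState where
  tree : BTree
  o : ℕ → Dir
  s : ℕ → ℕ

/-- Initialization. -/
def HState.init (n : ℕ) : HState where
  tree := rightPath 1 n
  o := fun _ => .up
  s := fun j => j

/-- For direction up: `j` is the root or its parent is larger than `j`.
For direction down: `j` has no left child. -/
def blocked (T : BTree) (j : ℕ) : Dir → Bool
  | .up =>
      match parent T j with
      | none => true
      | some p => decide (j < p)
  | .down => (leftChild T j).isNone

/-- The update of the auxiliary arrays after a slide of `j` that created the tree `T'`. -/
def HState.update (n : ℕ) (x : HState) (j : ℕ) (T' : BTree) : HState :=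
  let s₁ := Function.update x.s n n
  if blocked T' j (x.o j) then
    { tree := T'
      o := Function.update x.o j (x.o j).flip
      s := Function.update (Function.update s₁ j (s₁ (j - 1))) (j - 1) (j - 1) }
  else
    { tree := T', o := x.o, s := s₁ }

/-- One iteration of the history-free algorithm, from one visit to the next. -/
def HStep (𝓛 : Set BTree) (n : ℕ) (x y : HState) : Prop :=
  x.s n ≠ 1 ∧
  ∃ T' ∈ 𝓛, IsMinSlide 𝓛 (x.o (x.s n)) (x.s n) x.tree T' ∧ y = x.update n (x.s n) T'

/-- `xs` is the list of states at the visits of a complete run of the history-free algorithm for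
`𝓛 ⊆ 𝒯_n`: it starts with the initial state, and it ends by termination, that is, with a state
where `s_n = 1`. -/
def IsHRun (𝓛 : Set BTree) (n : ℕ) (xs : List HState) : Prop :=
  xs.head? = some (HState.init n) ∧ xs.IsChain (HStep 𝓛 n) ∧ ∀ x ∈ xs.getLast?, x.s n = 1

/-! ### A word RAM with a step count

Programs are built from assignments, conditionals and loops over expressions. The memory consists
of registers and of arrays, each a sequence of words. Arithmetic is modulo the word size `M` (words
are the numbers less than `M`). Every operation, memory access and test takes one step. -/

/-- The contents of the memory. -/
structure Memory where
  reg : ℕ → ℕ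
  arr : ℕ → ℕ → ℕ

/-- Expressions. -/
inductive Expr
  | const (c : ℕ)
  | reg (x : ℕ)
  | get (a : ℕ) (i : Expr)
  | add (u v : Expr)
  | sub (u v : Expr)
  | mul (u v : Expr)
  | lt (u v : Expr)
  | eq (u v : Expr)

/-- The value of an expression. Subtraction is truncated at zero; comparisons yield `1` or `0`. -/
def Expr.val (M : ℕ) (m : Memory) : Expr → ℕ
  | const c => c % M
  | reg x => m.reg x
  | get a i => m.arr a (i.val M m)
  | add u v => (u.val M m + v.val M m) % M
  | sub u v => (u.val M m - v.val M m) % M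
  | mul u v => (u.val M m * v.val M m) % M
  | lt u v => if u.val M m < v.val M m then 1 else 0
  | eq u v => if u.val M m = v.val M m then 1 else 0

/-- The number of steps for evaluating an expression. -/
def Expr.cost : Expr → ℕ
  | const _ => 1
  | reg _ => 1
  | get _ i => i.cost + 1
  | add u v => u.cost + v.cost + 1
  | sub u v => u.cost + v.cost + 1
  | mul u v => u.cost + v.cost + 1
  | lt u v => u.cost + v.cost + 1
  | eq u v => u.cost + v.cost + 1

/-- Programs. The statement `visit` announces that the memory now holds the next object. -/
inductive Prog
  | skip
  | assign (x : ℕ) (u : Expr)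
  | put (a : ℕ) (i u : Expr)
  | seq (p q : Prog)
  | cond (u : Expr) (p q : Prog)
  | loop (u : Expr) (p : Prog)
  | visit

/-- A configuration: the memory, the number of steps so far, and the times and memory contents of
the visits so far. -/
structure Config where
  mem : Memory
  clock : ℕ
  log : List (ℕ × Memory)

/-- Let `t` steps pass. -/
def Config.tick (c : Config) (t : ℕ) : Config := { c with clock := c.clock + t }

/-- `Exec M p c c'`: with word size `M`, the program `p` started in configuration `c` halts in
configuration `c'`. -/
inductive Exec (M : ℕ) : Prog → Config → Config → Prop
  | skip (c : Config) : Exec M .skip c (c.tick 1)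
  | assign (x : ℕ) (u : Expr) (c : Config) :
      Exec M (.assign x u) c
        { mem := { c.mem with reg := Function.update c.mem.reg x (u.val M c.mem) }
          clock := c.clock + (u.cost + 1)
          log := c.log }
  | put (a : ℕ) (i u : Expr) (c : Config) :
      Exec M (.put a i u) c
        { mem := { c.mem with
            arr := Function.update c.mem.arr a
              (Function.update (c.mem.arr a) (i.val M c.mem) (u.val M c.mem)) }
          clock := c.clock + (i.cost + u.cost + 1)
          log := c.log }
  | seq {p q : Prog} {c c' c'' : Config} (hp : Exec M p c c') (hq : Exec M q c' c'') :
      Exec M (.seq p q) c c''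
  | cond_true {u : Expr} {p q : Prog} {c c' : Config} (hu : u.val M c.mem ≠ 0)
      (hp : Exec M p (c.tick (u.cost + 1)) c') : Exec M (.cond u p q) c c'
  | cond_false {u : Expr} {p q : Prog} {c c' : Config} (hu : u.val M c.mem = 0)
      (hq : Exec M q (c.tick (u.cost + 1)) c') : Exec M (.cond u p q) c c'
  | loop_true {u : Expr} {p : Prog} {c c' c'' : Config} (hu : u.val M c.mem ≠ 0)
      (hp : Exec M p (c.tick (u.cost + 1)) c') (hl : Exec M (.loop u p) c' c'') :
      Exec M (.loop u p) c c''
  | loop_false {u : Expr} {p : Prog} {c : Config} (hu : u.val M c.mem = 0) :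
      Exec M (.loop u p) c (c.tick (u.cost + 1))
  | visit (c : Config) :
      Exec M .visit c
        { mem := c.mem, clock := c.clock + 1, log := c.log ++ [(c.clock + 1, c.mem)] }

/-! ### Input and output of the history-free algorithm on the word RAM -/

/-- A vertex or `ε` as a word; vertices are positive, and `0` encodes `ε`. -/
def code (v : Option ℕ) : ℕ := v.getD 0

/-- The concatenation, over all patterns, of the rows `g P 1, …, g P k`, preceded by an unused
entry `0`. The entry for the vertex `v` of the pattern with number `i` thus has position
`k₁ + ⋯ + k_{i-1} + v`. -/
def rows (pats : List TreePattern) (g : TreePattern → ℕ → ℕ) : List ℕ :=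
  0 :: pats.flatMap (fun P => (List.range P.k).map (fun v => g P (v + 1)))

/-- The memory that holds the input: `n` and the number `ℓ` of patterns in registers `0` and `1`;
the sizes `k₁, …, k_ℓ` and the roots of the patterns in arrays `0` and `1`; the left children, the
right children and the values `e` of all vertices of all patterns in arrays `2`, `3`, `4`.
Everything else is zero. -/
def inputMemory (n : ℕ) (pats : List TreePattern) : Memory where
  reg x := if x = 0 then n else if x = 1 then pats.length else 0
  arr a x :=
    if a = 0 then (pats.map (fun P => P.k)).getD x 0
    else if a = 1 then (pats.map (fun P => code (root? P.tree))).getD x 0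
    else if a = 2 then (rows pats (fun P v => code (leftChild P.tree v))).getD x 0
    else if a = 3 then (rows pats (fun P v => code (rightChild P.tree v))).getD x 0
    else if a = 4 then (rows pats (fun P v => (P.e v).toNat)).getD x 0
    else 0

/-- The memory holds a state of the history-free algorithm: the root of the current tree in register
`2`, its left and right children in arrays `5` and `6`, and the auxiliary arrays `o` (with `0` for
up and `1` for down) and `s` in arrays `7` and `8`. -/
def Holds (n : ℕ) (m : Memory) (x : HState) : Prop :=
  m.reg 2 = code (root? x.tree) ∧
  ∀ v, 1 ≤ v → v ≤ n →
    m.arr 5 v = code (leftChild x.tree v) ∧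
    m.arr 6 v = code (rightChild x.tree v) ∧
    m.arr 7 v = (match x.o v with | .up => 0 | .down => 1) ∧
    m.arr 8 v = x.s v

/-- Started on the input, the program halts, its successive visits are exactly the states in the
list `xs`, and at most `B` steps pass before the first visit, between any two consecutive visits,
and after the last visit. -/
def RunsWithDelay (M : ℕ) (prog : Prog) (n : ℕ) (pats : List TreePattern) (xs : List HState)
    (B : ℕ) : Prop :=
  ∃ c : Config, Exec M prog ⟨inputMemory n pats, 0, []⟩ c ∧
    List.Forall₂ (fun (r : ℕ × Memory) (x : HState) => Holds n r.2 x) c.log xs ∧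
    List.IsChain (fun t t' : ℕ => t' ≤ t + B) (0 :: (c.log.map Prod.fst ++ [c.clock]))

end FriendlyTrees

open FriendlyTrees

/-!
Every tree with vertices `1, …, n + 1` arises in exactly one way from a tree `T` with vertices
`1, …, n` by inserting the vertex `n + 1` at some distance `m` from the root on the right branch
(`ins`, `exists_eq_ins_of_mem`, `ins_inj`), and the rotations of `n + 1` change `m` by one while
keeping `T`. The avoiders of friendly patterns form a zigzag language (`zigzag_avoiders`): deleting
the largest vertex creates no occurrence of a pattern, and inserting a new largest vertex at the
root or as the last vertex of the right branch creates none either. This uses containment in the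
form of a structural recursion on the pattern and the tree (`contains_iff`) and the properties that
friendliness gives to the right branch of a pattern (`Tame`).

For a zigzag language the run for `n + 1` vertices arises from the run for `n` vertices: the vertex
`n + 1` slides alternately from the bottom to the top and back, through all positions that are
allowed by the language, and between two such slides the smaller vertices make one step of their
run (`expand`, `hRun`). Since the vertex `n + 1` is then at the top or at the bottom, it does not
interfere with that step (`slide_ext`, `blocked_ext`), and the arrays `o` and `s` are the mechanism
that decides which vertex moves next (`isChain_expand`). By induction, this run visits every tree of
the language once (`hRun_spec`). The greedy algorithm makes the same choices: during a slide of
`n + 1`, exactly one direction leads to a new tree, and after the slide all trees with the same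
restriction have been visited (`sNext_fib`, `sNext_ext`). Both algorithms are deterministic, so
these are their only runs (`isHRun_iff`, `isSRun_iff_eq`).

The word RAM program maintains the links and the parents of the tree, so that a rotation takes
constant time (`rotProg_spec`). A minimal slide is done by at most `n` rotations, each followed by a
containment test. The test fills, for each pattern, two tables that say for a vertex `i` of the
pattern and a vertex `v` of the tree whether the part of the pattern below `i` occurs at `v`, or
anywhere below `v` (`occA_iff`, `occB_iff`); the vertices of the tree are processed in reverse
preorder. One test takes time `O(n ∑ kᵢ)` (`checkProg_spec`), so one step of the algorithm takes
time `O(n² ∑ kᵢ)` (`stepProg_spec`), which is within the claimed bound.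
-/

namespace FriendlyTrees

open BTree BinaryTree

/-! ### Search trees -/

theorem leftChild_node (a : ℕ) (l r : BTree) (v : ℕ) :
    leftChild (node a l r) v =
      if v = a then root? l else if v < a then leftChild l v else leftChild r v := by
  unfold leftChild
  rw [subAt]
  split_ifs <;> rfl

theorem rightChild_node (a : ℕ) (l r : BTree) (v : ℕ) :
    rightChild (node a l r) v =
      if v = a then root? r else if v < a then rightChild l v else rightChild r v := by
  unfold rightChild
  rw [subAt]
  split_ifs <;> rfl

theorem mem_verts_node {a : ℕ} {l r : BTree} {x : ℕ} :
    x ∈ verts (node a l r) ↔ x = a ∨ x ∈ verts l ∨ x ∈ verts r := by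
  simp [verts]

theorem mem_verts_of_root {t : BTree} {x : ℕ} (h : root? t = some x) : x ∈ verts t := by
  cases t with
  | nil => simp [root?] at h
  | node a l r => simp only [root?, Option.some.injEq] at h; simp [verts, h]

theorem subAt_root {t : BTree} {x : ℕ} (h : root? t = some x) : subAt t x = t := by
  cases t with
  | nil => simp [root?] at h
  | node a l r => simp only [root?, Option.some.injEq] at h; simp [subAt, h]

theorem verts_subAt_subset (T : BTree) (v : ℕ) : verts (subAt T v) ⊆ verts T := by
  induction T with
  | nil => simp [subAt]
  | node a l r ihl ihr =>
    intro x hx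
    rw [subAt] at hx
    rw [mem_verts_node]
    split_ifs at hx with h1 h2
    · exact mem_verts_node.1 hx
    · exact Or.inr (Or.inl (ihl hx))
    · exact Or.inr (Or.inr (ihr hx))

theorem isSearch_subAt {T : BTree} (hT : IsSearch T) (v : ℕ) : IsSearch (subAt T v) := by
  induction T with
  | nil => exact hT
  | node a l r ihl ihr =>
    rw [subAt]
    split_ifs
    · exact hT
    · exact ihl hT.2.2.1
    · exact ihr hT.2.2.2

/-- The subtree at a vertex has that vertex as its root. -/
theorem exists_subAt_eq_node {T : BTree} (hT : IsSearch T) {v : ℕ} (hv : v ∈ verts T) :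
    ∃ l r, subAt T v = node v l r := by
  induction T with
  | nil => simp [verts] at hv
  | node a l r ihl ihr =>
    rw [subAt]
    split_ifs with h1 h2
    · exact ⟨l, r, by rw [h1]⟩
    · refine ihl hT.2.2.1 ?_
      rcases mem_verts_node.1 hv with h | h | h
      · exact absurd h h1
      · exact h
      · have := hT.2.1 v h; omega
    · refine ihr hT.2.2.2 ?_
      rcases mem_verts_node.1 hv with h | h | h
      · exact absurd h h1
      · have := hT.1 v h; omega
      · exact h

theorem subAt_eq_nil {T : BTree} (hT : IsSearch T) {v : ℕ} (hv : v ∉ verts T) :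
    subAt T v = nil := by
  induction T with
  | nil => rfl
  | node a l r ihl ihr =>
    rw [mem_verts_node] at hv
    push Not at hv
    rw [subAt, if_neg hv.1]
    split_ifs
    · exact ihl hT.2.2.1 hv.2.1
    · exact ihr hT.2.2.2 hv.2.2

theorem subAt_subAt {T : BTree} (hT : IsSearch T) {v x : ℕ} (hx : x ∈ verts (subAt T v)) :
    subAt (subAt T v) x = subAt T x := by
  induction T with
  | nil => simp [subAt, verts] at hx
  | node a l r ihl ihr =>
    rw [subAt] at hx ⊢
    split_ifs at hx ⊢ with h1 h2
    · rfl
    · have h := hT.1 x (verts_subAt_subset _ _ hx)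
      rw [ihl hT.2.2.1 hx, subAt, if_neg h.ne, if_pos h]
    · have h := hT.2.1 x (verts_subAt_subset _ _ hx)
      rw [ihr hT.2.2.2 hx, subAt, if_neg h.ne', if_neg h.not_gt]

theorem isSearch_leftSub {t : BTree} (h : IsSearch t) : IsSearch (leftSub t) := by
  cases t with
  | nil => exact h
  | node a l r => exact h.2.2.1

theorem isSearch_rightSub {t : BTree} (h : IsSearch t) : IsSearch (rightSub t) := by
  cases t with
  | nil => exact h
  | node a l r => exact h.2.2.2

theorem verts_leftSub_subset (t : BTree) : verts (leftSub t) ⊆ verts t := by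
  cases t with
  | nil => exact subset_rfl
  | node a l r => intro x hx; exact mem_verts_node.2 (Or.inr (Or.inl hx))

theorem verts_rightSub_subset (t : BTree) : verts (rightSub t) ⊆ verts t := by
  cases t with
  | nil => exact subset_rfl
  | node a l r => intro x hx; exact mem_verts_node.2 (Or.inr (Or.inr hx))

theorem subAt_leftSub_subAt {T : BTree} (hT : IsSearch T) {v x : ℕ}
    (hx : x ∈ verts (leftSub (subAt T v))) : subAt (leftSub (subAt T v)) x = subAt T x := by
  rw [← subAt_subAt hT (verts_leftSub_subset _ hx)]
  have hs := isSearch_subAt hT v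
  revert hx hs
  generalize subAt T v = t
  intro hx hs
  cases t with
  | nil => rfl
  | node a l r =>
    have h := hs.1 x hx
    conv_rhs => rw [subAt, if_neg h.ne, if_pos h]
    rfl

theorem subAt_rightSub_subAt {T : BTree} (hT : IsSearch T) {v x : ℕ}
    (hx : x ∈ verts (rightSub (subAt T v))) : subAt (rightSub (subAt T v)) x = subAt T x := by
  rw [← subAt_subAt hT (verts_rightSub_subset _ hx)]
  have hs := isSearch_subAt hT v
  revert hx hs
  generalize subAt T v = t
  intro hx hs
  cases t with
  | nil => rfl
  | node a l r =>
    have h := hs.2.1 x hx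
    conv_rhs => rw [subAt, if_neg h.ne', if_neg h.not_gt]
    rfl

theorem leftSub_subAt_eq {T : BTree} (hT : IsSearch T) {v w : ℕ}
    (h : leftChild T v = some w) : leftSub (subAt T v) = subAt T w := by
  rw [← subAt_leftSub_subAt hT (mem_verts_of_root h), subAt_root h]

theorem rightSub_subAt_eq {T : BTree} (hT : IsSearch T) {v w : ℕ}
    (h : rightChild T v = some w) : rightSub (subAt T v) = subAt T w := by
  rw [← subAt_rightSub_subAt hT (mem_verts_of_root h), subAt_root h]

theorem leftChild_mem {T : BTree} {v w : ℕ} (h : leftChild T v = some w) : w ∈ verts T :=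
  verts_subAt_subset _ _ (verts_leftSub_subset _ (mem_verts_of_root h))

theorem rightChild_mem {T : BTree} {v w : ℕ} (h : rightChild T v = some w) : w ∈ verts T :=
  verts_subAt_subset _ _ (verts_rightSub_subset _ (mem_verts_of_root h))

theorem root?_eq_none {t : BTree} : root? t = none ↔ t = nil := by
  cases t <;> simp [root?]

/-! ### Containment as a structural recursion -/

/-- Some nonempty subtree, rooted at a vertex of the tree, has the property `Q`. -/
def AnySub (Q : BTree → Prop) : BTree → Prop
  | nil => False
  | node a l r => Q (node a l r) ∨ AnySub Q l ∨ AnySub Q r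

/-- The condition that an edge of the pattern from the root of `p` to its parent puts on the subtree
`t` below the image of the parent, where `Q` says that `p` occurs at the root of a tree. -/
def Link (e : ℕ → Bool) (p : BTree) (Q : BTree → Prop) (t : BTree) : Prop :=
  match root? p with
  | none => True
  | some c => if e c = true then Q t else AnySub Q t

/-- The pattern `(p, e)` has an occurrence in `t` that maps the root of `p` to the root of `t`. -/
def OccAt (e : ℕ → Bool) : BTree → BTree → Prop
  | nil => fun _ => True
  | node _ pl pr => fun t =>
      t ≠ nil ∧ Link e pl (OccAt e pl) (leftSub t) ∧ Link e pr (OccAt e pr) (rightSub t)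

theorem anySub_iff {Q : BTree → Prop} {T : BTree} (hT : IsSearch T) :
    AnySub Q T ↔ ∃ v ∈ verts T, Q (subAt T v) := by
  induction T with
  | nil => simp [AnySub, verts]
  | node a l r ihl ihr =>
    rw [AnySub, ihl hT.2.2.1, ihr hT.2.2.2]
    constructor
    · rintro (h | ⟨v, hv, h⟩ | ⟨v, hv, h⟩)
      · exact ⟨a, mem_verts_node.2 (Or.inl rfl), by simpa [subAt] using h⟩
      · refine ⟨v, mem_verts_node.2 (Or.inr (Or.inl hv)), ?_⟩
        have := hT.1 v hv
        rwa [subAt, if_neg this.ne, if_pos this]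
      · refine ⟨v, mem_verts_node.2 (Or.inr (Or.inr hv)), ?_⟩
        have := hT.2.1 v hv
        rwa [subAt, if_neg this.ne', if_neg this.not_gt]
    · rintro ⟨v, hv, h⟩
      rcases mem_verts_node.1 hv with hv | hv | hv
      · subst hv
        left
        simpa [subAt] using h
      · have := hT.1 v hv
        rw [subAt, if_neg this.ne, if_pos this] at h
        exact Or.inr (Or.inl ⟨v, hv, h⟩)
      · have := hT.2.1 v hv
        rw [subAt, if_neg this.ne', if_neg this.not_gt] at h
        exact Or.inr (Or.inr ⟨v, hv, h⟩)

/-- The map `f` embeds the pattern `(p, e)` into `T`. -/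
def Emb (e : ℕ → Bool) (p T : BTree) (f : ℕ → ℕ) : Prop :=
  Set.MapsTo f (verts p) (verts T) ∧
  Set.InjOn f (verts p) ∧
  ∀ i ∈ verts p, ∀ q ∈ verts p,
    (leftChild p q = some i →
      (e i = true → leftChild T (f q) = some (f i)) ∧
      (e i = false → f i ∈ verts (leftSub (subAt T (f q))))) ∧
    (rightChild p q = some i →
      (e i = true → rightChild T (f q) = some (f i)) ∧
      (e i = false → f i ∈ verts (rightSub (subAt T (f q)))))

theorem Emb.left {e : ℕ → Bool} {i : ℕ} {pl pr T : BTree} {f : ℕ → ℕ}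
    (hp : IsSearch (node i pl pr)) (h : Emb e (node i pl pr) T f) : Emb e pl T f := by
  have hs : verts pl ⊆ verts (node i pl pr) := fun x hx => mem_verts_node.2 (Or.inr (Or.inl hx))
  refine ⟨fun x hx => h.1 (hs hx), h.2.1.mono (by exact_mod_cast hs), fun j hj q hq => ?_⟩
  have hlt := hp.1 q hq
  have := h.2.2 j (hs hj) q (hs hq)
  rwa [leftChild_node, rightChild_node, if_neg hlt.ne, if_pos hlt, if_neg hlt.ne, if_pos hlt]
    at this

theorem Emb.right {e : ℕ → Bool} {i : ℕ} {pl pr T : BTree} {f : ℕ → ℕ}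
    (hp : IsSearch (node i pl pr)) (h : Emb e (node i pl pr) T f) : Emb e pr T f := by
  have hs : verts pr ⊆ verts (node i pl pr) := fun x hx => mem_verts_node.2 (Or.inr (Or.inr hx))
  refine ⟨fun x hx => h.1 (hs hx), h.2.1.mono (by exact_mod_cast hs), fun j hj q hq => ?_⟩
  have hlt := hp.2.1 q hq
  have := h.2.2 j (hs hj) q (hs hq)
  rwa [leftChild_node, rightChild_node, if_neg hlt.ne', if_neg hlt.not_gt, if_neg hlt.ne',
    if_neg hlt.not_gt] at this

/-- An embedding of a pattern gives an occurrence at the image of its root. -/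
theorem Emb.occAt {e : ℕ → Bool} {T : BTree} (hT : IsSearch T) {f : ℕ → ℕ} {p : BTree}
    (hp : IsSearch p) (h : Emb e p T f) {c : ℕ} (hc : root? p = some c) :
    OccAt e p (subAt T (f c)) := by
  induction p generalizing c with
  | nil => trivial
  | node i pl pr ihl ihr =>
    simp only [root?, Option.some.injEq] at hc
    subst hc
    have hi : i ∈ verts (node i pl pr) := mem_verts_node.2 (Or.inl rfl)
    refine ⟨?_, ?_, ?_⟩
    · obtain ⟨l, r, hlr⟩ := exists_subAt_eq_node hT (h.1 hi)
      simp [hlr]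
    · unfold Link
      split
      · trivial
      · rename_i d hd
        have hdm : d ∈ verts (node i pl pr) :=
          mem_verts_node.2 (Or.inr (Or.inl (mem_verts_of_root hd)))
        have h1 := (h.2.2 d hdm i hi).1 (by rw [leftChild_node, if_pos rfl, hd])
        have h2 := ihl hp.2.2.1 (h.left hp) hd
        cases hed : e d
        · have h3 := h1.2 hed
          rw [if_neg (by simp), anySub_iff (isSearch_leftSub (isSearch_subAt hT _))]
          exact ⟨f d, h3, by rwa [subAt_leftSub_subAt hT h3]⟩
        · rw [if_pos rfl, leftSub_subAt_eq hT (h1.1 hed)]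
          exact h2
    · unfold Link
      split
      · trivial
      · rename_i d hd
        have hdm : d ∈ verts (node i pl pr) :=
          mem_verts_node.2 (Or.inr (Or.inr (mem_verts_of_root hd)))
        have h1 := (h.2.2 d hdm i hi).2 (by rw [rightChild_node, if_pos rfl, hd])
        have h2 := ihr hp.2.2.2 (h.right hp) hd
        cases hed : e d
        · have h3 := h1.2 hed
          rw [if_neg (by simp), anySub_iff (isSearch_rightSub (isSearch_subAt hT _))]
          exact ⟨f d, h3, by rwa [subAt_rightSub_subAt hT h3]⟩
        · rw [if_pos rfl, rightSub_subAt_eq hT (h1.1 hed)]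
          exact h2

theorem emb_nil (e : ℕ → Bool) (T : BTree) (f : ℕ → ℕ) : Emb e nil T f :=
  ⟨fun x hx => by simp [verts] at hx, fun x hx => by simp [verts] at hx,
    fun i hi => by simp [verts] at hi⟩

theorem Emb.of_subAt {e : ℕ → Bool} {T p : BTree} (hT : IsSearch T) {f : ℕ → ℕ} {v : ℕ}
    (h : Emb e p (subAt T v) f) : Emb e p T f := by
  refine ⟨fun x hx => verts_subAt_subset _ _ (h.1 hx), h.2.1, fun i hi q hq => ?_⟩
  have := h.2.2 i hi q hq
  rwa [leftChild.eq_1 (subAt T v), rightChild.eq_1 (subAt T v), subAt_subAt hT (h.1 hq)] at this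

theorem link_nil (e : ℕ → Bool) (Q : BTree → Prop) (t : BTree) : Link e nil Q t := trivial

theorem link_node (e : ℕ → Bool) (c : ℕ) (pl pr : BTree) (Q : BTree → Prop) (t : BTree) :
    Link e (node c pl pr) Q t = if e c = true then Q t else AnySub Q t := rfl

/-- An occurrence at the root is given by an embedding. The embeddings of the two subtrees of the
pattern can be glued, since their images lie on different sides of the root of `t`. -/
theorem OccAt.exists_emb {e : ℕ → Bool} {p t : BTree} (hp : IsSearch p) (ht : IsSearch t)
    (h : OccAt e p t) : ∃ f, Emb e p t f ∧ ∀ c, root? p = some c → root? t = some (f c) := by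
  induction p generalizing t with
  | nil => exact ⟨id, emb_nil e _ id, by simp [root?]⟩
  | node i pl pr ihl ihr =>
    obtain ⟨hne, hl, hr⟩ := h
    cases t with
    | nil => exact absurd rfl hne
    | node v l r =>
      -- the same for a subtree `q` of the pattern below an edge that leads to the subtree `s`
      have key : ∀ (q s : BTree), IsSearch q → IsSearch s → Link e q (OccAt e q) s →
          (∀ {t : BTree}, IsSearch t → OccAt e q t →
            ∃ f, Emb e q t f ∧ ∀ c, root? q = some c → root? t = some (f c)) →
          ∃ f, Emb e q s f ∧ ∀ c, root? q = some c → e c = true → root? s = some (f c) := by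
        intro q s hq hs hlink ih
        cases q with
        | nil => exact ⟨id, emb_nil e _ id, by simp [root?]⟩
        | node c ql qr =>
          rw [link_node] at hlink
          split_ifs at hlink with hc
          · obtain ⟨f, hf, hf'⟩ := ih hs hlink
            exact ⟨f, hf, fun d hd _ => hf' d hd⟩
          · obtain ⟨w, hw, hw'⟩ := (anySub_iff hs).1 hlink
            obtain ⟨f, hf, hf'⟩ := ih (isSearch_subAt hs w) hw'
            refine ⟨f, hf.of_subAt hs, fun d hd hd' => ?_⟩
            simp only [root?, Option.some.injEq] at hd
            exact absurd (hd ▸ hd') hc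
      obtain ⟨fl, hfl, hfl'⟩ := key pl l hp.2.2.1 ht.2.2.1 hl (fun h1 h2 => ihl hp.2.2.1 h1 h2)
      obtain ⟨fr, hfr, hfr'⟩ := key pr r hp.2.2.2 ht.2.2.2 hr (fun h1 h2 => ihr hp.2.2.2 h1 h2)
      let f : ℕ → ℕ := fun x => if x = i then v else if x < i then fl x else fr x
      have fi : f i = v := by simp [f]
      have fL : ∀ x ∈ verts pl, f x = fl x := fun x hx => by
        have := hp.1 x hx
        simp [f, this, this.ne]
      have fR : ∀ x ∈ verts pr, f x = fr x := fun x hx => by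
        have := hp.2.1 x hx
        simp [f, this.not_gt, this.ne']
      have hL : ∀ x ∈ verts pl, f x ∈ verts l := fun x hx => by rw [fL x hx]; exact hfl.1 hx
      have hR : ∀ x ∈ verts pr, f x ∈ verts r := fun x hx => by rw [fR x hx]; exact hfr.1 hx
      have hL' : ∀ x ∈ verts pl, f x < v := fun x hx => ht.1 _ (hL x hx)
      have hR' : ∀ x ∈ verts pr, v < f x := fun x hx => ht.2.1 _ (hR x hx)
      refine ⟨f, ⟨?_, ?_, ?_⟩, ?_⟩
      · intro x hx
        rcases mem_verts_node.1 hx with rfl | hx | hx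
        · rw [fi]; exact mem_verts_node.2 (Or.inl rfl)
        · exact mem_verts_node.2 (Or.inr (Or.inl (hL x hx)))
        · exact mem_verts_node.2 (Or.inr (Or.inr (hR x hx)))
      · intro x hx y hy hxy
        rcases mem_verts_node.1 hx with hx | hx | hx <;>
          rcases mem_verts_node.1 hy with hy | hy | hy
        · rw [hx, hy]
        · rw [hx, fi] at hxy; have := hL' y hy; omega
        · rw [hx, fi] at hxy; have := hR' y hy; omega
        · rw [hy, fi] at hxy; have := hL' x hx; omega
        · rw [fL x hx, fL y hy] at hxy; exact hfl.2.1 hx hy hxy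
        · have := hL' x hx; have := hR' y hy; omega
        · rw [hy, fi] at hxy; have := hR' x hx; omega
        · have := hR' x hx; have := hL' y hy; omega
        · rw [fR x hx, fR y hy] at hxy; exact hfr.2.1 hx hy hxy
      · intro j hj q hq
        rw [leftChild_node, rightChild_node]
        rcases mem_verts_node.1 hq with rfl | hq | hq
        · rw [if_pos rfl, if_pos rfl, fi, leftChild_node, rightChild_node, if_pos rfl, if_pos rfl,
            subAt, if_pos rfl]
          refine ⟨fun h => ?_, fun h => ?_⟩
          · have hm := mem_verts_of_root h
            refine ⟨fun he => ?_, fun _ => hL j hm⟩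
            rw [fL j hm]; exact hfl' j h he
          · have hm := mem_verts_of_root h
            refine ⟨fun he => ?_, fun _ => hR j hm⟩
            rw [fR j hm]; exact hfr' j h he
        · have hlt := hp.1 q hq
          have hlt' := hL' q hq
          rw [if_neg hlt.ne, if_neg hlt.ne, if_pos hlt, if_pos hlt, leftChild_node, rightChild_node,
            if_neg hlt'.ne, if_neg hlt'.ne, if_pos hlt', if_pos hlt', subAt, if_neg hlt'.ne,
            if_pos hlt', fL q hq]
          refine ⟨fun h => ?_, fun h => ?_⟩
          · have hm := leftChild_mem h
            rw [fL j hm]; exact (hfl.2.2 j hm q hq).1 h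
          · have hm := rightChild_mem h
            rw [fL j hm]; exact (hfl.2.2 j hm q hq).2 h
        · have hlt := hp.2.1 q hq
          have hlt' := hR' q hq
          rw [if_neg hlt.ne', if_neg hlt.ne', if_neg hlt.not_gt, if_neg hlt.not_gt, leftChild_node,
            rightChild_node, if_neg hlt'.ne', if_neg hlt'.ne', if_neg hlt'.not_gt,
            if_neg hlt'.not_gt, subAt, if_neg hlt'.ne', if_neg hlt'.not_gt, fR q hq]
          refine ⟨fun h => ?_, fun h => ?_⟩
          · have hm := leftChild_mem h
            rw [fR j hm]; exact (hfr.2.2 j hm q hq).1 h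
          · have hm := rightChild_mem h
            rw [fR j hm]; exact (hfr.2.2 j hm q hq).2 h
      · intro c hc
        simp only [root?, Option.some.injEq] at hc ⊢
        rw [← hc, fi]

/-- Containment of a nonempty pattern is decided by recursion on the pattern and the tree. -/
theorem contains_iff {T : BTree} (hT : IsSearch T) {P : TreePattern} (hP : P.tree ≠ nil) :
    Contains T P ↔ AnySub (OccAt P.e P.tree) T := by
  have hs : IsSearch P.tree := P.tree_mem.1
  rw [anySub_iff hT]
  constructor
  · rintro ⟨f, hf⟩
    obtain ⟨c, hc⟩ : ∃ c, root? P.tree = some c :=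
      Option.ne_none_iff_exists'.1 (fun h => hP (root?_eq_none.1 h))
    exact ⟨f c, hf.1 (mem_verts_of_root hc), Emb.occAt hT hs hf hc⟩
  · rintro ⟨v, _, h⟩
    obtain ⟨f, hf, _⟩ := h.exists_emb hs (isSearch_subAt hT v)
    exact ⟨f, hf.of_subAt hT⟩

/-! ### Inserting the largest vertex -/

/-- The tree that arises from `T` by inserting the vertex `n`, larger than all vertices of `T`, at
distance `m` from the root on the right branch; the subtree that was there becomes its left
subtree. -/
def ins (n : ℕ) : ℕ → BTree → BTree
  | 0, t => node n t nil
  | _ + 1, nil => node n nil nil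
  | m + 1, node a l r => node a l (ins n m r)

/-- The tree that arises from `T` by appending the leaf `n` at the end of the right branch. -/
def bot (n : ℕ) : BTree → BTree
  | nil => node n nil nil
  | node a l r => node a l (bot n r)

/-- The number of vertices on the right branch. -/
def rlen : BTree → ℕ
  | nil => 0
  | node _ _ r => rlen r + 1

theorem ins_rlen (n : ℕ) (t : BTree) : ins n (rlen t) t = bot n t := by
  induction t with
  | nil => rfl
  | node a l r _ ih => simp [ins, rlen, bot, ih]

/-- The last edge of the right branch is the only one that may be contiguous, and below it the
left edge is then not contiguous; moreover the last vertex of the branch has a left child. These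
are the properties of a friendly pattern that its right subtrees inherit. -/
def Tame (e : ℕ → Bool) : BTree → Prop
  | nil => False
  | node _ pl nil => pl ≠ nil
  | node _ _ (node c ql qr) =>
      Tame e (node c ql qr) ∧
        (e c = true → qr = nil ∧ ∀ d, root? ql = some d → e d = false)

theorem OccAt.anySub {e : ℕ → Bool} {p t : BTree} (hp : p ≠ nil) (h : OccAt e p t) :
    AnySub (OccAt e p) t := by
  cases p with
  | nil => exact absurd rfl hp
  | node i pl pr =>
    cases t with
    | nil => exact absurd rfl h.1
    | node a l r => exact Or.inl h

/-- An occurrence of a pattern whose right branch ends with a vertex that has a left child cannot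
use a leaf at the end of the right branch. -/
theorem OccAt.of_bot {e : ℕ → Bool} {n : ℕ} {p t : BTree} (hp : Tame e p)
    (h : OccAt e p (FriendlyTrees.bot n t)) : OccAt e p t := by
  induction p generalizing t with
  | nil => trivial
  | node i pl pr _ ihr =>
    obtain ⟨-, hl, hr⟩ := h
    -- no nonempty part of the pattern fits into the empty subtrees of the new leaf
    have hleaf : ∀ (q : BTree), q ≠ nil → ¬ Link e q (OccAt e q) nil := by
      intro q hq hk
      cases q with
      | nil => exact hq rfl
      | node c ql qr =>
        rw [link_node] at hk
        split_ifs at hk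
        · exact hk.1 rfl
        · exact hk
    cases t with
    | nil =>
      cases pr with
      | nil => exact absurd hl (hleaf _ hp)
      | node c ql qr => exact absurd hr (hleaf _ (by simp))
    | node a l r =>
      refine ⟨by simp, hl, ?_⟩
      cases pr with
      | nil => trivial
      | node c ql qr =>
        change Link e (node c ql qr) _ (FriendlyTrees.bot n r) at hr
        change Link e (node c ql qr) _ r
        rw [link_node] at hr ⊢
        split_ifs at hr ⊢ with hc
        · exact ihr hp.1 hr
        · clear hc hl
          induction r with
          | nil =>
            rcases hr with hr | hr | hr
            · exact absurd (ihr (t := nil) hp.1 hr).1 (by simp)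
            · exact hr
            · exact hr
          | node b x y _ ihy =>
            rcases hr with hr | hr | hr
            · exact Or.inl (ihr (t := node b x y) hp.1 hr)
            · exact Or.inr (Or.inl hr)
            · exact Or.inr (Or.inr (ihy hr))

theorem AnySub.of_bot {e : ℕ → Bool} {n : ℕ} {p t : BTree} (hp : Tame e p)
    (h : AnySub (OccAt e p) (FriendlyTrees.bot n t)) : AnySub (OccAt e p) t := by
  have hne : p ≠ nil := by rintro rfl; exact hp
  induction t with
  | nil =>
    rcases h with h | h | h
    · exact (OccAt.of_bot (t := nil) hp h).anySub hne
    · exact h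
    · exact h
  | node a l r _ ihr =>
    rcases h with h | h | h
    · exact (OccAt.of_bot (t := node a l r) hp h).anySub hne
    · exact Or.inr (Or.inl h)
    · exact Or.inr (Or.inr (ihr h))

/-- The vertex inserted at the root cannot be used by a pattern whose root has a right child. -/
theorem AnySub.of_top {e : ℕ → Bool} {n i : ℕ} {pl pr t : BTree} (hpr : pr ≠ nil)
    (h : AnySub (OccAt e (node i pl pr)) (node n t nil)) : AnySub (OccAt e (node i pl pr)) t := by
  rcases h with h | h | h
  · obtain ⟨-, -, h⟩ := h
    cases pr with
    | nil => exact absurd rfl hpr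
    | node c ql qr =>
      rw [link_node] at h
      split_ifs at h
      · exact absurd rfl h.1
      · exact h.elim
  · exact h
  · exact h.elim

/-- Inserting the largest vertex does not destroy occurrences of tame patterns: if it is inserted
into an edge used contiguously by the pattern, then it can take the role of the lower endpoint. -/
theorem OccAt.ins_succ {e : ℕ → Bool} {n : ℕ} {p t : BTree} (hp : Tame e p) (m : ℕ)
    (h : OccAt e p t) : OccAt e p (ins n (m + 1) t) := by
  induction p generalizing t m with
  | nil => trivial
  | node i pl pr _ ihr =>
    obtain ⟨hne, hl, hr⟩ := h
    cases t with
    | nil => exact absurd rfl hne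
    | node a l r =>
      refine ⟨by simp [ins], hl, ?_⟩
      cases pr with
      | nil => trivial
      | node c ql qr =>
        obtain ⟨hp1, hp2⟩ := hp
        change Link e (node c ql qr) _ r at hr
        change Link e (node c ql qr) _ (ins n m r)
        rw [link_node] at hr ⊢
        split_ifs at hr ⊢ with hc
        · cases m with
          | succ m => exact ihr hp1 m hr
          | zero =>
            -- `n` becomes the right child of the root and takes the role of `c`; the left edge of
            -- `c` is not contiguous, so its lower endpoint may stay where it is
            obtain ⟨rfl, hd⟩ := hp2 hc
            refine ⟨by simp [ins], ?_, trivial⟩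
            cases ql with
            | nil => trivial
            | node d xl xr =>
              obtain ⟨-, hx, -⟩ := hr
              rw [link_node, hd d rfl] at hx ⊢
              simp only [Bool.false_eq_true, if_false] at hx ⊢
              cases r with
              | nil => exact hx.elim
              | node b x y => exact Or.inr (Or.inl hx)
        · clear hc hl hne
          induction r generalizing m with
          | nil => exact hr.elim
          | node b x y _ ihy =>
            cases m with
            | zero => exact Or.inr (Or.inl hr)
            | succ m =>
              rcases hr with hr | hr | hr
              · exact Or.inl (ihr (t := node b x y) hp1 m hr)
              · exact Or.inr (Or.inl hr)
              · exact Or.inr (Or.inr (ihy m hr))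

theorem AnySub.ins {e : ℕ → Bool} {n : ℕ} {p t : BTree} (hp : Tame e p) (m : ℕ)
    (h : AnySub (OccAt e p) t) : AnySub (OccAt e p) (FriendlyTrees.ins n m t) := by
  induction t generalizing m with
  | nil => exact h.elim
  | node a l r _ ihr =>
    cases m with
    | zero => exact Or.inr (Or.inl h)
    | succ m =>
      rcases h with h | h | h
      · exact Or.inl (OccAt.ins_succ (t := node a l r) hp m h)
      · exact Or.inr (Or.inl h)
      · exact Or.inr (Or.inr (ihr m h))

/-! ### Languages closed under insertion and deletion of the largest vertex -/

theorem mem_verts_of_mem_rightBranch {t : BTree} {x : ℕ} (h : x ∈ rightBranch t) :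
    x ∈ verts t := by
  induction t with
  | nil => simp [rightBranch] at h
  | node a l r _ ih =>
    rw [rightBranch, List.mem_cons] at h
    exact mem_verts_node.2 (h.imp id (fun h => Or.inr (ih h)))

/-- In a search tree the largest vertex `k` is the last vertex of the right branch, so the
conditions on `k` are conditions on the end of this branch. -/
theorem tame_of_branch {e : ℕ → Bool} {k : ℕ} {p : BTree} (hp : IsSearch p) (hk : k ∈ verts p)
    (hmax : ∀ x ∈ verts p, x ≤ k) (hleft : leftChild p k ≠ none)
    (hbranch : ∀ j ∈ (rightBranch p).dropLast, root? p ≠ some j → e j = false)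
    (hlast : e k = true → ∀ c, leftChild p k = some c → e c = false) : Tame e p := by
  induction p with
  | nil => simp [verts] at hk
  | node i pl pr _ ihr =>
    cases pr with
    | nil =>
      have : k = i := by
        rcases mem_verts_node.1 hk with h | h | h
        · exact h
        · have := hp.1 k h
          have := hmax i (mem_verts_node.2 (Or.inl rfl))
          omega
        · simp [verts] at h
      subst this
      rintro rfl
      simp [leftChild_node, root?] at hleft
    | node c ql qr =>
      have hcr : c ∈ verts (node c ql qr) := mem_verts_node.2 (Or.inl rfl)
      have hic : i < c := hp.2.1 c hcr
      have hck : c ≤ k := hmax c (mem_verts_node.2 (Or.inr (Or.inr hcr)))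
      have hkr : k ∈ verts (node c ql qr) := by
        rcases mem_verts_node.1 hk with h | h | h
        · omega
        · have := hp.1 k h; omega
        · exact h
      have hlk : leftChild (node i pl (node c ql qr)) k = leftChild (node c ql qr) k := by
        rw [leftChild_node, if_neg (by omega), if_neg (by omega)]
      rw [hlk] at hleft hlast
      have hmax' : ∀ x ∈ verts (node c ql qr), x ≤ k :=
        fun x hx => hmax x (mem_verts_node.2 (Or.inr (Or.inr hx)))
      refine ⟨ihr hp.2.2.2 hkr hmax' hleft (fun j hj hne => ?_) hlast, fun hc => ?_⟩
      · have hij := hp.2.1 j (mem_verts_of_mem_rightBranch (List.dropLast_subset _ hj))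
        refine hbranch j ?_ (by simp only [root?, ne_eq, Option.some.injEq]; omega)
        rw [rightBranch] at hj ⊢
        rw [rightBranch, List.dropLast_cons_of_ne_nil (by simp)]
        exact List.mem_cons_of_mem _ hj
      · have hqr : qr = nil := by
          cases qr with
          | nil => rfl
          | node d xl xr =>
            have := hbranch c (by simp [rightBranch]) (by
              simp only [root?, ne_eq, Option.some.injEq]; omega)
            simp [hc] at this
        subst hqr
        have hkc : k = c := by
          rcases mem_verts_node.1 hkr with h | h | h
          · exact h
          · have := hp.2.2.2.1 k h; omega
          · simp [verts] at h
        subst hkc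
        refine ⟨rfl, fun d hd => hlast hc d ?_⟩
        rw [leftChild_node, if_pos rfl, hd]

/-- What the closure properties need from a friendly pattern. -/
theorem TreePattern.Friendly.tame {P : TreePattern} (h : P.Friendly) :
    ∃ i pl pr, P.tree = node i pl pr ∧ pr ≠ nil ∧ Tame P.e P.tree := by
  obtain ⟨hs, hv⟩ := P.tree_mem
  have hk : P.k ∈ verts P.tree := by
    by_contra hk
    exact h.left_ne (by rw [leftChild, subAt_eq_nil hs hk]; rfl)
  have hmax : ∀ x ∈ verts P.tree, x ≤ P.k := fun x hx => by
    rw [hv, Finset.mem_Icc] at hx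
    exact hx.2
  have ht := tame_of_branch hs hk hmax h.left_ne h.branch h.last
  have hpar := h.parent_ne
  revert hs hk hmax ht hpar
  generalize P.tree = p
  intro hs hk hmax ht hpar
  cases p with
  | nil => exact ht.elim
  | node i pl pr =>
    refine ⟨i, pl, pr, rfl, ?_, ht⟩
    rintro rfl
    have hki : P.k = i := by
      rcases mem_verts_node.1 hk with h | h | h
      · exact h
      · have := hs.1 _ h
        have := hmax i (mem_verts_node.2 (Or.inl rfl))
        omega
      · simp [verts] at h
    have hne : root? pl ≠ some P.k := fun h' => by
      have := hs.1 _ (mem_verts_of_root h')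
      omega
    rw [parent, if_neg (not_or.2 ⟨hne, by simp [root?]⟩), if_neg (by omega)] at hpar
    exact hpar rfl

theorem verts_ins (n m : ℕ) (t : BTree) : verts (ins n m t) = insert n (verts t) := by
  induction t generalizing m with
  | nil => cases m <;> simp [ins, verts]
  | node a l r _ ih =>
    cases m with
    | zero => simp [ins, verts]
    | succ m =>
      rw [ins, verts, ih, verts]
      ext x
      simp only [Finset.mem_insert, Finset.mem_union]
      tauto

theorem isSearch_ins {n m : ℕ} {t : BTree} (ht : IsSearch t) (hn : ∀ x ∈ verts t, x < n) :
    IsSearch (ins n m t) := by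
  induction t generalizing m with
  | nil => cases m <;> simp [ins, IsSearch, verts]
  | node a l r _ ih =>
    cases m with
    | zero => exact ⟨hn, by simp [verts], ht, trivial⟩
    | succ m =>
      refine ⟨ht.1, fun x hx => ?_, ht.2.2.1,
        ih ht.2.2.2 (fun x hx => hn x (mem_verts_node.2 (Or.inr (Or.inr hx))))⟩
      rw [verts_ins, Finset.mem_insert] at hx
      rcases hx with rfl | hx
      · exact hn a (mem_verts_node.2 (Or.inl rfl))
      · exact ht.2.1 x hx

theorem lt_succ_of_mem_onVertices {n : ℕ} {T : BTree} (hT : T ∈ onVertices n) :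
    ∀ x ∈ verts T, x < n + 1 := fun x hx => by
  rw [hT.2, Finset.mem_Icc] at hx
  omega

theorem ins_mem_onVertices {n m : ℕ} {T : BTree} (hT : T ∈ onVertices n) :
    ins (n + 1) m T ∈ onVertices (n + 1) := by
  refine ⟨isSearch_ins hT.1 (lt_succ_of_mem_onVertices hT), ?_⟩
  rw [verts_ins, hT.2]
  ext x
  simp only [Finset.mem_insert, Finset.mem_Icc]
  omega

/-- Every tree arises from the tree without its largest vertex by inserting that vertex. -/
theorem exists_eq_ins {N : ℕ} {T : BTree} (hT : IsSearch T) (hN : N ∈ verts T)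
    (hmax : ∀ x ∈ verts T, x ≤ N) :
    ∃ m t, m ≤ rlen t ∧ T = ins N m t ∧ IsSearch t ∧ ∀ x ∈ verts t, x < N := by
  induction T with
  | nil => simp [verts] at hN
  | node a l r _ ih =>
    rcases mem_verts_node.1 hN with h | h | h
    · subst h
      have hr : r = nil := by
        cases r with
        | nil => rfl
        | node b x y =>
          have hb : b ∈ verts (node b x y) := mem_verts_node.2 (Or.inl rfl)
          have := hT.2.1 b hb
          have := hmax b (mem_verts_node.2 (Or.inr (Or.inr hb)))
          omega
      subst hr
      exact ⟨0, l, Nat.zero_le _, rfl, hT.2.2.1, hT.1⟩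
    · have := hT.1 N h
      have := hmax a (mem_verts_node.2 (Or.inl rfl))
      omega
    · obtain ⟨m, t, hm, rfl, hs, hlt⟩ := ih hT.2.2.2 h
        (fun x hx => hmax x (mem_verts_node.2 (Or.inr (Or.inr hx))))
      have haN := hT.2.1 N h
      refine ⟨m + 1, node a l t, by rw [rlen]; omega, rfl,
        ⟨hT.1, fun x hx => hT.2.1 x ?_, hT.2.2.1, hs⟩, fun x hx => ?_⟩
      · rw [verts_ins]; exact Finset.mem_insert_of_mem hx
      · rcases mem_verts_node.1 hx with rfl | hx | hx
        · exact haN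
        · exact (hT.1 x hx).trans haN
        · exact hlt x hx

theorem exists_eq_ins_of_mem {n : ℕ} {T : BTree} (hT : T ∈ onVertices (n + 1)) :
    ∃ m t, m ≤ rlen t ∧ T = ins (n + 1) m t ∧ t ∈ onVertices n := by
  obtain ⟨hs, hv⟩ := hT
  obtain ⟨m, t, hm, rfl, ht, hlt⟩ := exists_eq_ins (N := n + 1) hs (by rw [hv]; simp)
    (fun x hx => by rw [hv, Finset.mem_Icc] at hx; exact hx.2)
  refine ⟨m, t, hm, rfl, ht, ?_⟩
  rw [verts_ins] at hv
  ext x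
  have hx := Finset.ext_iff.1 hv x
  simp only [Finset.mem_insert, Finset.mem_Icc] at hx ⊢
  constructor
  · intro h
    have := hlt x h
    have := hx.1 (Or.inr h)
    omega
  · intro h
    rcases hx.2 (by omega) with h' | h'
    · omega
    · exact h'

/-- The tree without the last vertex of its right branch, which is replaced by its left subtree. -/
def del : BTree → BTree
  | nil => nil
  | node _ l nil => l
  | node a l (node b x y) => node a l (del (node b x y))

theorem ins_ne_nil (n m : ℕ) (t : BTree) : ins n m t ≠ nil := by
  cases m <;> cases t <;> simp [ins]

theorem del_ins {n m : ℕ} {t : BTree} (hm : m ≤ rlen t) : del (ins n m t) = t := by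
  induction t generalizing m with
  | nil =>
    obtain rfl : m = 0 := by simpa [rlen] using hm
    rfl
  | node a l r _ ih =>
    cases m with
    | zero => rfl
    | succ m =>
      have h := ih (m := m) (by simpa [rlen] using hm)
      rw [ins]
      cases hr : ins n m r with
      | nil => exact absurd hr (ins_ne_nil n m r)
      | node b x y => rw [del, ← hr, h]

theorem rlen_ins {n m : ℕ} {t : BTree} (hm : m ≤ rlen t) : rlen (ins n m t) = m + 1 := by
  induction t generalizing m with
  | nil =>
    obtain rfl : m = 0 := by simpa [rlen] using hm
    rfl
  | node a l r _ ih =>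
    cases m with
    | zero => rfl
    | succ m => rw [ins, rlen, ih (by simpa [rlen] using hm)]

theorem ins_inj {n m m' : ℕ} {t t' : BTree} (hm : m ≤ rlen t) (hm' : m' ≤ rlen t')
    (h : ins n m t = ins n m' t') : m = m' ∧ t = t' := by
  refine ⟨?_, by rw [← del_ins hm, h, del_ins hm']⟩
  have := rlen_ins (n := n) hm
  rw [h, rlen_ins hm'] at this
  omega

/-- A family of sets of trees is a zigzag language if deleting the largest vertex does not lead out
of it, and inserting a new largest vertex at the top or at the bottom does not either. -/
structure Zigzag (L : ℕ → Set BTree) : Prop where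
  sub : ∀ n, L n ⊆ onVertices n
  one : node 1 nil nil ∈ L 1
  top : ∀ n, ∀ T ∈ L n, node (n + 1) T nil ∈ L (n + 1)
  bot : ∀ n, ∀ T ∈ L n, bot (n + 1) T ∈ L (n + 1)
  del : ∀ n m T, T ∈ onVertices n → ins (n + 1) m T ∈ L (n + 1) → T ∈ L n

/-- Tameness of the patterns gives the closure under deletion and under insertion at the bottom, and
the closure under insertion at the top holds since the root of a pattern has a right child. -/
theorem zigzag_avoiders {pats : List TreePattern} (hp : ∀ P ∈ pats, P.Friendly) :
    Zigzag (fun n => avoiders n pats) := by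
  have hc : ∀ P ∈ pats, ∀ T : BTree, IsSearch T →
      (Contains T P ↔ AnySub (OccAt P.e P.tree) T) := fun P hP T hT => by
    obtain ⟨i, pl, pr, h, -⟩ := (hp P hP).tame
    exact contains_iff hT (by rw [h]; simp)
  have htop : ∀ n, ∀ T ∈ avoiders n pats, node (n + 1) T nil ∈ avoiders (n + 1) pats := by
    intro n T hT
    have hm : node (n + 1) T nil ∈ onVertices (n + 1) := ins_mem_onVertices (m := 0) hT.1
    refine ⟨hm, fun P hP h => hT.2 P hP ?_⟩
    obtain ⟨i, pl, pr, h', hpr, -⟩ := (hp P hP).tame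
    rw [hc P hP _ hm.1, h'] at h
    rw [hc P hP _ hT.1.1, h']
    exact h.of_top hpr
  refine ⟨fun n T hT => hT.1, htop 0 nil ⟨⟨trivial, rfl⟩, fun P hP h => ?_⟩, htop, ?_, ?_⟩
  · rw [hc P hP nil trivial] at h
    exact h
  · intro n T hT
    have hm : FriendlyTrees.bot (n + 1) T ∈ onVertices (n + 1) := by
      rw [← ins_rlen]; exact ins_mem_onVertices hT.1
    refine ⟨hm, fun P hP h => hT.2 P hP ?_⟩
    obtain ⟨i, pl, pr, h', hpr, ht⟩ := (hp P hP).tame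
    rw [hc P hP _ hm.1] at h
    rw [hc P hP _ hT.1.1]
    exact AnySub.of_bot ht h
  · intro n m T hT hm
    refine ⟨hT, fun P hP h => hm.2 P hP ?_⟩
    obtain ⟨i, pl, pr, h', hpr, ht⟩ := (hp P hP).tame
    rw [hc P hP _ hm.1.1]
    rw [hc P hP _ hT.1] at h
    exact AnySub.ins ht m h

/-! ### Rotations -/

/-- The tree `T'` arises from `T` by an up-rotation of `j`, and `T` from `T'` by a down-rotation. -/
inductive UpStep (j : ℕ) : BTree → BTree → Prop
  | here (i : ℕ) (l y z : BTree) :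
      UpStep j (node i l (node j y z)) (node j (node i l y) z)
  | left {a : ℕ} {l l' : BTree} (r : BTree) (ha : j < a) (h : UpStep j l l') :
      UpStep j (node a l r) (node a l' r)
  | right {a : ℕ} (l : BTree) {r r' : BTree} (ha : a < j) (h : UpStep j r r') :
      UpStep j (node a l r) (node a l r')

theorem upRot_node_nil (j a : ℕ) (l : BTree) :
    upRot j (node a l nil) =
      if j < a then (upRot j l).map (fun l' => node a l' nil) else none := by
  rw [upRot]

theorem upRot_node_node (j a b : ℕ) (l y z : BTree) :
    upRot j (node a l (node b y z)) =
      if b = j then some (node j (node a l y) z)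
      else if j < a then (upRot j l).map (fun l' => node a l' (node b y z))
      else if a < j then (upRot j (node b y z)).map (fun r' => node a l r')
      else none := by
  rw [upRot]

theorem downRot_node (j a : ℕ) (l r : BTree) :
    downRot j (node a l r) =
      if j = a then
        match l with
        | node b x y => some (node b x (node a y r))
        | nil => none
      else if j < a then (downRot j l).map (fun l' => node a l' r)
      else (downRot j r).map (fun r' => node a l r') := by
  rw [downRot.eq_def]
  cases l <;> rfl

theorem upStep_of_upRot {j : ℕ} {T T' : BTree} (h : upRot j T = some T') : UpStep j T T' := by
  induction T generalizing T' with
  | nil => simp [upRot] at h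
  | node a l r ihl ihr =>
    cases r with
    | nil =>
      rw [upRot_node_nil] at h
      split_ifs at h with h1
      obtain ⟨l', hl, rfl⟩ := Option.map_eq_some_iff.1 h
      exact .left _ h1 (ihl hl)
    | node b y z =>
      rw [upRot_node_node] at h
      split_ifs at h with h1 h2 h3
      · subst h1
        obtain rfl := Option.some.inj h
        exact .here _ _ _ _
      · obtain ⟨l', hl, rfl⟩ := Option.map_eq_some_iff.1 h
        exact .left _ h2 (ihl hl)
      · obtain ⟨r', hr, rfl⟩ := Option.map_eq_some_iff.1 h
        exact .right _ h3 (ihr hr)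

theorem upStep_of_downRot {j : ℕ} {T T' : BTree} (h : downRot j T = some T') :
    UpStep j T' T := by
  induction T generalizing T' with
  | nil => simp [downRot] at h
  | node a l r ihl ihr =>
    rw [downRot_node] at h
    split_ifs at h with h1 h2
    · subst h1
      cases l with
      | nil => simp at h
      | node b x y =>
        obtain rfl := Option.some.inj h
        exact .here _ _ _ _
    · obtain ⟨l', hl, rfl⟩ := Option.map_eq_some_iff.1 h
      exact .left _ h2 (ihl hl)
    · obtain ⟨r', hr, rfl⟩ := Option.map_eq_some_iff.1 h
      exact .right _ (by omega) (ihr hr)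

theorem UpStep.verts_eq {j : ℕ} {T T' : BTree} (h : UpStep j T T') : verts T' = verts T := by
  induction h with
  | here i l y z => ext x; simp only [mem_verts_node]; tauto
  | left r _ _ ih => rw [verts, ih, verts]
  | right l _ _ ih => rw [verts, ih, verts]

theorem UpStep.mem {j : ℕ} {T T' : BTree} (h : UpStep j T T') : j ∈ verts T := by
  induction h with
  | here i l y z => simp [verts]
  | left r _ _ ih => exact mem_verts_node.2 (Or.inr (Or.inl ih))
  | right l _ _ ih => exact mem_verts_node.2 (Or.inr (Or.inr ih))

theorem UpStep.isSearch_iff {j : ℕ} {T T' : BTree} (h : UpStep j T T') :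
    IsSearch T' ↔ IsSearch T := by
  induction h with
  | here i l y z =>
    simp only [IsSearch, mem_verts_node]
    constructor
    · rintro ⟨h1, h2, ⟨h3, h4, h5, h6⟩, h7⟩
      have hij := h1 i (Or.inl rfl)
      refine ⟨h3, ?_, h5, fun x hx => h1 x (Or.inr (Or.inr hx)), h2, h6, h7⟩
      rintro x (rfl | hx | hx)
      · exact hij
      · exact h4 x hx
      · exact hij.trans (h2 x hx)
    · rintro ⟨h1, h2, h3, h4, h5, h6, h7⟩
      have hij := h2 j (Or.inl rfl)
      refine ⟨?_, h5, ⟨h1, fun x hx => h2 x (Or.inr (Or.inl hx)), h3, h6⟩, h7⟩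
      rintro x (rfl | hx | hx)
      · exact hij
      · exact (h1 x hx).trans hij
      · exact h4 x hx
  | left r _ h ih => simp only [IsSearch, h.verts_eq, ih]
  | right l _ h ih => simp only [IsSearch, h.verts_eq, ih]

theorem mem_onVertices_of_rot {d : Dir} {j n : ℕ} {T T' : BTree} (h : rot d j T = some T')
    (hT : T ∈ onVertices n) : T' ∈ onVertices n := by
  cases d with
  | up =>
    have h := upStep_of_upRot h
    exact ⟨h.isSearch_iff.2 hT.1, h.verts_eq.trans hT.2⟩
  | down =>
    have h := upStep_of_downRot h
    exact ⟨h.isSearch_iff.1 hT.1, h.verts_eq.symm.trans hT.2⟩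

theorem mem_of_rot {d : Dir} {j : ℕ} {T T' : BTree} (h : rot d j T = some T') : j ∈ verts T := by
  cases d with
  | up => exact (upStep_of_upRot h).mem
  | down =>
    have h := upStep_of_downRot h
    rw [h.verts_eq]
    exact h.mem

theorem mem_of_slide {d : Dir} {j m : ℕ} {T T' : BTree} (hm : 1 ≤ m)
    (h : slide d j m T = some T') : j ∈ verts T := by
  obtain ⟨m, rfl⟩ : ∃ m', m = m' + 1 := ⟨m - 1, by omega⟩
  rw [slide, Option.bind_eq_some_iff] at h
  obtain ⟨T₁, h1, -⟩ := h
  exact mem_of_rot h1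

theorem mem_onVertices_of_slide {d : Dir} {j n m : ℕ} {T T' : BTree}
    (h : slide d j m T = some T') (hT : T ∈ onVertices n) : T' ∈ onVertices n := by
  induction m generalizing T with
  | zero => rw [slide, Option.some.injEq] at h; exact h ▸ hT
  | succ m ih =>
    rw [slide, Option.bind_eq_some_iff] at h
    obtain ⟨T₁, h1, h2⟩ := h
    exact ih h2 (mem_onVertices_of_rot h1 hT)

theorem upRot_ins_zero {n : ℕ} {t : BTree} : upRot n (ins n 0 t) = none := by
  rw [ins, upRot_node_nil, if_neg (lt_irrefl n)]

theorem upRot_ins_succ {n m : ℕ} {t : BTree} (hm : m + 1 ≤ rlen t) (hn : ∀ x ∈ verts t, x < n) :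
    upRot n (ins n (m + 1) t) = some (ins n m t) := by
  induction t generalizing m with
  | nil => simp [rlen] at hm
  | node a l r _ ih =>
    have ha := hn a (mem_verts_node.2 (Or.inl rfl))
    cases m with
    | zero => rw [ins, ins, ins, upRot_node_node, if_pos rfl]
    | succ m =>
      cases r with
      | nil => simp [rlen] at hm
      | node b y z =>
        have hb : b < n := hn b (by simp [verts])
        have h := ih (m := m) (by simpa [rlen] using hm)
          (fun x hx => hn x (mem_verts_node.2 (Or.inr (Or.inr hx))))
        rw [ins, ins, upRot_node_node, if_neg hb.ne, if_neg ha.not_gt, if_pos ha]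
        rw [ins] at h
        rw [h]
        rfl

theorem downRot_ins {n m : ℕ} {t : BTree} (hm : m + 1 ≤ rlen t) (hn : ∀ x ∈ verts t, x < n) :
    downRot n (ins n m t) = some (ins n (m + 1) t) := by
  induction t generalizing m with
  | nil => simp [rlen] at hm
  | node a l r _ ih =>
    have ha := hn a (mem_verts_node.2 (Or.inl rfl))
    cases m with
    | zero => rw [ins, ins, downRot_node, if_pos rfl, ins]
    | succ m =>
      rw [ins, downRot_node, if_neg ha.ne', if_neg ha.not_gt, ih (by simpa [rlen] using hm)
        (fun x hx => hn x (mem_verts_node.2 (Or.inr (Or.inr hx))))]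
      rfl

theorem downRot_bot {n : ℕ} {t : BTree} (hn : ∀ x ∈ verts t, x < n) :
    downRot n (bot n t) = none := by
  induction t with
  | nil => simp [bot, downRot_node]
  | node a l r _ ih =>
    have ha := hn a (mem_verts_node.2 (Or.inl rfl))
    rw [bot, downRot_node, if_neg ha.ne', if_neg ha.not_gt,
      ih (fun x hx => hn x (mem_verts_node.2 (Or.inr (Or.inr hx))))]
    rfl

/-- The tree with the new largest vertex `n` at the position where its slide in direction `d`
ends: at the root for an up-slide and at the bottom for a down-slide. -/
def ext (n : ℕ) : Dir → BTree → BTree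
  | .up, t => node n t nil
  | .down, t => bot n t

/-- The position of `n` in `ext n d t`. -/
def extPos : Dir → BTree → ℕ
  | .up, _ => 0
  | .down, t => rlen t

theorem ext_eq_ins (n : ℕ) (d : Dir) (t : BTree) : ext n d t = ins n (extPos d t) t := by
  cases d with
  | up => rfl
  | down => exact (ins_rlen n t).symm

theorem rot_bot {d : Dir} {j n : ℕ} {t : BTree} (hj : j < n) :
    rot d j (bot n t) = (rot d j t).map (bot n) := by
  cases d with
  | up =>
    change upRot j _ = (upRot j t).map _
    induction t with
    | nil => rw [bot, upRot_node_nil, if_pos hj]; rfl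
    | node a l r _ ihr =>
      cases r with
      | nil =>
        rw [bot, bot, upRot_node_node, upRot_node_nil, if_neg hj.ne', upRot_node_nil, if_pos hj]
        split_ifs
        · rw [Option.map_map]; rfl
        · rfl
        · rfl
      | node b y z =>
        rw [bot, upRot_node_node]
        have : bot n (node b y z) = node b y (bot n z) := rfl
        rw [this, upRot_node_node, ← this, ihr]
        split_ifs
        · rfl
        · rw [Option.map_map]; try rw [Option.map_map]
          rfl
        · rw [Option.map_map]; try rw [Option.map_map]
          rfl
        · rfl
  | down =>
    change downRot j _ = (downRot j t).map _
    induction t with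
    | nil => rw [bot, downRot_node, if_neg hj.ne, if_pos hj]; rfl
    | node a l r _ ihr =>
      rw [bot, downRot_node, downRot_node, ihr]
      split_ifs
      · cases l <;> rfl
      · rw [Option.map_map]; try rw [Option.map_map]
        rfl
      · rw [Option.map_map]; try rw [Option.map_map]
        rfl

theorem rot_top {d : Dir} {j n : ℕ} {t : BTree} (hj : j < n) :
    rot d j (node n t nil) = (rot d j t).map (fun t => node n t nil) := by
  cases d with
  | up => change upRot j _ = (upRot j t).map _; rw [upRot_node_nil, if_pos hj]
  | down =>
    change downRot j _ = (downRot j t).map _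
    rw [downRot_node, if_neg hj.ne, if_pos hj]

/-- Slides of smaller vertices do not interfere with the largest vertex at the top or bottom. -/
theorem slide_ext {d d' : Dir} {j n m : ℕ} {t : BTree} (hj : j < n) :
    slide d j m (ext n d' t) = (slide d j m t).map (ext n d') := by
  have hr : ∀ t, rot d j (ext n d' t) = (rot d j t).map (ext n d') := by
    intro t
    cases d' with
    | up => exact rot_top hj
    | down => exact rot_bot hj
  induction m generalizing t with
  | zero => rfl
  | succ m ih =>
    rw [slide, slide, hr]
    cases rot d j t with
    | none => rfl
    | some t₁ => exact ih

theorem parent_of_notMem {s : BTree} {v : ℕ} (hs : v ∉ verts s) : parent s v = none := by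
  induction s with
  | nil => rfl
  | node a l r ihl ihr =>
    rw [mem_verts_node] at hs
    push Not at hs
    rw [parent, if_neg, ihl hs.2.1, ihr hs.2.2, ite_self]
    rintro (h | h)
    · exact hs.2.1 (mem_verts_of_root h)
    · exact hs.2.2 (mem_verts_of_root h)

theorem parent_root {t : BTree} (ht : IsSearch t) {v : ℕ} (h : root? t = some v) :
    parent t v = none := by
  cases t with
  | nil => rfl
  | node a l r =>
    obtain rfl := Option.some.inj h
    have h1 : a ∉ verts l := fun h => lt_irrefl _ (ht.1 a h)
    have h2 : a ∉ verts r := fun h => lt_irrefl _ (ht.2.1 a h)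
    rw [parent, if_neg, parent_of_notMem h1, parent_of_notMem h2, ite_self]
    rintro (h | h)
    · exact h1 (mem_verts_of_root h)
    · exact h2 (mem_verts_of_root h)

theorem verts_bot (n : ℕ) (t : BTree) : verts (bot n t) = insert n (verts t) := by
  rw [← ins_rlen, verts_ins]

theorem root?_bot {n : ℕ} {t : BTree} (ht : t ≠ nil) : root? (bot n t) = root? t := by
  cases t with
  | nil => exact absurd rfl ht
  | node a l r => rfl

/-- A new largest leaf at the bottom changes neither the parent nor the left child of a vertex. -/
theorem bot_eq {n j : ℕ} {t : BTree} (ht : IsSearch t) (hj : j ∈ verts t)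
    (hn : j < n) : parent (bot n t) j = parent t j ∧ leftChild (bot n t) j = leftChild t j := by
  induction t with
  | nil => simp [verts] at hj
  | node a l r _ ihr =>
    rw [bot, leftChild_node, leftChild_node, parent, parent]
    by_cases hr : j ∈ verts r
    · have hlt := ht.2.1 j hr
      have hne : r ≠ nil := by rintro rfl; simp [verts] at hr
      rw [(ihr ht.2.2.2 hr).1, (ihr ht.2.2.2 hr).2, root?_bot hne]
      simp
    · have hj' : j = a ∨ j < a := by
        rcases mem_verts_node.1 hj with h | h | h
        · exact Or.inl h
        · exact Or.inr (ht.1 j h)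
        · exact absurd h hr
      have h1 : j ∉ verts (bot n r) := by
        rw [verts_bot, Finset.mem_insert, not_or]
        exact ⟨hn.ne, hr⟩
      have h2 : root? r ≠ some j := fun h => hr (mem_verts_of_root h)
      have h3 : root? (bot n r) ≠ some j := fun h => h1 (mem_verts_of_root h)
      rw [parent_of_notMem h1, parent_of_notMem hr]
      refine ⟨by simp only [h2, h3], ?_⟩
      rcases hj' with rfl | h
      · rw [if_pos rfl, if_pos rfl]
      · rw [if_neg h.ne, if_neg h.ne, if_pos h, if_pos h]

theorem blocked_ext {n j : ℕ} {d d' : Dir} {t : BTree} (ht : IsSearch t) (hj : j ∈ verts t)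
    (hn : j < n) : blocked (ext n d' t) j d = blocked t j d := by
  cases d' with
  | down =>
    change blocked (bot n t) j d = _
    cases d <;> simp only [blocked, bot_eq ht hj hn]
  | up =>
    change blocked (node n t nil) j d = _
    cases d with
    | down => simp only [blocked]; rw [leftChild_node, if_neg hn.ne, if_pos hn]
    | up =>
      simp only [blocked]
      rw [parent]
      by_cases h : root? t = some j
      · rw [parent_root ht h]; simp [h, hn]
      · rw [if_neg (not_or.2 ⟨h, by simp [root?]⟩), if_pos hn]

/-! ### Minimal slides of the largest vertex -/

/-- The position `b` is reached later than `a` by a slide of the largest vertex in direction `d`,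
where positions are distances from the root. -/
def After : Dir → ℕ → ℕ → Prop
  | .up, a, b => b < a
  | .down, a, b => a < b

theorem After.asymm {d : Dir} {a b : ℕ} (h : After d a b) (h' : After d b a) : False := by
  cases d <;> exact Nat.lt_asymm h h'

theorem After.ne {d : Dir} {a b : ℕ} (h : After d a b) : a ≠ b := by
  rintro rfl; exact h.asymm h

theorem after_flip {d : Dir} {a b : ℕ} : After d.flip a b ↔ After d b a := by
  cases d <;> rfl

theorem flip_flip (d : Dir) : d.flip.flip = d := by cases d <;> rfl

theorem slide_succ' (d : Dir) (j m : ℕ) (T : BTree) :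
    slide d j (m + 1) T = (rot d j T).bind (slide d j m) := rfl

theorem slide_up_ins {n m s : ℕ} {t : BTree} (hm : m ≤ rlen t) (hn : ∀ x ∈ verts t, x < n) :
    slide .up n s (ins n m t) = if s ≤ m then some (ins n (m - s) t) else none := by
  induction s generalizing m with
  | zero => simp [slide]
  | succ s ih =>
    rw [slide_succ']
    cases m with
    | zero => simp only [rot, upRot_ins_zero]; simp
    | succ m =>
      simp only [rot, upRot_ins_succ hm hn, Option.bind_some, ih (show m ≤ rlen t by omega)]
      simp

theorem slide_down_ins {n m s : ℕ} {t : BTree} (hm : m ≤ rlen t) (hn : ∀ x ∈ verts t, x < n) :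
    slide .down n s (ins n m t) = if m + s ≤ rlen t then some (ins n (m + s) t) else none := by
  induction s generalizing m with
  | zero => simp [slide, hm]
  | succ s ih =>
    rw [slide_succ']
    rcases hm.lt_or_eq with h | rfl
    · simp only [rot, downRot_ins h hn, Option.bind_some, ih (show m + 1 ≤ rlen t by omega)]
      rw [show m + 1 + s = m + (s + 1) by omega]
    · rw [ins_rlen]
      simp only [rot, downRot_bot hn]
      simp

/-- The minimal slides of the largest vertex in terms of its positions. -/
theorem isMinSlide_ins {L : Set BTree} {d : Dir} {n m : ℕ} {t T' : BTree} (hm : m ≤ rlen t)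
    (hn : ∀ x ∈ verts t, x < n) :
    IsMinSlide L d n (ins n m t) T' ↔
      ∃ m' ≤ rlen t, T' = ins n m' t ∧ After d m m' ∧
        ∀ x ≤ rlen t, After d m x → After d x m' → ins n x t ∉ L := by
  cases d with
  | up =>
    simp only [IsMinSlide, slide_up_ins hm hn, After]
    constructor
    · rintro ⟨s, hs, h, hmin⟩
      split_ifs at h with h1
      refine ⟨m - s, by omega, (Option.some.inj h).symm, by omega, fun x _ h2 h3 => ?_⟩
      refine hmin (m - x) (by omega) (by omega) _ ?_
      rw [if_pos (by omega), show m - (m - x) = x by omega]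
    · rintro ⟨m', h1, rfl, h2, h3⟩
      refine ⟨m - m', by omega, ?_, fun s hs hs' T h => ?_⟩
      · rw [if_pos (by omega), show m - (m - m') = m' by omega]
      · split_ifs at h
        rw [← Option.some.inj h]
        exact h3 _ (by omega) (by omega) (by omega)
  | down =>
    simp only [IsMinSlide, slide_down_ins hm hn, After]
    constructor
    · rintro ⟨s, hs, h, hmin⟩
      split_ifs at h with h1
      refine ⟨m + s, by omega, (Option.some.inj h).symm, by omega, fun x _ h2 h3 => ?_⟩
      refine hmin (x - m) (by omega) (by omega) _ ?_
      rw [if_pos (by omega), show m + (x - m) = x by omega]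
    · rintro ⟨m', h1, rfl, h2, h3⟩
      refine ⟨m' - m, by omega, ?_, fun s hs hs' T h => ?_⟩
      · rw [if_pos (by omega), show m + (m' - m) = m' by omega]
      · split_ifs at h
        rw [← Option.some.inj h]
        exact h3 _ (by omega) (by omega) (by omega)

theorem mem_of_isMinSlide {L : Set BTree} {d : Dir} {j : ℕ} {T T' : BTree}
    (h : IsMinSlide L d j T T') : j ∈ verts T := by
  obtain ⟨m, hm, h, -⟩ := h
  exact mem_of_slide hm h

theorem isMinSlide_unique {L : Set BTree} {d : Dir} {j : ℕ} {T T' T'' : BTree}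
    (h : IsMinSlide L d j T T') (h' : IsMinSlide L d j T T'') (hL : T' ∈ L) (hL' : T'' ∈ L) :
    T' = T'' := by
  obtain ⟨m, hm, h1, h2⟩ := h
  obtain ⟨m', hm', h1', h2'⟩ := h'
  rcases lt_trichotomy m m' with h | rfl | h
  · exact absurd hL (h2' m hm h _ h1)
  · rw [h1] at h1'; exact Option.some.inj h1'
  · exact absurd hL' (h2 m' hm' h _ h1')

theorem parent_ins_succ {n m : ℕ} {t : BTree} (hm : m + 1 ≤ rlen t)
    (hn : ∀ x ∈ verts t, x < n) : ∃ p < n, parent (ins n (m + 1) t) n = some p := by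
  induction t generalizing m with
  | nil => simp [rlen] at hm
  | node a l r _ ih =>
    have ha := hn a (mem_verts_node.2 (Or.inl rfl))
    rw [ins, parent]
    split_ifs with h1 h2
    · exact ⟨a, ha, rfl⟩
    · omega
    · cases m with
      | zero => exact absurd (Or.inr rfl) h1
      | succ m =>
        exact ih (by simpa [rlen] using hm)
          (fun x hx => hn x (mem_verts_node.2 (Or.inr (Or.inr hx))))

theorem leftChild_ins {n m : ℕ} {t : BTree} (hm : m ≤ rlen t) (hn : ∀ x ∈ verts t, x < n) :
    leftChild (ins n m t) n = none ↔ m = rlen t := by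
  induction t generalizing m with
  | nil =>
    obtain rfl : m = 0 := by simpa [rlen] using hm
    simp [ins, leftChild_node, root?, rlen]
  | node a l r _ ih =>
    have ha := hn a (mem_verts_node.2 (Or.inl rfl))
    cases m with
    | zero => simp [ins, leftChild_node, root?, rlen]
    | succ m =>
      rw [ins, leftChild_node, if_neg ha.ne', if_neg ha.not_gt, rlen, ih (by simpa [rlen] using hm)
          (fun x hx => hn x (mem_verts_node.2 (Or.inr (Or.inr hx))))]
      omega

/-- The largest vertex is blocked exactly at the end of its slide. -/
theorem blocked_ins {n m : ℕ} {d : Dir} {t : BTree} (ht : IsSearch t) (hm : m ≤ rlen t)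
    (hn : ∀ x ∈ verts t, x < n) : blocked (ins n m t) n d = true ↔ m = extPos d t := by
  cases d with
  | down =>
    rw [blocked, Option.isNone_iff_eq_none, leftChild_ins hm hn]
    rfl
  | up =>
    simp only [blocked, extPos]
    cases m with
    | zero => rw [parent_root (isSearch_ins ht hn) rfl]; simp
    | succ m =>
      obtain ⟨p, hp, h⟩ := parent_ins_succ hm hn
      simp [h, hp.le]

/-! ### The trees with a given restriction to the smaller vertices -/

open Classical in
/-- The positions at which the vertex `n` can be inserted into `t` such that the result lies in
`L`, in the order of a slide in direction `d`. -/
noncomputable def fibPos (L : Set BTree) (n : ℕ) (t : BTree) : Dir → List ℕ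
  | .up => ((List.range (rlen t + 1)).filter (fun m => ins n m t ∈ L)).reverse
  | .down => (List.range (rlen t + 1)).filter (fun m => ins n m t ∈ L)

section fibPos

variable {L : Set BTree} {n : ℕ} {t : BTree} {d : Dir}

theorem mem_fibPos {m : ℕ} : m ∈ fibPos L n t d ↔ m ≤ rlen t ∧ ins n m t ∈ L := by
  cases d <;> simp [fibPos]

theorem pairwise_fibPos : (fibPos L n t d).Pairwise (After d) := by
  cases d with
  | up =>
    rw [fibPos, List.pairwise_reverse]
    exact (List.pairwise_lt_range).filter _
  | down => exact (List.pairwise_lt_range).filter _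

theorem nodup_fibPos : (fibPos L n t d).Nodup := by
  exact pairwise_fibPos.imp After.ne

/-- In a list that is sorted by an asymmetric relation, no entry lies between two consecutive
entries. -/
theorem isChain_of_pairwise {α : Type*} {R : α → α → Prop} (hR : ∀ a b, R a b → R b a → False)
    {l : List α} (h : l.Pairwise R) :
    l.IsChain (fun a b => R a b ∧ ∀ x ∈ l, R a x → R x b → False) := by
  rw [List.isChain_iff_getElem]
  rw [List.pairwise_iff_getElem] at h
  intro i hi
  refine ⟨h i (i + 1) _ _ (Nat.lt_succ_self i), fun x hx h1 h2 => ?_⟩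
  obtain ⟨k, hk, rfl⟩ := List.getElem_of_mem hx
  have a1 : i < k := by
    by_contra hc
    rcases (not_lt.1 hc).lt_or_eq with hc | rfl
    · exact hR _ _ h1 (h k i _ _ hc)
    · exact hR _ _ h1 h1
  have a2 : k < i + 1 := by
    by_contra hc
    rcases (not_lt.1 hc).lt_or_eq with hc | rfl
    · exact hR _ _ h2 (h (i + 1) k _ _ hc)
    · exact hR _ _ h2 h2
  omega

/-- One step of a minimal slide of the inserted vertex, in terms of positions. -/
def MinStep (L : Set BTree) (n : ℕ) (t : BTree) (d : Dir) (m m' : ℕ) : Prop :=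
  After d m m' ∧ ∀ x ≤ rlen t, After d m x → After d x m' → ins n x t ∉ L

theorem isChain_fibPos : (fibPos L n t d).IsChain (MinStep L n t d) :=
  (isChain_of_pairwise (fun _ _ => After.asymm) pairwise_fibPos).imp
    (fun _ _ h => ⟨h.1, fun x hx h1 h2 hL => h.2 x (mem_fibPos.2 ⟨hx, hL⟩) h1 h2⟩)

theorem getLast?_fibPos (h : ∀ d, ext n d t ∈ L) :
    (fibPos L n t d).getLast? = some (extPos d t) := by
  have h0 := h .up
  have h1 := h .down
  rw [ext_eq_ins] at h0 h1
  cases d with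
  | up =>
    rw [fibPos, List.getLast?_reverse, List.range_succ_eq_map, List.filter_cons_of_pos]
    · rfl
    · classical exact decide_eq_true h0
  | down =>
    rw [fibPos, List.range_succ, List.filter_append, List.filter_cons_of_pos]
    · simp [extPos]
    · classical exact decide_eq_true h1

theorem head?_fibPos (h : ∀ d, ext n d t ∈ L) :
    (fibPos L n t d).head? = some (extPos d.flip t) := by
  have := getLast?_fibPos (d := d.flip) h
  rw [← this]
  cases d with
  | up => rw [fibPos, List.head?_reverse]; rfl
  | down => rw [Dir.flip, fibPos, List.getLast?_reverse]; rfl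

end fibPos

/-- The states at the visits of the trees that arise from the tree of the state `x` by inserting the
vertex `n + 1` at one of the given positions, the last of which is the end of the slide in
direction `d`. -/
def fibStates (n : ℕ) (x : HState) (d : Dir) : List ℕ → List HState
  | [] => []
  | [m] => [⟨ins (n + 1) m x.tree, Function.update x.o (n + 1) d.flip,
      Function.update (Function.update x.s (n + 1) (x.s n)) n n⟩]
  | m :: m' :: ms => ⟨ins (n + 1) m x.tree, Function.update x.o (n + 1) d, x.s⟩ ::
      fibStates n x d (m' :: ms)

/-- The run for the trees with `n + 1` vertices from the run for the trees with `n` vertices: the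
largest vertex slides alternately up and down, and between any two of these slides the smaller
vertices make one step of their run. -/
noncomputable def expand (L : Set BTree) (n : ℕ) : Dir → List HState → List HState
  | _, [] => []
  | d, x :: xs => fibStates n x d (fibPos L (n + 1) x.tree d) ++ expand L n d.flip xs

theorem map_tree_fibStates (n : ℕ) (x : HState) (d : Dir) (l : List ℕ) :
    (fibStates n x d l).map HState.tree = l.map (fun m => ins (n + 1) m x.tree) := by
  induction l with
  | nil => rfl
  | cons m ms ih =>
    cases ms with
    | nil => rfl
    | cons m' ms => rw [fibStates, List.map_cons, ih]; rfl

theorem getLast?_fibStates {n : ℕ} {x : HState} {d : Dir} {l : List ℕ} {m : ℕ}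
    (h : l.getLast? = some m) :
    (fibStates n x d l).getLast? = some ⟨ins (n + 1) m x.tree, Function.update x.o (n + 1) d.flip,
      Function.update (Function.update x.s (n + 1) (x.s n)) n n⟩ := by
  induction l with
  | nil => simp at h
  | cons a ms ih =>
    cases ms with
    | nil =>
      simp only [List.getLast?_singleton, Option.some.injEq] at h
      rw [h]; rfl
    | cons m' ms =>
      rw [List.getLast?_cons_cons] at h
      have := ih h
      rw [fibStates]
      cases hf : fibStates n x d (m' :: ms) with
      | nil => rw [hf] at this; simp at this
      | cons y ys => rw [List.getLast?_cons_cons, ← hf, this]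

theorem rlen_pos {n : ℕ} (hn : 1 ≤ n) {T : BTree} (hT : T ∈ onVertices n) : 1 ≤ rlen T := by
  cases T with
  | nil =>
    have := hT.2
    have h1 : 1 ∈ verts nil := by rw [this]; simp [hn]
    simp [verts] at h1
  | node a l r => simp [rlen]

theorem not_extPos_of_after {d : Dir} {t : BTree} {m m' : ℕ} (h : After d m m')
    (hm' : m' ≤ rlen t) : m ≠ extPos d t := by
  cases d with
  | up => simp only [After, extPos] at *; omega
  | down => simp only [After, extPos] at *; omega

section Level

variable {L : ℕ → Set BTree} (hL : Zigzag L) {n : ℕ} (hn : 1 ≤ n)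

include hL in
theorem Zigzag.ext_mem {T : BTree} (hT : T ∈ L n) (d : Dir) : ext (n + 1) d T ∈ L (n + 1) := by
  cases d with
  | up => exact hL.top n T hT
  | down => exact hL.bot n T hT

include hL in
theorem Zigzag.of_ext_mem {T : BTree} (hT : T ∈ onVertices n) {d : Dir}
    (h : ext (n + 1) d T ∈ L (n + 1)) : T ∈ L n := by
  rw [ext_eq_ins] at h
  exact hL.del n _ T hT h

include hL in
theorem fibPos_spec {T : BTree} (hT : T ∈ L n) (d : Dir) :
    (fibPos (L (n + 1)) (n + 1) T d).getLast? = some (extPos d T) ∧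
    (fibPos (L (n + 1)) (n + 1) T d).head? = some (extPos d.flip T) :=
  ⟨getLast?_fibPos (hL.ext_mem hT), head?_fibPos (hL.ext_mem hT)⟩

include hL hn in
theorem head?_fibStates {x : HState} (hx : x.tree ∈ L n) (d : Dir) :
    (fibStates n x d (fibPos (L (n + 1)) (n + 1) x.tree d)).head? =
      some ⟨ext (n + 1) d.flip x.tree, Function.update x.o (n + 1) d, x.s⟩ := by
  obtain ⟨h1, h2⟩ := fibPos_spec hL hx d
  have hr := rlen_pos hn (hL.sub n hx)
  cases hf : fibPos (L (n + 1)) (n + 1) x.tree d with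
  | nil => rw [hf] at h1; simp at h1
  | cons m ms =>
    rw [hf] at h1 h2
    obtain rfl := Option.some.inj h2
    cases ms with
    | nil =>
      -- the top and the bottom are different positions, since the right branch is not empty
      simp only [List.getLast?_singleton, Option.some.injEq] at h1
      cases d <;> simp only [extPos, Dir.flip] at h1 <;> omega
    | cons m' ms => rw [fibStates, List.head?_cons, ← ext_eq_ins]

include hn in
/-- A slide of the largest vertex consists of steps of the history-free algorithm: as long as the
vertex is not blocked, only the tree changes. -/
theorem isChain_fibStates {x : HState} (hx : x.tree ∈ onVertices n) (hs : x.s (n + 1) = n + 1)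
    (d : Dir) {l : List ℕ} (hc : l.IsChain (MinStep (L (n + 1)) (n + 1) x.tree d))
    (hm : ∀ m ∈ l, m ≤ rlen x.tree ∧ ins (n + 1) m x.tree ∈ L (n + 1))
    (hlast : l.getLast? = some (extPos d x.tree)) :
    (fibStates n x d l).IsChain (HStep (L (n + 1)) (n + 1)) := by
  have hlt := lt_succ_of_mem_onVertices hx
  induction l with
  | nil => exact List.IsChain.nil
  | cons m ms ih =>
    cases ms with
    | nil => exact List.IsChain.singleton _
    | cons m' ms =>
      rw [List.isChain_cons_cons] at hc
      rw [List.getLast?_cons_cons] at hlast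
      have hm' := hm m' (by simp)
      have key := ih hc.2 (fun k hk => hm k (List.mem_cons_of_mem _ hk)) hlast
      have hmin : IsMinSlide (L (n + 1)) d (n + 1) (ins (n + 1) m x.tree)
          (ins (n + 1) m' x.tree) :=
        (isMinSlide_ins (hm m (by simp)).1 hlt).2 ⟨m', hm'.1, rfl, hc.1⟩
      have hup : Function.update x.s (n + 1) (n + 1) = x.s := by
        conv_lhs => rw [← hs]
        rw [hs, Function.update_eq_self_iff, hs]
      have hb := blocked_ins (n := n + 1) (d := d) hx.1 hm'.1 hlt
      rw [fibStates]
      cases ms with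
      | nil =>
        simp only [List.getLast?_singleton, Option.some.injEq] at hlast
        rw [fibStates]
        refine List.isChain_pair.2 ⟨by rw [hs]; omega, _, hm'.2, ?_, ?_⟩
        · simpa [hs] using hmin
        · rw [hs]
          simp only [HState.update, Function.update_self, hup, hb.2 hlast, if_true,
            Nat.add_sub_cancel, Function.update_idem]
      | cons m'' ms =>
        rw [List.isChain_cons_cons] at hc
        rw [fibStates] at key ⊢
        refine List.isChain_cons_cons.2 ⟨⟨by rw [hs]; omega, _, hm'.2, ?_, ?_⟩, key⟩
        · simpa [hs] using hmin
        · have hb' : ¬ blocked (ins (n + 1) m' x.tree) (n + 1) d = true := fun h =>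
            not_extPos_of_after hc.2.1.1 (hm m'' (by simp)).1 (hb.1 h)
          rw [hs]
          simp only [HState.update, Function.update_self, hup, hb', Bool.false_eq_true, if_false]

include hL in
/-- Minimal slides of a smaller vertex, with the largest vertex at the top or bottom. -/
theorem isMinSlide_ext {T T' : BTree} (hT : T ∈ onVertices n) {d d' : Dir} {j : ℕ}
    (hj : j < n + 1) :
    IsMinSlide (L (n + 1)) d j (ext (n + 1) d' T) T' ↔
      ∃ T₁, T' = ext (n + 1) d' T₁ ∧ T₁ ∈ onVertices n ∧ IsMinSlide (L n) d j T T₁ := by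
  have hmem : ∀ {m T₁}, slide d j m T = some T₁ → (ext (n + 1) d' T₁ ∈ L (n + 1) ↔ T₁ ∈ L n) :=
    fun h => ⟨hL.of_ext_mem (mem_onVertices_of_slide h hT), fun h => hL.ext_mem h d'⟩
  simp only [IsMinSlide, slide_ext hj]
  constructor
  · rintro ⟨m, hm, h, hmin⟩
    obtain ⟨T₁, h1, rfl⟩ := Option.map_eq_some_iff.1 h
    refine ⟨T₁, rfl, mem_onVertices_of_slide h1 hT, m, hm, h1, fun m' h2 h3 T₂ h4 h5 => ?_⟩
    exact hmin m' h2 h3 _ (Option.map_eq_some_iff.2 ⟨T₂, h4, rfl⟩) ((hmem h4).2 h5)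
  · rintro ⟨T₁, rfl, -, m, hm, h, hmin⟩
    refine ⟨m, hm, Option.map_eq_some_iff.2 ⟨T₁, h, rfl⟩, fun m' h2 h3 T₂ h4 h5 => ?_⟩
    obtain ⟨T₃, h6, rfl⟩ := Option.map_eq_some_iff.1 h4
    exact hmin m' h2 h3 _ h6 ((hmem h6).1 h5)

include hL in
/-- One step of the history-free algorithm for `n` vertices is one for `n + 1` vertices when the
slide of the largest vertex has just ended. -/
theorem hStep_ext {x y : HState} (hx : x.tree ∈ L n) (hs : x.s (n + 1) = n + 1)
    (h : HStep (L n) n x y) (d : Dir) :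
    HStep (L (n + 1)) (n + 1)
      ⟨ext (n + 1) d x.tree, Function.update x.o (n + 1) d.flip,
        Function.update (Function.update x.s (n + 1) (x.s n)) n n⟩
      ⟨ext (n + 1) d y.tree, Function.update y.o (n + 1) d.flip, y.s⟩ := by
  obtain ⟨h1, T', hT', hmin, rfl⟩ := h
  have hTn := hL.sub n hx
  have hTn' := hL.sub n hT'
  have hjm := mem_of_isMinSlide hmin
  have hj := lt_succ_of_mem_onVertices hTn _ hjm
  have hjm' : x.s n ∈ verts T' := by rwa [hTn'.2, ← hTn.2]
  have hsn : Function.update (Function.update x.s (n + 1) (x.s n)) n n (n + 1) = x.s n := by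
    rw [Function.update_of_ne (by omega), Function.update_self]
  have ho : ∀ f : ℕ → Dir, Function.update f (n + 1) d.flip (x.s n) = f (x.s n) := fun f =>
    Function.update_of_ne hj.ne _ _
  refine ⟨by simp only [hsn]; exact h1, ext (n + 1) d T', hL.ext_mem hT' d, ?_, ?_⟩
  · simp only [hsn, ho]
    exact (isMinSlide_ext hL hTn hj).2 ⟨T', rfl, hTn', hmin⟩
  · simp only [hsn]
    have e1 : Function.update (Function.update (Function.update x.s (n + 1) (x.s n)) n n)
        (n + 1) (n + 1) = Function.update x.s n n := by
      funext v
      by_cases h1 : v = n + 1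
      · subst h1; rw [Function.update_self, Function.update_of_ne (by omega), hs]
      · rw [Function.update_of_ne h1]
        by_cases h2 : v = n
        · subst h2; simp
        · rw [Function.update_of_ne h2, Function.update_of_ne h1, Function.update_of_ne h2]
    simp only [HState.update, ho, e1, blocked_ext hTn'.1 hjm' hj]
    split_ifs with hb
    · simp only [HState.mk.injEq, true_and, and_true]
      rw [Function.update_comm hj.ne]
    · rfl

/-- The facts about a run for `n` vertices that carry over to `n + 1` vertices. -/
structure RunOk (L : ℕ → Set BTree) (n : ℕ) (xs : List HState) : Prop where
  mem : ∀ x ∈ xs, x.tree ∈ L n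
  s_eq : ∀ x ∈ xs, ∀ v, n < v → x.s v = v
  chain : xs.IsChain (HStep (L n) n)
  last : ∀ x ∈ xs.getLast?, x.s n = 1

include hL hn in
theorem head?_expand {x : HState} {xs : List HState} (hx : x.tree ∈ L n) (d : Dir) :
    (expand (L (n + 1)) n d (x :: xs)).head? =
      some ⟨ext (n + 1) d.flip x.tree, Function.update x.o (n + 1) d, x.s⟩ := by
  rw [expand, List.head?_append, head?_fibStates hL hn hx]
  rfl

include hL in
theorem getLast?_expand {x : HState} {xs : List HState} (hx : ∀ y ∈ x :: xs, y.tree ∈ L n)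
    (d : Dir) : ∃ d', ∃ y ∈ (x :: xs).getLast?, (expand (L (n + 1)) n d (x :: xs)).getLast? =
      some ⟨ext (n + 1) d' y.tree, Function.update y.o (n + 1) d'.flip,
        Function.update (Function.update y.s (n + 1) (y.s n)) n n⟩ := by
  induction xs generalizing x d with
  | nil =>
    refine ⟨d, x, by simp, ?_⟩
    rw [expand, expand, List.append_nil,
      getLast?_fibStates (fibPos_spec hL (hx x (by simp)) d).1, ext_eq_ins]
  | cons y ys ih =>
    obtain ⟨d', z, hz, h⟩ := ih (x := y) (fun z hz => hx z (List.mem_cons_of_mem _ hz)) d.flip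
    refine ⟨d', z, by rw [List.getLast?_cons_cons]; exact hz, ?_⟩
    rw [expand, List.getLast?_append, h]
    rfl

include hL hn in
/-- The steps of the extended run are those within a slide of the largest vertex, and those of the
smaller vertices between two such slides. -/
theorem isChain_expand {xs : List HState} (h : RunOk L n xs) (d : Dir) :
    (expand (L (n + 1)) n d xs).IsChain (HStep (L (n + 1)) (n + 1)) := by
  have hmem := h.mem
  have hs := h.s_eq
  have hc := h.chain
  clear h
  induction xs generalizing d with
  | nil => exact List.IsChain.nil
  | cons x xs ih =>
    have hx := hmem x (by simp)
    have hsx := hs x (by simp) (n + 1) (Nat.lt_succ_self n)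
    have hsp := fibPos_spec hL hx d
    rw [expand, List.isChain_append]
    refine ⟨isChain_fibStates hn (hL.sub n hx) hsx d isChain_fibPos
      (fun m hm => mem_fibPos.1 hm) hsp.1,
      ih d.flip (fun y hy => hmem y (List.mem_cons_of_mem _ hy))
      (fun y hy => hs y (List.mem_cons_of_mem _ hy)) hc.tail, ?_⟩
    rw [getLast?_fibStates hsp.1]
    rintro _ ⟨rfl⟩ z hz
    cases xs with
    | nil => simp [expand] at hz
    | cons y ys =>
      rw [head?_expand hL hn (hmem y (by simp)), flip_flip] at hz
      obtain rfl := Option.some.inj hz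
      rw [← ext_eq_ins]
      exact hStep_ext hL hx hsx (List.isChain_cons_cons.1 hc).1 d

theorem s_eq_of_mem_fibStates {x y : HState} {d : Dir} {l : List ℕ} (h : y ∈ fibStates n x d l)
    (hs : ∀ v, n < v → x.s v = v) {v : ℕ} (hv : n + 1 < v) : y.s v = v := by
  induction l with
  | nil => simp [fibStates] at h
  | cons m ms ih =>
    cases ms with
    | nil =>
      simp only [fibStates, List.mem_singleton] at h
      subst h
      simp only
      rw [Function.update_of_ne (by omega), Function.update_of_ne (by omega), hs v (by omega)]
    | cons m' ms =>
      rw [fibStates, List.mem_cons] at h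
      rcases h with rfl | h
      · exact hs v (by omega)
      · exact ih h

theorem mem_expand {𝓛 : Set BTree} {xs : List HState} {d : Dir} {y : HState}
    (h : y ∈ expand 𝓛 n d xs) :
    ∃ x ∈ xs, ∃ d', y ∈ fibStates n x d' (fibPos 𝓛 (n + 1) x.tree d') := by
  induction xs generalizing d with
  | nil => simp [expand] at h
  | cons x xs ih =>
    rw [expand, List.mem_append] at h
    rcases h with h | h
    · exact ⟨x, by simp, d, h⟩
    · obtain ⟨z, hz, h⟩ := ih h
      exact ⟨z, List.mem_cons_of_mem _ hz, h⟩

/-- The trees of the extended run are those of the language that restrict to a tree of the run. -/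
theorem mem_trees_expand {𝓛 : Set BTree} {xs : List HState} {d : Dir} {T : BTree} :
    T ∈ (expand 𝓛 n d xs).map HState.tree ↔
      ∃ x ∈ xs, ∃ m ≤ rlen x.tree, T = ins (n + 1) m x.tree ∧ T ∈ 𝓛 := by
  induction xs generalizing d with
  | nil => simp [expand]
  | cons x xs ih =>
    rw [expand, List.map_append, List.mem_append, ih, map_tree_fibStates]
    simp only [List.mem_map, mem_fibPos, List.mem_cons, exists_eq_or_imp]
    refine or_congr ⟨?_, ?_⟩ Iff.rfl
    · rintro ⟨m, ⟨h1, h2⟩, rfl⟩; exact ⟨m, h1, rfl, h2⟩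
    · rintro ⟨m, h1, rfl, h2⟩; exact ⟨m, ⟨h1, h2⟩, rfl⟩

theorem nodup_trees_expand {𝓛 : Set BTree} {xs : List HState} {d : Dir}
    (h : (xs.map HState.tree).Nodup) : ((expand 𝓛 n d xs).map HState.tree).Nodup := by
  induction xs generalizing d with
  | nil => simp [expand]
  | cons x xs ih =>
    rw [List.map_cons, List.nodup_cons] at h
    rw [expand, List.map_append, List.nodup_append, map_tree_fibStates]
    refine ⟨?_, ih h.2, ?_⟩
    · refine nodup_fibPos.map_on (fun m hm m' hm' he => ?_)
      exact (ins_inj (mem_fibPos.1 hm).1 (mem_fibPos.1 hm').1 he).1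
    · rintro T hT T' hT' rfl
      obtain ⟨m, hm, rfl⟩ := List.mem_map.1 hT
      obtain ⟨y, hy, m', hm', he, -⟩ := mem_trees_expand.1 hT'
      refine h.1 (List.mem_map.2 ⟨y, hy, ?_⟩)
      exact (ins_inj (mem_fibPos.1 hm).1 hm' he).2.symm

include hL hn in
theorem RunOk.expand {xs : List HState} (h : RunOk L n xs) (d : Dir) :
    RunOk L (n + 1) (expand (L (n + 1)) n d xs) := by
  refine ⟨fun y hy => ?_, fun y hy v hv => ?_, isChain_expand hL hn h d, ?_⟩
  · obtain ⟨x, -, m, -, -, h⟩ := mem_trees_expand.1 (List.mem_map_of_mem (f := HState.tree) hy)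
    exact h
  · obtain ⟨x, hx, d', hy⟩ := mem_expand hy
    exact s_eq_of_mem_fibStates hy (h.s_eq x hx) hv
  · cases xs with
    | nil => simp [FriendlyTrees.expand]
    | cons x xs =>
      obtain ⟨d', z, hz, he⟩ := getLast?_expand hL h.mem d
      rw [he]
      rintro _ ⟨rfl⟩
      simp only
      rw [Function.update_of_ne (by omega), Function.update_self]
      exact h.last z hz

end Level

/-! ### The greedy algorithm follows the same order -/

/-- Every tree of `l` but the first is the greedy choice after its predecessors, when the trees in
`pre` have been visited before. -/
def SChain (L : Set BTree) : List BTree → List BTree → Prop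
  | _, [] => True
  | _, [_] => True
  | pre, T :: T' :: l => SNext L (pre ++ [T]) T T' ∧ SChain L (pre ++ [T]) (T' :: l)

theorem sChain_iff {L : Set BTree} {pre l : List BTree} :
    SChain L pre l ↔
      ∀ (i : ℕ) (hi : i + 1 < l.length), SNext L (pre ++ l.take (i + 1)) l[i] l[i + 1] := by
  induction l generalizing pre with
  | nil => simp [SChain]
  | cons T l ih =>
    cases l with
    | nil => simp [SChain]
    | cons T' l =>
      rw [SChain, ih]
      constructor
      · rintro ⟨h1, h2⟩ i hi
        cases i with
        | zero => exact h1
        | succ i =>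
          have := h2 i (by simpa using hi)
          rw [List.append_assoc] at this
          exact this
      · intro h
        refine ⟨h 0 (by simp), fun i hi => ?_⟩
        have := h (i + 1) (by simpa using hi)
        rw [List.append_assoc]
        exact this

theorem isSRun_iff {L : Set BTree} {T₀ : BTree} {vs : List BTree} :
    IsSRun L T₀ vs ↔ vs.head? = some T₀ ∧ SChain L [] vs ∧
      ∀ T ∈ vs.getLast?, ∀ T', ¬ SNext L vs T T' := by
  rw [IsSRun, sChain_iff]
  rfl

theorem sNext_unique {L : Set BTree} {pre : List BTree} {T T' T'' : BTree}
    (h : SNext L pre T T') (h' : SNext L pre T T'') : T' = T'' := by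
  obtain ⟨j, d, hc, hm, ho⟩ := h
  obtain ⟨j', d', hc', hm', ho'⟩ := h'
  obtain rfl : j = j' := le_antisymm (hm' _ _ _ hc) (hm _ _ _ hc')
  have hd : d = d' := by
    cases d <;> cases d'
    · rfl
    · exact absurd hc' (ho _)
    · exact absurd hc' (ho _)
    · rfl
  subst hd
  exact isMinSlide_unique hc.1 hc'.1 hc.2.1 hc'.2.1

theorem sChain_unique {L : Set BTree} {l l' pre : List BTree} (hh : l.head? = l'.head?)
    (h : SChain L pre l) (h' : SChain L pre l')
    (hl : ∀ T ∈ l.getLast?, ∀ T', ¬ SNext L (pre ++ l) T T')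
    (hl' : ∀ T ∈ l'.getLast?, ∀ T', ¬ SNext L (pre ++ l') T T') : l = l' := by
  induction l generalizing pre l' with
  | nil =>
    cases l' with
    | nil => rfl
    | cons _ _ => simp at hh
  | cons T l ih =>
    cases l' with
    | nil => simp at hh
    | cons T' l' =>
      obtain rfl : T = T' := by simpa using hh
      cases l with
      | nil =>
        cases l' with
        | nil => rfl
        | cons U' l' => exact absurd h'.1 (hl T rfl U')
      | cons U l =>
        cases l' with
        | nil => exact absurd h.1 (hl' T rfl U)
        | cons U' l' =>
          have he := sNext_unique h.1 h'.1
          subst he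
          rw [List.getLast?_cons_cons] at hl hl'
          rw [List.append_cons] at hl hl'
          rw [ih (l' := U :: l') rfl h.2 h'.2 hl hl']

theorem sChain_append {L : Set BTree} {pre l l' : List BTree} (h : SChain L pre l)
    (h' : SChain L (pre ++ l) l')
    (hj : ∀ T ∈ l.getLast?, ∀ T' ∈ l'.head?, SNext L (pre ++ l) T T') :
    SChain L pre (l ++ l') := by
  induction l generalizing pre with
  | nil => simpa using h'
  | cons T l ih =>
    cases l with
    | nil =>
      cases l' with
      | nil => trivial
      | cons T' l' => exact ⟨hj T rfl T' rfl, h'⟩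
    | cons U l =>
      rw [List.getLast?_cons_cons] at hj
      rw [List.append_cons] at h' hj
      exact ⟨h.1, ih h.2 h' hj⟩

section Level

variable {L : ℕ → Set BTree} (hL : Zigzag L) {n : ℕ}

theorem isMinSlide_le {𝓛 : Set BTree} {T T' : BTree} (hT : T ∈ onVertices n) {d : Dir} {j : ℕ}
    (h : IsMinSlide 𝓛 d j T T') : j ≤ n :=
  Nat.le_of_lt_succ (lt_succ_of_mem_onVertices hT _ (mem_of_isMinSlide h))

/-- While the largest vertex slides, the greedy algorithm continues this slide. -/
theorem sNext_fib {T : BTree} (hT : T ∈ onVertices n) {d : Dir} {pre : List BTree}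
    (hpre : ∀ m ≤ rlen T, ins (n + 1) m T ∉ pre) {P₁ P₂ : List ℕ} {m m' : ℕ}
    (hP : fibPos (L (n + 1)) (n + 1) T d = P₁ ++ m :: m' :: P₂) :
    SNext (L (n + 1)) (pre ++ (P₁ ++ [m]).map (fun m => ins (n + 1) m T)) (ins (n + 1) m T)
      (ins (n + 1) m' T) := by
  have hlt := lt_succ_of_mem_onVertices hT
  have hmem : ∀ x, x ∈ P₁ ++ m :: m' :: P₂ ↔ x ≤ rlen T ∧ ins (n + 1) x T ∈ L (n + 1) :=
    fun x => by rw [← hP]; exact mem_fibPos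
  have hpw : (P₁ ++ m :: m' :: P₂).Pairwise (After d) := hP ▸ pairwise_fibPos
  have hch : (P₁ ++ m :: m' :: P₂).IsChain (MinStep (L (n + 1)) (n + 1) T d) :=
    hP ▸ isChain_fibPos
  have hm := (hmem m).1 (by simp)
  have hm' := (hmem m').1 (by simp)
  have hstep := (List.isChain_cons_cons.1 (List.isChain_append.1 hch).2.1).1
  rw [List.pairwise_append, List.pairwise_cons, List.pairwise_cons] at hpw
  have hnv : ins (n + 1) m' T ∉ pre ++ (P₁ ++ [m]).map (fun m => ins (n + 1) m T) := by
    rw [List.mem_append, not_or]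
    refine ⟨hpre m' hm'.1, fun h => ?_⟩
    obtain ⟨x, hx, he⟩ := List.mem_map.1 h
    have hx' : x ≤ rlen T := by
      refine ((hmem x).1 ?_).1
      rw [List.mem_append, List.mem_singleton] at hx
      rw [List.mem_append, List.mem_cons]
      tauto
    obtain rfl := (ins_inj hx' hm'.1 he).1
    rw [List.mem_append, List.mem_singleton] at hx
    rcases hx with hx | hx
    · exact (hpw.2.2 x hx x (by simp)).ne rfl
    · exact hstep.1.ne hx.symm
  refine ⟨n + 1, d, ⟨(isMinSlide_ins hm.1 hlt).2 ⟨m', hm'.1, rfl, hstep⟩, hm'.2, hnv⟩,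
    fun j' d' T'' h => isMinSlide_le (ins_mem_onVertices hT) h.1, fun T'' h => ?_⟩
  obtain ⟨k, hk, rfl, ha, -⟩ := (isMinSlide_ins hm.1 hlt).1 h.1
  rw [after_flip] at ha
  refine h.2.2 (List.mem_append_right _ (List.mem_map_of_mem (List.mem_append_left _ ?_)))
  have hk' := (hmem k).2 ⟨hk, h.2.1⟩
  rw [List.mem_append, List.mem_cons] at hk'
  rcases hk' with hk' | rfl | hk'
  · exact hk'
  · exact absurd rfl ha.ne
  · exact (ha.asymm (hpw.2.1.1 k hk')).elim

theorem sChain_fib {T : BTree} (hT : T ∈ onVertices n) {d : Dir} {pre : List BTree}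
    (hpre : ∀ m ≤ rlen T, ins (n + 1) m T ∉ pre) {P₁ P₂ : List ℕ}
    (hP : fibPos (L (n + 1)) (n + 1) T d = P₁ ++ P₂) :
    SChain (L (n + 1)) (pre ++ P₁.map (fun m => ins (n + 1) m T))
      (P₂.map (fun m => ins (n + 1) m T)) := by
  induction P₂ generalizing P₁ with
  | nil => trivial
  | cons m P₂ ih =>
    cases P₂ with
    | nil => trivial
    | cons m' P₂ =>
      have h1 := sNext_fib hT hpre hP
      have h2 := ih (P₁ := P₁ ++ [m]) (by rw [hP]; simp)
      rw [List.map_append, ← List.append_assoc] at h1 h2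
      exact ⟨h1, h2⟩

include hL in
/-- When the slide of the largest vertex has ended, the greedy algorithm makes the step that it
makes without that vertex. -/
theorem sNext_ext {vis VIS : List BTree} {T T' : BTree} (hT : T ∈ L n) (hTv : T ∈ vis)
    (hV : ∀ t, t ∈ onVertices n → ∀ m ≤ rlen t, ins (n + 1) m t ∈ L (n + 1) →
      (ins (n + 1) m t ∈ VIS ↔ t ∈ vis))
    (h : SNext (L n) vis T T') (d' : Dir) :
    SNext (L (n + 1)) VIS (ext (n + 1) d' T) (ext (n + 1) d' T') := by
  have hTn := hL.sub n hT
  have hTe : ext (n + 1) d' T ∈ onVertices (n + 1) := hL.sub _ (hL.ext_mem hT d')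
  have hextpos : ∀ t, extPos d' t ≤ rlen t := fun t => by cases d' <;> simp [extPos]
  have hVe : ∀ t ∈ L n, (ext (n + 1) d' t ∈ VIS ↔ t ∈ vis) := fun t ht => by
    have := hL.ext_mem ht d'
    rw [ext_eq_ins] at this ⊢
    exact hV t (hL.sub n ht) _ (hextpos t) this
  have back : ∀ {j d T''}, SCandidate (L (n + 1)) VIS (ext (n + 1) d' T) j d T'' →
      ∃ T₁, SCandidate (L n) vis T j d T₁ := by
    intro j d T'' hc
    have hj : j < n + 1 := by
      refine lt_of_le_of_ne (isMinSlide_le hTe hc.1) ?_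
      rintro rfl
      have hc1 := hc.1
      rw [ext_eq_ins] at hc1
      obtain ⟨m, hm, rfl, -⟩ := (isMinSlide_ins (hextpos T) (lt_succ_of_mem_onVertices hTn)).1 hc1
      exact hc.2.2 ((hV T hTn m hm hc.2.1).2 hTv)
    obtain ⟨T₁, rfl, h1, h2⟩ := (isMinSlide_ext hL hTn hj).1 hc.1
    have h3 := hL.of_ext_mem h1 hc.2.1
    exact ⟨T₁, h2, h3, fun h => hc.2.2 ((hVe T₁ h3).2 h)⟩
  obtain ⟨j, d, hc, hm, ho⟩ := h
  have hj : j < n + 1 := Nat.lt_succ_of_le (isMinSlide_le hTn hc.1)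
  refine ⟨j, d, ⟨(isMinSlide_ext hL hTn hj).2 ⟨T', rfl, hL.sub n hc.2.1, hc.1⟩,
    hL.ext_mem hc.2.1 d', fun h => hc.2.2 ((hVe T' hc.2.1).1 h)⟩, fun j' d'' T'' h => ?_,
    fun T'' h => ?_⟩
  · obtain ⟨T₁, h⟩ := back h
    exact hm _ _ _ h
  · obtain ⟨T₁, h⟩ := back h
    exact ho _ h

include hL in
/-- If the greedy algorithm follows a run for `n` vertices, then it follows the extended run. Here
`vis` and `VIS` are the trees visited before, and a tree of the larger language is in `VIS` exactly
if its restriction is in `vis`. -/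
theorem sChain_expand (hn : 1 ≤ n) {xs : List HState} {vis VIS : List BTree} {d : Dir}
    (hmem : ∀ x ∈ xs, x.tree ∈ L n)
    (hnd : (xs.map HState.tree).Nodup) (hvis : ∀ x ∈ xs, x.tree ∉ vis)
    (hV : ∀ t, t ∈ onVertices n → ∀ m ≤ rlen t, ins (n + 1) m t ∈ L (n + 1) →
      (ins (n + 1) m t ∈ VIS ↔ t ∈ vis)) (hVL : ∀ t ∈ VIS, t ∈ L (n + 1))
    (h : SChain (L n) vis (xs.map HState.tree)) :
    SChain (L (n + 1)) VIS ((expand (L (n + 1)) n d xs).map HState.tree) := by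
  induction xs generalizing vis VIS d with
  | nil => trivial
  | cons x xs ih =>
    have hx := hmem x (by simp)
    have hxn := hL.sub n hx
    rw [List.map_cons, List.nodup_cons] at hnd
    rw [expand, List.map_append, map_tree_fibStates]
    have hV' : ∀ t, t ∈ onVertices n → ∀ m ≤ rlen t, ins (n + 1) m t ∈ L (n + 1) →
        (ins (n + 1) m t ∈ VIS ++ (fibPos (L (n + 1)) (n + 1) x.tree d).map
          (fun m => ins (n + 1) m x.tree) ↔ t ∈ vis ++ [x.tree]) := by
      intro t ht m hm hmL
      rw [List.mem_append, List.mem_append, hV t ht m hm hmL, List.mem_singleton]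
      refine or_congr Iff.rfl ⟨fun h => ?_, ?_⟩
      · obtain ⟨m', hm', he⟩ := List.mem_map.1 h
        exact (ins_inj (mem_fibPos.1 hm').1 hm he).2.symm
      · rintro rfl
        exact List.mem_map.2 ⟨m, mem_fibPos.2 ⟨hm, hmL⟩, rfl⟩
    refine sChain_append ?_ (ih (vis := vis ++ [x.tree])
      (fun y hy => hmem y (List.mem_cons_of_mem _ hy)) hnd.2 ?_ hV' ?_ ?_) ?_
    · have := sChain_fib (L := L) hxn (d := d) (pre := VIS) (fun m hm hv =>
        hvis x (by simp) ((hV _ hxn m hm (hVL _ hv)).1 hv)) (P₁ := []) (P₂ := _) rfl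
      rwa [List.map_nil, List.append_nil] at this
    · intro y hy hyv
      rw [List.mem_append, List.mem_singleton] at hyv
      rcases hyv with hyv | hyv
      · exact hvis y (List.mem_cons_of_mem _ hy) hyv
      · exact hnd.1 (List.mem_map.2 ⟨y, hy, hyv⟩)
    · intro t ht
      rw [List.mem_append] at ht
      rcases ht with ht | ht
      · exact hVL t ht
      · obtain ⟨m, hm, rfl⟩ := List.mem_map.1 ht
        exact (mem_fibPos.1 hm).2
    · cases xs with
      | nil => trivial
      | cons y ys => exact h.2
    · intro T hT T' hT'
      rw [List.getLast?_map, (fibPos_spec hL hx d).1] at hT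
      obtain rfl := Option.some.inj hT
      cases xs with
      | nil => simp [expand] at hT'
      | cons y ys =>
        rw [List.head?_map, head?_expand hL hn (hmem y (by simp)), flip_flip] at hT'
        obtain rfl := Option.some.inj hT'
        beta_reduce
        rw [← ext_eq_ins]
        exact sNext_ext hL hx (by simp) hV' h.1 d

end Level

/-! ### The run of the history-free algorithm -/

/-- The states at the visits of the history-free algorithm, by recursion on the number of
vertices. -/
noncomputable def hRun (L : ℕ → Set BTree) : ℕ → List HState
  | 0 => []
  | 1 => [HState.init 1]
  | n + 2 => expand (L (n + 2)) (n + 1) .up (hRun L (n + 1))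

theorem bot_rightPath (a m : ℕ) : bot (a + m) (rightPath a m) = rightPath a (m + 1) := by
  induction m generalizing a with
  | zero => rfl
  | succ m ih =>
    rw [rightPath, bot, show a + (m + 1) = a + 1 + m by omega, ih]
    rfl

theorem onVertices_one {T : BTree} (h : T ∈ onVertices 1) : T = rightPath 1 1 := by
  obtain ⟨m, t, hm, rfl, ht⟩ := exists_eq_ins_of_mem h
  cases t with
  | nil =>
    obtain rfl : m = 0 := by simpa [rlen] using hm
    rfl
  | node a l r =>
    have := lt_succ_of_mem_onVertices ht a (by simp [verts])
    have h2 := ht.2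
    have : a ∈ Finset.Icc 1 0 := h2 ▸ (by simp [verts])
    simp at this

section Run

variable {L : ℕ → Set BTree} (hL : Zigzag L)

include hL in
/-- By induction on the number of vertices, `hRun` is a run of the history-free algorithm that
visits every tree of the language once, and it makes the greedy choices. -/
theorem hRun_spec (n : ℕ) :
    RunOk L (n + 1) (hRun L (n + 1)) ∧ (hRun L (n + 1)).head? = some (HState.init (n + 1)) ∧
    ((hRun L (n + 1)).map HState.tree).Nodup ∧
    (∀ T, T ∈ (hRun L (n + 1)).map HState.tree ↔ T ∈ L (n + 1)) ∧
    SChain (L (n + 1)) [] ((hRun L (n + 1)).map HState.tree) := by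
  induction n with
  | zero =>
    refine ⟨⟨?_, ?_, List.IsChain.singleton _, ?_⟩, rfl,
      List.nodup_singleton _, fun T => ?_, trivial⟩
    · intro x hx
      rw [hRun, List.mem_singleton] at hx
      rw [hx]; exact hL.one
    · intro x hx v _
      rw [hRun, List.mem_singleton] at hx
      rw [hx]; rfl
    · rintro _ ⟨rfl⟩; rfl
    · simp only [zero_add, hRun, List.map_cons, List.map_nil, List.mem_singleton]
      refine ⟨fun h => h ▸ hL.one, fun h => onVertices_one (hL.sub 1 h)⟩
  | succ n ih =>
    obtain ⟨hok, hhead, hnd, hmem, hS⟩ := ih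
    have hn : 1 ≤ n + 1 := by omega
    obtain ⟨xs, hxs⟩ : ∃ xs, hRun L (n + 1) = HState.init (n + 1) :: xs := by
      cases h : hRun L (n + 1) with
      | nil => rw [h] at hhead; simp at hhead
      | cons x xs =>
        rw [h] at hhead
        exact ⟨xs, by rw [Option.some.inj hhead]⟩
    rw [hRun]
    refine ⟨hok.expand hL hn .up, ?_, nodup_trees_expand hnd, fun T => ?_,
      sChain_expand hL hn hok.mem hnd (by simp) (by simp) (by simp) hS⟩
    · have h0 := hok.mem (HState.init (n + 1)) (by rw [hxs]; simp)
      rw [hxs, head?_expand hL hn h0]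
      simp only [HState.init, Function.update_eq_self, Option.some.injEq, HState.mk.injEq,
        and_true]
      have h1 := bot_rightPath 1 (n + 1)
      rw [add_comm 1 (n + 1)] at h1
      exact h1
    · rw [mem_trees_expand]
      constructor
      · rintro ⟨x, -, m, -, -, h⟩
        exact h
      · intro hT
        obtain ⟨m, t, hm, rfl, ht⟩ := exists_eq_ins_of_mem (hL.sub _ hT)
        obtain ⟨x, hx, rfl⟩ := List.mem_map.1 ((hmem t).2 (hL.del _ m t ht hT))
        exact ⟨x, hx, m, hm, rfl, hT⟩

theorem hStep_unique {𝓛 : Set BTree} {n : ℕ} {x y y' : HState} (h : HStep 𝓛 n x y)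
    (h' : HStep 𝓛 n x y') : y = y' := by
  obtain ⟨-, T, hT, hm, rfl⟩ := h
  obtain ⟨-, T', hT', hm', rfl⟩ := h'
  rw [isMinSlide_unique hm hm' hT hT']

/-- The history-free algorithm is deterministic, and it stops exactly when `s_n = 1`. -/
theorem isHRun_unique {𝓛 : Set BTree} {n : ℕ} {xs ys : List HState} (hh : xs.head? = ys.head?)
    (hx : xs.IsChain (HStep 𝓛 n)) (hy : ys.IsChain (HStep 𝓛 n))
    (lx : ∀ x ∈ xs.getLast?, x.s n = 1) (ly : ∀ x ∈ ys.getLast?, x.s n = 1) : xs = ys := by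
  induction xs generalizing ys with
  | nil =>
    cases ys with
    | nil => rfl
    | cons _ _ => simp at hh
  | cons x xs ih =>
    cases ys with
    | nil => simp at hh
    | cons y ys =>
      obtain rfl : x = y := by simpa using hh
      cases xs with
      | nil =>
        cases ys with
        | nil => rfl
        | cons y ys => exact absurd (lx x rfl) (List.isChain_cons_cons.1 hy).1.1
      | cons z xs =>
        cases ys with
        | nil => exact absurd (ly x rfl) (List.isChain_cons_cons.1 hx).1.1
        | cons y ys =>
          rw [List.isChain_cons_cons] at hx hy
          obtain rfl := hStep_unique hx.1 hy.1
          rw [List.getLast?_cons_cons] at lx ly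
          rw [ih (ys := z :: ys) rfl hx.2 hy.2 lx ly]

include hL in
theorem isHRun_iff {n : ℕ} (hn : 1 ≤ n) (ys : List HState) :
    IsHRun (L n) n ys ↔ ys = hRun L n := by
  obtain ⟨n, rfl⟩ : ∃ m, n = m + 1 := ⟨n - 1, by omega⟩
  obtain ⟨hok, hhead, -⟩ := hRun_spec hL n
  constructor
  · rintro ⟨h1, h2, h3⟩
    exact isHRun_unique (h1.trans hhead.symm) h2 hok.chain h3 hok.last
  · rintro rfl
    exact ⟨hhead, hok.chain, hok.last⟩

include hL in
theorem isSRun_iff_eq {n : ℕ} (hn : 1 ≤ n) (vs : List BTree) :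
    IsSRun (L n) (rightPath 1 n) vs ↔ vs = (hRun L n).map HState.tree := by
  obtain ⟨n, rfl⟩ : ∃ m, n = m + 1 := ⟨n - 1, by omega⟩
  obtain ⟨hok, hhead, -, hmem, hS⟩ := hRun_spec hL n
  have hh : ((hRun L (n + 1)).map HState.tree).head? = some (rightPath 1 (n + 1)) := by
    rw [List.head?_map, hhead]; rfl
  -- at the end every tree of the language has been visited, so no candidate is left
  have hl : ∀ T ∈ ((hRun L (n + 1)).map HState.tree).getLast?, ∀ T',
      ¬ SNext (L (n + 1)) ((hRun L (n + 1)).map HState.tree) T T' := by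
    rintro T - T' ⟨j, d, ⟨-, h1, h2⟩, -⟩
    exact h2 ((hmem _).2 h1)
  rw [isSRun_iff]
  constructor
  · rintro ⟨h1, h2, h3⟩
    exact sChain_unique (h1.trans hh.symm) h2 hS h3 hl
  · rintro rfl
    exact ⟨hh, hS, hl⟩

end Run

/-! ### The effect of a rotation on the links of a tree -/

theorem parent_node (a : ℕ) (l r : BTree) (v : ℕ) :
    parent (node a l r) v = if root? l = some v ∨ root? r = some v then some a
      else if v < a then parent l v else parent r v := by
  rw [parent]

theorem root?_node (a : ℕ) (l r : BTree) : root? (node a l r) = some a := rfl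

theorem parent_mem {t : BTree} {v w : ℕ} (h : parent t v = some w) : w ∈ verts t := by
  induction t with
  | nil => simp [parent] at h
  | node a l r ihl ihr =>
    rw [parent_node] at h
    rw [mem_verts_node]
    split_ifs at h
    · exact Or.inl (Option.some.inj h).symm
    · exact Or.inr (Or.inl (ihl h))
    · exact Or.inr (Or.inr (ihr h))

/-- The links that change under an up-rotation of `j` with parent `i`, read in both directions. -/
structure LinkChange (i j : ℕ) (T T' : BTree) : Prop where
  lt : i < j
  mem : i ∈ verts T
  left_j : leftChild T' j = some i
  right_i : rightChild T i = some j
  par_j : parent T j = some i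
  par_i : parent T' i = some j
  par_top : parent T' j = parent T i
  inner : rightChild T' i = leftChild T j
  root : parent T i = none → root? T = some i ∧ root? T' = some j
  root_eq : parent T i ≠ none → root? T' = root? T
  left_top : ∀ v, parent T i = some v → j < v → leftChild T v = some i ∧ leftChild T' v = some j
  right_top : ∀ v, parent T i = some v → v < j → rightChild T v = some i ∧ rightChild T' v = some j
  left_eq : ∀ v, v ≠ j → ¬ (parent T i = some v ∧ j < v) → leftChild T' v = leftChild T v
  right_eq : ∀ v, v ≠ i → ¬ (parent T i = some v ∧ v < j) → rightChild T' v = rightChild T v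
  par_inner : ∀ v, leftChild T j = some v → parent T v = some j ∧ parent T' v = some i
  par_eq : ∀ v, v ≠ i → v ≠ j → leftChild T j ≠ some v → parent T' v = parent T v
  top_ne : ∀ v, parent T i = some v → v ≠ i ∧ v ≠ j

/-- The recursive description of a rotation determines all links, by cases on the position of each
vertex relative to the roots on the path. -/
theorem UpStep.linkChange {j : ℕ} {T T' : BTree} (h : UpStep j T T') (hs : IsSearch T) :
    ∃ i, LinkChange i j T T' := by
  induction h with
  | here i l y z =>
    obtain ⟨h1, h2, h3, h4, h5, h6, h7⟩ := hs
    have hij : i < j := h2 j (by simp [verts])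
    have hy : ∀ x ∈ verts y, i < x := fun x hx => h2 x (by simp [verts, hx])
    have hl' : ∀ x, root? l = some x → x < i := fun x hx => h1 x (mem_verts_of_root hx)
    have hy' : ∀ x, root? y = some x → i < x ∧ x < j := fun x hx =>
      ⟨hy x (mem_verts_of_root hx), h4 x (mem_verts_of_root hx)⟩
    have hz' : ∀ x, root? z = some x → j < x := fun x hx => h5 x (mem_verts_of_root hx)
    have hsT : IsSearch (node i l (node j y z)) := ⟨h1, h2, h3, h4, h5, h6, h7⟩
    have pi : parent (node i l (node j y z)) i = none :=
      parent_root hsT rfl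
    have pj : parent (node j (node i l y) z) j = none :=
      parent_root ((UpStep.here i l y z).isSearch_iff.2 hsT) rfl
    have hl2 : ∀ x, i ≤ x → parent l x = none := fun x hx =>
      parent_of_notMem (fun h => absurd (h1 x h) (by omega))
    have hz2 : ∀ x, x ≤ j → parent z x = none := fun x hx =>
      parent_of_notMem (fun h => absurd (h5 x h) (by omega))
    have hy2 : ∀ x, x ≤ i ∨ j ≤ x → parent y x = none := fun x hx =>
      parent_of_notMem (fun h => by have := hy x h; have := h4 x h; omega)
    refine ⟨i, ?_⟩
    constructor
    · exact hij
    · simp [verts]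
    all_goals simp only [pi, pj, leftChild_node, rightChild_node, parent_node, root?_node]
    all_goals grind
  | left r ha h ih =>
    rename_i a l l'
    obtain ⟨i, hi⟩ := ih hs.2.2.1
    have hia : i < a := hs.1 i hi.mem
    have hl' : ∀ x, root? l = some x → x < a := fun x hx => hs.1 x (mem_verts_of_root hx)
    have hl3 : ∀ x, root? l' = some x → x < a := fun x hx =>
      hs.1 x (h.verts_eq ▸ mem_verts_of_root hx)
    have hr' : ∀ x, root? r = some x → a < x := fun x hx => hs.2.1 x (mem_verts_of_root hx)
    have hp : ∀ x y, parent l x = some y → y < a := fun x y h => hs.1 y (parent_mem h)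
    have hc : ∀ x y, leftChild l x = some y → y < a := fun x y h => hs.1 y (leftChild_mem h)
    have h0 : ∀ x, root? l = some x → parent l x = none := fun x h => parent_root hs.2.2.1 h
    have h0' : ∀ x, root? l' = some x → parent l' x = none :=
      fun x hx => parent_root (h.isSearch_iff.2 hs.2.2.1) hx
    obtain ⟨k1, k2, k3, k4, k5, k6, k7, k8, k9, k10, k11, k12, k13, k14, k15, k16, k17⟩ := hi
    refine ⟨i, ?_⟩
    constructor
    · exact k1
    · exact mem_verts_node.2 (Or.inr (Or.inl k2))
    all_goals simp only [leftChild_node, rightChild_node, parent_node, root?_node]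
    all_goals grind
  | right l ha h ih =>
    rename_i a r r'
    obtain ⟨i, hi⟩ := ih hs.2.2.2
    have hia : a < i := hs.2.1 i hi.mem
    have hl' : ∀ x, root? l = some x → x < a := fun x hx => hs.1 x (mem_verts_of_root hx)
    have hr' : ∀ x, root? r = some x → a < x := fun x hx => hs.2.1 x (mem_verts_of_root hx)
    have hr3 : ∀ x, root? r' = some x → a < x := fun x hx =>
      hs.2.1 x (h.verts_eq ▸ mem_verts_of_root hx)
    have hp : ∀ x y, parent r x = some y → a < y := fun x y h => hs.2.1 y (parent_mem h)
    have hc : ∀ x y, leftChild r x = some y → a < y := fun x y h => hs.2.1 y (leftChild_mem h)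
    have h0 : ∀ x, root? r = some x → parent r x = none := fun x h => parent_root hs.2.2.2 h
    have h0' : ∀ x, root? r' = some x → parent r' x = none :=
      fun x hx => parent_root (h.isSearch_iff.2 hs.2.2.2) hx
    obtain ⟨k1, k2, k3, k4, k5, k6, k7, k8, k9, k10, k11, k12, k13, k14, k15, k16, k17⟩ := hi
    refine ⟨i, ?_⟩
    constructor
    · exact k1
    · exact mem_verts_node.2 (Or.inr (Or.inr k2))
    all_goals simp only [leftChild_node, rightChild_node, parent_node, root?_node]
    all_goals grind

/-! ### Reasoning about word RAM programs -/

/-- Assign to a register. -/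
def Memory.setReg (m : Memory) (x v : ℕ) : Memory := { m with reg := Function.update m.reg x v }

/-- Assign to an array entry. -/
def Memory.setArr (m : Memory) (a i v : ℕ) : Memory :=
  { m with arr := Function.update m.arr a (Function.update (m.arr a) i v) }

@[simp] theorem Memory.setReg_reg (m : Memory) (x v y : ℕ) :
    (m.setReg x v).reg y = if y = x then v else m.reg y := by
  simp [Memory.setReg, Function.update_apply]

@[simp] theorem Memory.setReg_arr (m : Memory) (x v : ℕ) : (m.setReg x v).arr = m.arr := rfl

@[simp] theorem Memory.setArr_reg (m : Memory) (a i v : ℕ) : (m.setArr a i v).reg = m.reg := rfl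

@[simp] theorem Memory.setArr_arr (m : Memory) (a i v b k : ℕ) :
    (m.setArr a i v).arr b k = if b = a then (if k = i then v else m.arr b k) else m.arr b k := by
  by_cases h : b = a
  · subst h; simp [Memory.setArr, Function.update_apply]
  · simp [Memory.setArr, h]

/-- The memory after a program without loops. -/
def Prog.run (M : ℕ) : Prog → Memory → Memory
  | .skip, m => m
  | .assign x u, m => m.setReg x (u.val M m)
  | .put a i u, m => m.setArr a (i.val M m) (u.val M m)
  | .seq p q, m => q.run M (p.run M m)
  | .cond u p q, m => if u.val M m = 0 then q.run M m else p.run M m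
  | .loop _ _, m => m
  | .visit, m => m

/-- A bound on the number of steps of a program without loops. -/
def Prog.time : Prog → ℕ
  | .skip => 1
  | .assign _ u => u.cost + 1
  | .put _ i u => i.cost + u.cost + 1
  | .seq p q => p.time + q.time
  | .cond u p q => u.cost + 1 + (p.time + q.time)
  | .loop _ _ => 0
  | .visit => 0

/-- The program contains neither loops nor visits. -/
def Prog.flat : Prog → Bool
  | .seq p q => p.flat && q.flat
  | .cond _ p q => p.flat && q.flat
  | .loop _ _ => false
  | .visit => false
  | _ => true

/-- The program contains an assignment to the register `x`. -/
def Prog.wr (x : ℕ) : Prog → Bool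
  | .assign y _ => x == y
  | .seq p q => p.wr x || q.wr x
  | .cond _ p q => p.wr x || q.wr x
  | .loop _ p => p.wr x
  | _ => false

/-- The program contains an assignment to an entry of the array `a`. -/
def Prog.wa (a : ℕ) : Prog → Bool
  | .put b _ _ => a == b
  | .seq p q => p.wa a || q.wa a
  | .cond _ p q => p.wa a || q.wa a
  | .loop _ p => p.wa a
  | _ => false

/-- The memories agree on all registers and arrays to which `p` contains no assignment. -/
structure Same (p : Prog) (m m' : Memory) : Prop where
  reg : ∀ x, p.wr x = false → m'.reg x = m.reg x
  arr : ∀ a, p.wa a = false → m'.arr a = m.arr a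

theorem Same.refl (p : Prog) (m : Memory) : Same p m m := ⟨fun _ _ => rfl, fun _ _ => rfl⟩

theorem Same.trans {p : Prog} {m m' m'' : Memory} (h : Same p m m') (h' : Same p m' m'') :
    Same p m m'' :=
  ⟨fun x hx => (h'.reg x hx).trans (h.reg x hx), fun a ha => (h'.arr a ha).trans (h.arr a ha)⟩

theorem Exec.same {M : ℕ} {p : Prog} {c c' : Config} (h : Exec M p c c') :
    Same p c.mem c'.mem := by
  induction h with
  | skip c => exact Same.refl _ _
  | assign x u c =>
    refine ⟨fun y hy => ?_, fun _ _ => rfl⟩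
    have : y ≠ x := by simpa [Prog.wr] using hy
    simp [Function.update_of_ne this]
  | put a i u c =>
    refine ⟨fun _ _ => rfl, fun b hb => ?_⟩
    have : b ≠ a := by simpa [Prog.wa] using hb
    simp [Function.update_of_ne this]
  | seq _ _ ih1 ih2 =>
    constructor
    · intro x hx
      simp only [Prog.wr, Bool.or_eq_false_iff] at hx
      exact (ih2.reg x hx.2).trans (ih1.reg x hx.1)
    · intro x hx
      simp only [Prog.wa, Bool.or_eq_false_iff] at hx
      exact (ih2.arr x hx.2).trans (ih1.arr x hx.1)
  | cond_true _ _ ih =>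
    constructor
    · intro x hx
      simp only [Prog.wr, Bool.or_eq_false_iff] at hx
      exact ih.reg x hx.1
    · intro x hx
      simp only [Prog.wa, Bool.or_eq_false_iff] at hx
      exact ih.arr x hx.1
  | cond_false _ _ ih =>
    constructor
    · intro x hx
      simp only [Prog.wr, Bool.or_eq_false_iff] at hx
      exact ih.reg x hx.2
    · intro x hx
      simp only [Prog.wa, Bool.or_eq_false_iff] at hx
      exact ih.arr x hx.2
  | loop_true _ _ _ ih1 ih2 =>
    exact ⟨fun x hx => (ih2.reg x hx).trans (ih1.reg x hx),
      fun a ha => (ih2.arr a ha).trans (ih1.arr a ha)⟩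
  | loop_false _ => exact Same.refl _ _
  | visit c => exact Same.refl _ _

/-- From memory `m`, the program reaches memory `m'` in at most `t` steps and without a visit. -/
def Runs (M : ℕ) (p : Prog) (m m' : Memory) (t : ℕ) : Prop :=
  ∀ clk log, ∃ clk' ≤ clk + t, Exec M p ⟨m, clk, log⟩ ⟨m', clk', log⟩

theorem Runs.same {M : ℕ} {p : Prog} {m m' : Memory} {t : ℕ} (h : Runs M p m m' t) :
    Same p m m' := by
  obtain ⟨_, _, h⟩ := h 0 []
  exact h.same

theorem Runs.mono {M : ℕ} {p : Prog} {m m' : Memory} {t t' : ℕ} (h : Runs M p m m' t)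
    (ht : t ≤ t') : Runs M p m m' t' := fun clk log => by
  obtain ⟨c, hc, h⟩ := h clk log
  exact ⟨c, by omega, h⟩

theorem Runs.seq {M : ℕ} {p q : Prog} {m m' m'' : Memory} {t t' : ℕ} (h : Runs M p m m' t)
    (h' : Runs M q m' m'' t') : Runs M (.seq p q) m m'' (t + t') := fun clk log => by
  obtain ⟨c, hc, h⟩ := h clk log
  obtain ⟨c', hc', h'⟩ := h' c log
  exact ⟨c', by omega, .seq h h'⟩

theorem Runs.of_flat {M : ℕ} {p : Prog} (hp : p.flat = true) (m : Memory) :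
    Runs M p m (p.run M m) p.time := by
  induction p generalizing m with
  | skip => exact fun clk log => ⟨clk + 1, le_rfl, .skip _⟩
  | assign x u => exact fun clk log => ⟨clk + (u.cost + 1), le_rfl, .assign x u _⟩
  | put a i u => exact fun clk log => ⟨clk + (i.cost + u.cost + 1), le_rfl, .put a i u _⟩
  | seq p q ihp ihq =>
    simp only [Prog.flat, Bool.and_eq_true] at hp
    exact (ihp hp.1 m).seq (ihq hp.2 _)
  | cond u p q ihp ihq =>
    simp only [Prog.flat, Bool.and_eq_true] at hp
    intro clk log
    by_cases hu : u.val M m = 0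
    · obtain ⟨c, hc, h⟩ := ihq hp.2 m (clk + (u.cost + 1)) log
      refine ⟨c, by simp only [Prog.time]; omega, ?_⟩
      rw [Prog.run, if_pos hu]
      exact .cond_false hu h
    · obtain ⟨c, hc, h⟩ := ihp hp.1 m (clk + (u.cost + 1)) log
      refine ⟨c, by simp only [Prog.time]; omega, ?_⟩
      rw [Prog.run, if_neg hu]
      exact .cond_true hu h
  | loop u p => simp [Prog.flat] at hp
  | visit => simp [Prog.flat] at hp

/-- The rule for loops: `Inv i` is the invariant when `i` iterations remain, and `Φ i` bounds the
number of steps that they take. The memory that the body does not write stays the same. -/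
theorem Runs.loop {M : ℕ} {u : Expr} {p : Prog} (Inv : ℕ → Memory → Prop) (Φ : ℕ → ℕ) {N : ℕ}
    {m₀ : Memory} (h0 : Inv N m₀)
    (hu : ∀ i m, Same p m₀ m → Inv i m → (u.val M m = 0 ↔ i = 0))
    (hb : ∀ i m, Same p m₀ m → Inv (i + 1) m →
      ∃ m' t, Runs M p m m' t ∧ Inv i m' ∧ t + (u.cost + 1) + Φ i ≤ Φ (i + 1)) :
    ∃ m', Runs M (.loop u p) m₀ m' (Φ N + (u.cost + 1)) ∧ Inv 0 m' ∧ Same p m₀ m' := by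
  have key : ∀ i m, Same p m₀ m → Inv i m →
      ∃ m', Runs M (.loop u p) m m' (Φ i + (u.cost + 1)) ∧ Inv 0 m' ∧ Same p m₀ m' := by
    intro i
    induction i with
    | zero =>
      intro m hs hi
      refine ⟨m, fun clk log => ⟨clk + (u.cost + 1), by omega, ?_⟩, hi, hs⟩
      exact .loop_false ((hu 0 m hs hi).2 rfl)
    | succ i ih =>
      intro m hs hi
      obtain ⟨m', t, hr, hi', ht⟩ := hb i m hs hi
      obtain ⟨m'', hr', hi'', hs'⟩ := ih m' (hs.trans hr.same) hi'
      refine ⟨m'', fun clk log => ?_, hi'', hs'⟩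
      obtain ⟨c, hc, h⟩ := hr (clk + (u.cost + 1)) log
      obtain ⟨c', hc', h'⟩ := hr' c log
      refine ⟨c', by omega, .loop_true (fun h => ?_) h h'⟩
      exact absurd ((hu _ m hs hi).1 h) (by omega)
  exact key N m₀ (Same.refl _ _) h0

/-! ### Computing the preorder of a tree with a stack -/

/-- The memory holds the links of the tree `T`. -/
structure TreeIn (n : ℕ) (m : Memory) (T : BTree) : Prop where
  root : m.reg 2 = code (root? T)
  left : ∀ v, 1 ≤ v → v ≤ n → m.arr 5 v = code (leftChild T v)
  right : ∀ v, 1 ≤ v → v ≤ n → m.arr 6 v = code (rightChild T v)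

/-- One iteration of the traversal: the top entry of the stack in array `11`, whose height is in
register `11`, is replaced by its children and appended to the list in array `10`, whose length is
in register `12`. -/
def preBody : Prog :=
  (Prog.assign 11 (.sub (.reg 11) (.const 1))).seq <|
  (Prog.assign 13 (.get 11 (.reg 11))).seq <|
  Prog.cond (.reg 13)
    ((Prog.put 10 (.reg 12) (.reg 13)).seq <|
     (Prog.assign 12 (.add (.reg 12) (.const 1))).seq <|
     (Prog.put 11 (.reg 11) (.get 6 (.reg 13))).seq <|
     (Prog.assign 11 (.add (.reg 11) (.const 1))).seq <|
     (Prog.put 11 (.reg 11) (.get 5 (.reg 13))).seq <|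
     (Prog.assign 11 (.add (.reg 11) (.const 1))))
    .skip

/-- The program that writes the preorder of the tree to array `10`. -/
def preProg : Prog :=
  ((Prog.assign 11 (.const 1)).seq <|
   (Prog.put 11 (.const 0) (.reg 2)).seq <|
   (Prog.assign 12 (.const 0))).seq <|
  Prog.loop (.reg 11) preBody

/-- The entries of the array `f` from position `l.length - 1` down to `0` are the roots of the trees
in `l`. -/
def Stacked (f : ℕ → ℕ) : List BTree → Prop
  | [] => True
  | t :: l => f l.length = code (root? t) ∧ Stacked f l

theorem Stacked.congr {f g : ℕ → ℕ} {l : List BTree} (h : Stacked f l)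
    (hfg : ∀ i < l.length, g i = f i) : Stacked g l := by
  induction l with
  | nil => trivial
  | cons t l ih =>
    refine ⟨(hfg _ (by simp)).trans h.1, ih h.2 (fun i hi => hfg i ?_)⟩
    rw [List.length_cons]; omega

/-- `t` is one of the subtrees of `T`, in terms of the links of its vertices. -/
def SubOf (T t : BTree) : Prop := ∀ v ∈ verts t, subAt t v = subAt T v

theorem SubOf.left {T : BTree} {a : ℕ} {l r : BTree} (h : SubOf T (node a l r))
    (hs : IsSearch (node a l r)) : SubOf T l := fun v hv => by
  rw [← h v (mem_verts_node.2 (Or.inr (Or.inl hv)))]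
  have := hs.1 v hv
  rw [subAt, if_neg this.ne, if_pos this]

theorem SubOf.right {T : BTree} {a : ℕ} {l r : BTree} (h : SubOf T (node a l r))
    (hs : IsSearch (node a l r)) : SubOf T r := fun v hv => by
  rw [← h v (mem_verts_node.2 (Or.inr (Or.inr hv)))]
  have := hs.2.1 v hv
  rw [subAt, if_neg this.ne', if_neg this.not_gt]

theorem SubOf.leftChild {T : BTree} {a : ℕ} {l r : BTree} (h : SubOf T (node a l r)) :
    leftChild T a = root? l := by
  rw [BTree.leftChild, ← h a (mem_verts_node.2 (Or.inl rfl)), subAt, if_pos rfl]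
  rfl

theorem SubOf.rightChild {T : BTree} {a : ℕ} {l r : BTree} (h : SubOf T (node a l r)) :
    rightChild T a = root? r := by
  rw [BTree.rightChild, ← h a (mem_verts_node.2 (Or.inl rfl)), subAt, if_pos rfl]
  rfl

/-- The number of iterations of the traversal that a stack entry causes. -/
def work (t : BTree) : ℕ := 2 * (preorder t).length + 1

/-- The invariant of the traversal: the vertices written so far, followed by those of the trees on
the stack, form the preorder of the whole tree. -/
def PreInv (T : BTree) (n : ℕ) (i : ℕ) (m : Memory) : Prop :=
  ∃ (ts : List BTree) (out : List ℕ),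
    m.reg 11 = ts.length ∧ Stacked (m.arr 11) ts ∧
    (∀ t ∈ ts, IsSearch t ∧ SubOf T t ∧ ∀ v ∈ verts t, 1 ≤ v ∧ v ≤ n) ∧
    out ++ ts.flatMap preorder = preorder T ∧ m.reg 12 = out.length ∧
    (∀ x < out.length, m.arr 10 x = out.getD x 0) ∧ i = (ts.map work).sum

theorem length_le_sum_work (ts : List BTree) : ts.length ≤ (ts.map work).sum := by
  induction ts with
  | nil => simp
  | cons t ts ih => simp only [List.length_cons, List.map_cons, List.sum_cons, work]; omega

theorem preBody_spec {M n : ℕ} {T : BTree} (hlen : (preorder T).length = n) (hM : 4 * n + 4 < M)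
    {i : ℕ} {m : Memory} (hT : TreeIn n m T) (hi : PreInv T n (i + 1) m) (hin : i ≤ 2 * n) :
    PreInv T n i (preBody.run M m) := by
  obtain ⟨ts, out, h1, h2, h3, h4, h5, h6, h7⟩ := hi
  have hlt := length_le_sum_work ts
  cases ts with
  | nil => simp at h7
  | cons t ts =>
    have hout : out.length ≤ n := by
      have := congrArg List.length h4
      rw [List.length_append] at this
      omega
    rw [List.length_cons] at h1 hlt
    have hM1 : 1 % M = 1 := Nat.mod_eq_of_lt (by omega)
    have e1 : (m.reg 11 - 1) % M = ts.length := by rw [h1]; exact Nat.mod_eq_of_lt (by omega)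
    have ht := h3 t (by simp)
    cases t with
    | nil =>
      have hz : m.arr 11 ts.length = 0 := h2.1
      refine ⟨ts, out, ?_, ?_, fun s hs => h3 s (List.mem_cons_of_mem _ hs), ?_, ?_, ?_, ?_⟩
      · simp [preBody, Prog.run, Expr.val, hM1, e1, hz]
      · refine h2.2.congr (fun k _ => ?_)
        simp [preBody, Prog.run, Expr.val, hM1, e1, hz]
      · simpa [preorder] using h4
      · simp [preBody, Prog.run, Expr.val, hM1, e1, hz, h5]
      · intro x hx
        simp [preBody, Prog.run, Expr.val, hM1, e1, hz, h6 x hx]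
      · simp [work, preorder] at h7; omega
    | node a l r =>
      have hv : m.arr 11 ts.length = a := h2.1
      have ha := ht.2.2 a (mem_verts_node.2 (Or.inl rfl))
      have ha0 : a ≠ 0 := by omega
      have e2 : (ts.length + 1) % M = ts.length + 1 := Nat.mod_eq_of_lt (by omega)
      have e3 : (ts.length + 1 + 1) % M = ts.length + 1 + 1 := Nat.mod_eq_of_lt (by omega)
      have e4 : (out.length + 1) % M = out.length + 1 := Nat.mod_eq_of_lt (by omega)
      have hl := hT.left a ha.1 ha.2
      have hr := hT.right a ha.1 ha.2
      rw [ht.2.1.leftChild] at hl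
      rw [ht.2.1.rightChild] at hr
      refine ⟨l :: r :: ts, out ++ [a], ?_, ?_, ?_, ?_, ?_, ?_, ?_⟩
      · simp [preBody, Prog.run, Expr.val, hM1, e1, hv, ha0, e2, e3]
      · refine ⟨?_, ?_, h2.2.congr (fun k hk => ?_)⟩
        · simp [preBody, Prog.run, Expr.val, hM1, e1, hv, ha0, e2, hl]
        · simp [preBody, Prog.run, Expr.val, hM1, e1, hv, ha0, e2, hr]
        · simp [preBody, Prog.run, Expr.val, hM1, e1, hv, ha0, e2, hk.ne,
            (show k ≠ ts.length + 1 by omega)]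
      · intro s hs
        rw [List.mem_cons, List.mem_cons] at hs
        rcases hs with rfl | rfl | hs
        · exact ⟨ht.1.2.2.1, ht.2.1.left ht.1,
            fun v hv => ht.2.2 v (mem_verts_node.2 (Or.inr (Or.inl hv)))⟩
        · exact ⟨ht.1.2.2.2, ht.2.1.right ht.1,
            fun v hv => ht.2.2 v (mem_verts_node.2 (Or.inr (Or.inr hv)))⟩
        · exact h3 s (List.mem_cons_of_mem _ hs)
      · rw [← h4]; simp [preorder]
      · simp [preBody, Prog.run, Expr.val, hM1, e1, hv, ha0, h5, e4]
      · intro x hx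
        rw [List.length_append, List.length_singleton] at hx
        rcases Nat.lt_succ_iff_lt_or_eq.1 hx with hx | rfl
        · rw [List.getD_append _ _ _ _ hx, ← h6 x hx]
          simp [preBody, Prog.run, Expr.val, hM1, e1, hv, ha0, h5, hx.ne]
        · simp [preBody, Prog.run, Expr.val, hM1, e1, hv, ha0, h5]
      · simp [work, preorder] at h7 ⊢; omega

theorem length_preorder {T : BTree} (hT : IsSearch T) : (preorder T).length = (verts T).card := by
  induction T with
  | nil => rfl
  | node a l r ihl ihr =>
    rw [preorder, List.length_cons, List.length_append, ihl hT.2.2.1, ihr hT.2.2.2, verts,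
      Finset.card_insert_of_notMem, Finset.card_union_of_disjoint]
    · rw [Finset.disjoint_left]
      intro x hx hx'
      exact absurd (hT.1 x hx) (hT.2.1 x hx').not_gt
    · rw [Finset.mem_union, not_or]
      exact ⟨fun h => lt_irrefl _ (hT.1 a h), fun h => lt_irrefl _ (hT.2.1 a h)⟩

theorem length_preorder_of_mem {n : ℕ} {T : BTree} (hT : T ∈ onVertices n) :
    (preorder T).length = n := by
  rw [length_preorder hT.1, hT.2, Nat.card_Icc, Nat.add_sub_cancel]

theorem TreeIn.congr {n : ℕ} {m m' : Memory} {T : BTree} (h : TreeIn n m T)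
    (h2 : m'.reg 2 = m.reg 2) (h5 : m'.arr 5 = m.arr 5) (h6 : m'.arr 6 = m.arr 6) :
    TreeIn n m' T :=
  ⟨h2.trans h.root, fun v h1 hn => h5 ▸ h.left v h1 hn, fun v h1 hn => h6 ▸ h.right v h1 hn⟩

theorem preProg_spec {M n : ℕ} {T : BTree} (hTn : T ∈ onVertices n) (hM : 4 * n + 4 < M)
    {m : Memory} (hT : TreeIn n m T) :
    ∃ m', Runs M preProg m m' (100 * n + 100) ∧ ∀ x < n, m'.arr 10 x = (preorder T).getD x 0 := by
  have hlen := length_preorder_of_mem hTn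
  have hM1 : 1 % M = 1 := Nat.mod_eq_of_lt (by omega)
  set p₀ : Prog := (Prog.assign 11 (.const 1)).seq <|
   (Prog.put 11 (.const 0) (.reg 2)).seq <|
   (Prog.assign 12 (.const 0)) with hp₀
  have h0 := Runs.of_flat (M := M) (p := p₀) rfl m
  have hinit : PreInv T n (2 * n + 1) (p₀.run M m) := by
    refine ⟨[T], [], ?_, ⟨?_, trivial⟩, ?_, ?_, ?_, ?_, ?_⟩
    · simp [hp₀, Prog.run, Expr.val, hM1]
    · simp [hp₀, Prog.run, Expr.val, hT.root]
    · intro t ht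
      rw [List.mem_singleton] at ht
      subst ht
      refine ⟨hTn.1, fun _ _ => rfl, fun v hv => ?_⟩
      rw [hTn.2, Finset.mem_Icc] at hv
      exact hv
    · simp
    · simp [hp₀, Prog.run, Expr.val]
    · simp
    · simp [work, hlen]
  obtain ⟨m', hr, hi, hs⟩ := Runs.loop (M := M) (u := .reg 11) (p := preBody)
    (fun i m => PreInv T n i m ∧ i ≤ 2 * n + 1) (fun i => i * 40) ⟨hinit, le_rfl⟩
    (fun i m _ hi => by
      obtain ⟨⟨ts, out, h1, -, -, -, -, -, h7⟩, -⟩ := hi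
      have := length_le_sum_work ts
      simp only [Expr.val, h1, h7]
      cases ts with
      | nil => simp
      | cons t ts => simp [work])
    (fun i m hs hi => by
      refine ⟨_, _, Runs.of_flat rfl m, ⟨preBody_spec hlen hM (hT.congr ?_ ?_ ?_) hi.1 (by omega),
        by omega⟩, ?_⟩
      · rw [hs.reg 2 rfl]; rfl
      · rw [hs.arr 5 rfl]; rfl
      · rw [hs.arr 6 rfl]; rfl
      · have : preBody.time ≤ 37 := by decide
        simp only [Expr.cost]
        omega)
  refine ⟨m', (h0.seq hr).mono ?_, ?_⟩
  · have : p₀.time ≤ 10 := by decide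
    simp only [Expr.cost]
    omega
  · obtain ⟨⟨ts, out, -, -, -, h4, -, h6, h7⟩, -⟩ := hi
    have hts : ts = [] := by
      have := length_le_sum_work ts
      rw [← List.length_eq_zero_iff]
      omega
    subst hts
    rw [List.flatMap_nil, List.append_nil] at h4
    subst h4
    intro x hx
    exact h6 x (by omega)

/-! ### The containment test by dynamic programming -/

open Classical in
/-- The truth value of a proposition as a word. -/
noncomputable def ind (p : Prop) : ℕ := if p then 1 else 0

theorem ind_of {p : Prop} (h : p) : ind p = 1 := if_pos h

theorem ind_of_not {p : Prop} (h : ¬ p) : ind p = 0 := if_neg h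

theorem ind_eq (p : Prop) : ind p = 0 ∨ ind p = 1 := by
  by_cases h : p
  · exact Or.inr (ind_of h)
  · exact Or.inl (ind_of_not h)

theorem ind_congr {p q : Prop} (h : p ↔ q) : ind p = ind q := by rw [propext h]

/-- The subtree of the pattern at `i` has an occurrence in `T` that maps `i` to `v`. -/
def OccA (e : ℕ → Bool) (P T : BTree) (i v : ℕ) : Prop := OccAt e (subAt P i) (subAt T v)

/-- The subtree of the pattern at `i` has an occurrence in the subtree of `T` at `v`. -/
def OccB (e : ℕ → Bool) (P T : BTree) (i v : ℕ) : Prop :=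
  AnySub (OccAt e (subAt P i)) (subAt T v)

/-- The condition that an edge of the pattern puts on the children of a vertex of the tree, where
`c` and `w` are the lower endpoint of the edge and the child in the direction of the edge. -/
def LinkAt (e : ℕ → Bool) (A B : ℕ → ℕ → Prop) (c w : Option ℕ) : Prop :=
  ∀ x, c = some x → ∃ y, w = some y ∧ if e x = true then A x y else B x y

theorem exists_root {t : BTree} (ht : t ≠ nil) : ∃ c, root? t = some c :=
  Option.ne_none_iff_exists'.1 (fun h => ht (root?_eq_none.1 h))

theorem link_iff_linkAt {e : ℕ → Bool} {P T p t : BTree}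
    (hp : ∀ x, root? p = some x → subAt P x = p) (ht : ∀ x, root? t = some x → subAt T x = t) :
    Link e p (OccAt e p) t ↔ LinkAt e (OccA e P T) (OccB e P T) (root? p) (root? t) := by
  cases p with
  | nil => simp [link_nil, LinkAt, root?]
  | node c pl pr =>
    have hc := hp c rfl
    rw [link_node]
    constructor
    · intro h x hx
      obtain rfl := Option.some.inj hx
      have hne : t ≠ nil := by
        rintro rfl
        split_ifs at h
        · exact h.1 rfl
        · exact h
      obtain ⟨y, hy⟩ := exists_root hne
      refine ⟨y, hy, ?_⟩
      rw [OccA, OccB, hc, ht y hy]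
      exact h
    · intro h
      obtain ⟨y, hy, h⟩ := h c rfl
      rw [OccA, OccB, hc, ht y hy] at h
      exact h

/-- The recursion for occurrences at a given vertex. -/
theorem occA_iff {e : ℕ → Bool} {P T : BTree} (hP : IsSearch P) (hT : IsSearch T) {i v : ℕ}
    (hi : i ∈ verts P) (hv : v ∈ verts T) :
    OccA e P T i v ↔
      LinkAt e (OccA e P T) (OccB e P T) (leftChild P i) (leftChild T v) ∧
      LinkAt e (OccA e P T) (OccB e P T) (rightChild P i) (rightChild T v) := by
  obtain ⟨pl, pr, hp⟩ := exists_subAt_eq_node hP hi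
  obtain ⟨l, r, ht⟩ := exists_subAt_eq_node hT hv
  have h1 : ∀ x, leftChild P i = some x → subAt P x = pl := fun x hx => by
    rw [← leftSub_subAt_eq hP hx, hp]; rfl
  have h2 : ∀ x, rightChild P i = some x → subAt P x = pr := fun x hx => by
    rw [← rightSub_subAt_eq hP hx, hp]; rfl
  have h3 : ∀ x, leftChild T v = some x → subAt T x = l := fun x hx => by
    rw [← leftSub_subAt_eq hT hx, ht]; rfl
  have h4 : ∀ x, rightChild T v = some x → subAt T x = r := fun x hx => by
    rw [← rightSub_subAt_eq hT hx, ht]; rfl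
  have e1 : leftChild P i = root? pl := by rw [leftChild, hp]; rfl
  have e2 : rightChild P i = root? pr := by rw [rightChild, hp]; rfl
  have e3 : leftChild T v = root? l := by rw [leftChild, ht]; rfl
  have e4 : rightChild T v = root? r := by rw [rightChild, ht]; rfl
  rw [e1] at h1 ⊢
  rw [e2] at h2 ⊢
  rw [e3] at h3 ⊢
  rw [e4] at h4 ⊢
  rw [← link_iff_linkAt h1 h3, ← link_iff_linkAt h2 h4, OccA, hp, ht]
  exact ⟨fun h => h.2, fun h => ⟨by simp, h⟩⟩

/-- The recursion for occurrences below a given vertex. -/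
theorem occB_iff {e : ℕ → Bool} {P T : BTree} (hT : IsSearch T) {i v : ℕ} (hv : v ∈ verts T) :
    OccB e P T i v ↔ OccA e P T i v ∨ (∃ w, leftChild T v = some w ∧ OccB e P T i w) ∨
      (∃ w, rightChild T v = some w ∧ OccB e P T i w) := by
  obtain ⟨l, r, ht⟩ := exists_subAt_eq_node hT hv
  have h3 : ∀ x, leftChild T v = some x → subAt T x = l := fun x hx => by
    rw [← leftSub_subAt_eq hT hx, ht]; rfl
  have h4 : ∀ x, rightChild T v = some x → subAt T x = r := fun x hx => by
    rw [← rightSub_subAt_eq hT hx, ht]; rfl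
  have e3 : leftChild T v = root? l := by rw [leftChild, ht]; rfl
  have e4 : rightChild T v = root? r := by rw [rightChild, ht]; rfl
  have key : ∀ (o : Option ℕ) (s : BTree), o = root? s → (∀ x, o = some x → subAt T x = s) →
      (AnySub (OccAt e (subAt P i)) s ↔ ∃ w, o = some w ∧ OccB e P T i w) := by
    intro o s ho hs
    constructor
    · intro h
      have hne : s ≠ nil := by rintro rfl; exact h
      obtain ⟨y, hy⟩ := exists_root hne
      exact ⟨y, ho.trans hy, by rw [OccB, hs y (ho.trans hy)]; exact h⟩
    · rintro ⟨w, hw, h⟩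
      rwa [OccB, hs w hw] at h
  rw [OccB, OccA, ht, AnySub, key _ l e3 h3, key _ r e4 h4]

/-- The truth value of `LinkAt` for the entries in the registers `c` and `w`; arrays `12` and `13`
hold the tables of `OccA` and `OccB`, with the entry for `(i, v)` at position `i * (n + 1) + v`,
register `26` holds `n + 1` and register `14` the offset of the pattern. -/
def linkExpr (c w : ℕ) : Expr :=
  .add (.eq (.reg c) (.const 0))
    (.mul (.mul (.lt (.const 0) (.reg c)) (.lt (.const 0) (.reg w)))
      (.add
        (.mul (.get 4 (.add (.reg 14) (.reg c)))
          (.get 12 (.add (.mul (.reg c) (.reg 26)) (.reg w))))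
        (.mul (.sub (.const 1) (.get 4 (.add (.reg 14) (.reg c))))
          (.get 13 (.add (.mul (.reg c) (.reg 26)) (.reg w))))))

/-- The entries of the two tables for the vertex `v` of the tree and the vertices `1, …, k` of the
pattern are correct. -/
def RowOk (n k : ℕ) (A B : ℕ → ℕ → Prop) (m : Memory) (v : ℕ) : Prop :=
  ∀ i, 1 ≤ i → i ≤ k → m.arr 12 (i * (n + 1) + v) = ind (A i v) ∧
    m.arr 13 (i * (n + 1) + v) = ind (B i v)

theorem linkExpr_val {M n k off : ℕ} {e : ℕ → Bool} {A B : ℕ → ℕ → Prop} {m : Memory}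
    {c w : ℕ} {co wo : Option ℕ} (hM : (n + 1) * (k + 1) < M) (hoff : off + k < M)
    (h26 : m.reg 26 = n + 1) (h14 : m.reg 14 = off) (hc : m.reg c = code co)
    (hw : m.reg w = code wo) (hco : ∀ x, co = some x → 1 ≤ x ∧ x ≤ k)
    (hwo : ∀ y, wo = some y → 1 ≤ y ∧ y ≤ n)
    (he : ∀ x, 1 ≤ x → x ≤ k → m.arr 4 (off + x) = (e x).toNat)
    (hrow : ∀ y, wo = some y → RowOk n k A B m y) :
    (linkExpr c w).val M m = ind (LinkAt e A B co wo) := by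
  have hM' : 1 < M := by nlinarith
  have hM1 : 1 % M = 1 := Nat.mod_eq_of_lt hM'
  cases co with
  | none =>
    have hc0 : m.reg c = 0 := hc
    rw [ind_of (p := LinkAt e A B none wo) (fun x hx => by simp at hx)]
    simp [linkExpr, Expr.val, hc0, hM1]
  | some x =>
    have hx := hco x rfl
    have hcx : m.reg c = x := hc
    have hx0 : x ≠ 0 := by omega
    cases wo with
    | none =>
      have hw0 : m.reg w = 0 := hw
      rw [ind_of_not (fun h => by obtain ⟨y, hy, -⟩ := h x rfl; simp at hy)]
      simp [linkExpr, Expr.val, hcx, hw0, hx0]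
    | some y =>
      have hy := hwo y rfl
      have hwy : m.reg w = y := hw
      have hb : x * (n + 1) + y < M := by nlinarith
      have hb1 : x * (n + 1) % M = x * (n + 1) := Nat.mod_eq_of_lt (by omega)
      have hb2 : (x * (n + 1) + y) % M = x * (n + 1) + y := Nat.mod_eq_of_lt hb
      have hb3 : (off + x) % M = off + x := Nat.mod_eq_of_lt (by omega)
      obtain ⟨r1, r2⟩ := hrow y rfl x hx.1 hx.2
      have hlink : LinkAt e A B (some x) (some y) ↔ if e x = true then A x y else B x y := by
        constructor
        · intro h
          obtain ⟨z, hz, h⟩ := h x rfl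
          obtain rfl := Option.some.inj hz
          exact h
        · intro h z hz
          obtain rfl := Option.some.inj hz
          exact ⟨y, rfl, h⟩
      rw [ind_congr hlink]
      have hv : (linkExpr c w).val M m = ((e x).toNat * ind (A x y) % M +
          (1 - (e x).toNat) % M * ind (B x y) % M) % M % M := by
        simp [linkExpr, Expr.val, hcx, hwy, hx0, hM1, h26, h14, hb1, hb2, hb3, he x hx.1 hx.2,
          r1, r2, show 0 < x by omega, show 0 < y by omega]
      rw [hv]
      cases e x
      · rcases ind_eq (B x y) with h | h <;> simp [h, hM1]
      · rcases ind_eq (A x y) with h | h <;> simp [h, hM1]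

/-- The first part of the computation of one entry of the tables: register `20` holds the vertex of
the pattern, whose children go to registers `21` and `22`. -/
def dpChildren : Prog :=
  (Prog.assign 21 (.get 2 (.add (.reg 14) (.reg 20)))).seq <|
  (Prog.assign 22 (.get 3 (.add (.reg 14) (.reg 20)))).seq <|
  (Prog.assign 25 (.mul (.reg 20) (.reg 26)))

/-- The second part of the computation of one entry of the tables: registers `13`, `18`, `19` hold
the vertex of the tree and its children. -/
def dpEntry : Prog :=
  (Prog.assign 23 (.mul (linkExpr 21 18) (linkExpr 22 19))).seq <|
  (Prog.put 12 (.add (.reg 25) (.reg 13)) (.reg 23)).seq <|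
  (Prog.put 13 (.add (.reg 25) (.reg 13)) (.lt (.const 0)
    (.add (.reg 23) (.add
      (.mul (.lt (.const 0) (.reg 18)) (.get 13 (.add (.reg 25) (.reg 18))))
      (.mul (.lt (.const 0) (.reg 19)) (.get 13 (.add (.reg 25) (.reg 19)))))))).seq <|
  (Prog.assign 20 (.sub (.reg 20) (.const 1)))

/-- The data of one pattern in the memory, with offset `off`. -/
structure PatIn (off : ℕ) (P : TreePattern) (m : Memory) : Prop where
  left : ∀ v, 1 ≤ v → v ≤ P.k → m.arr 2 (off + v) = code (leftChild P.tree v)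
  right : ∀ v, 1 ≤ v → v ≤ P.k → m.arr 3 (off + v) = code (rightChild P.tree v)
  e : ∀ v, 1 ≤ v → v ≤ P.k → m.arr 4 (off + v) = (P.e v).toNat

theorem mem_verts_iff {n v : ℕ} {T : BTree} (hT : T ∈ onVertices n) :
    v ∈ verts T ↔ 1 ≤ v ∧ v ≤ n := by
  rw [hT.2, Finset.mem_Icc]

theorem ind_and (p q : Prop) : ind (p ∧ q) = ind p * ind q := by
  by_cases hp : p <;> by_cases hq : q <;> simp [ind, hp, hq]

/-- Different entries of a table have different positions. -/
theorem index_inj {n i i' v v' : ℕ} (hv : v ≤ n) (hv' : v' ≤ n)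
    (h : i * (n + 1) + v = i' * (n + 1) + v') : i = i' ∧ v = v' := by
  have h1 : (i * (n + 1) + v) / (n + 1) = i := by
    rw [mul_comm, Nat.mul_add_div (by omega), Nat.div_eq_of_lt (by omega), add_zero]
  have h2 : (i' * (n + 1) + v') / (n + 1) = i' := by
    rw [mul_comm, Nat.mul_add_div (by omega), Nat.div_eq_of_lt (by omega), add_zero]
  have : i = i' := by rw [← h1, h, h2]
  subst this
  exact ⟨rfl, by omega⟩

/-- The value of the expression that reads the entry of the second table for a child that may not
exist. -/
theorem child_expr_val {M n k i : ℕ} {B : ℕ → ℕ → Prop} {f : ℕ → ℕ} {wo : Option ℕ}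
    (hM : (n + 1) * (k + 1) < M) (hi : i ≤ k) (hwo : ∀ y, wo = some y → 1 ≤ y ∧ y ≤ n)
    (hf : ∀ y, wo = some y → f (i * (n + 1) + y) = ind (B i y)) :
    ((if 0 < code wo then 1 else 0) * f ((i * (n + 1) + code wo) % M)) % M =
      ind (∃ y, wo = some y ∧ B i y) := by
  cases wo with
  | none => rw [ind_of_not (by simp)]; simp [code]
  | some y =>
    have hy := hwo y rfl
    have hb : i * (n + 1) + y < M := by nlinarith
    have hy0 : 0 < y := by omega
    simp only [code, Option.getD_some, Nat.mod_eq_of_lt hb, hf y rfl, hy0, if_true, one_mul]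
    have : 1 < M := by nlinarith
    rw [ind_congr (p := ∃ y', some y = some y' ∧ B i y') (q := B i y) (by simp)]
    rcases ind_eq (B i y) with h | h <;> rw [h]
    · exact Nat.zero_mod M
    · exact Nat.mod_eq_of_lt this

/-- One entry of each table is computed from the entries for the children of `v`. -/
theorem dp_entry_spec {M n off i v : ℕ} {P : TreePattern} {T : BTree} {m : Memory}
    (hM : (n + 1) * (P.k + 1) < M) (hM4 : 4 < M) (hoff : off + P.k < M) (hT : T ∈ onVertices n)
    (hv : 1 ≤ v ∧ v ≤ n) (hi : 1 ≤ i ∧ i ≤ P.k) (hP : PatIn off P m)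
    (h26 : m.reg 26 = n + 1) (h14 : m.reg 14 = off) (h20 : m.reg 20 = i) (h13 : m.reg 13 = v)
    (h18 : m.reg 18 = code (leftChild T v)) (h19 : m.reg 19 = code (rightChild T v))
    (hl : ∀ y, leftChild T v = some y → RowOk n P.k (OccA P.e P.tree T) (OccB P.e P.tree T) m y)
    (hr : ∀ y, rightChild T v = some y →
      RowOk n P.k (OccA P.e P.tree T) (OccB P.e P.tree T) m y) :
    ((dpChildren.seq dpEntry).run M m).reg 20 = i - 1 ∧
    (∀ x, ((dpChildren.seq dpEntry).run M m).arr 12 x =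
      if x = i * (n + 1) + v then ind (OccA P.e P.tree T i v) else m.arr 12 x) ∧
    (∀ x, ((dpChildren.seq dpEntry).run M m).arr 13 x =
      if x = i * (n + 1) + v then ind (OccB P.e P.tree T i v) else m.arr 13 x) := by
  have hPs := P.tree_mem.1
  have hiP : i ∈ verts P.tree := (mem_verts_iff P.tree_mem).2 hi
  have hvT : v ∈ verts T := (mem_verts_iff hT).2 hv
  have hM1 : 1 % M = 1 := Nat.mod_eq_of_lt (by omega)
  have hb : i * (n + 1) + v < M := by nlinarith
  have hb1 : i * (n + 1) % M = i * (n + 1) := Nat.mod_eq_of_lt (by omega)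
  have hb2 : (i * (n + 1) + v) % M = i * (n + 1) + v := Nat.mod_eq_of_lt hb
  have hb3 : (off + i) % M = off + i := Nat.mod_eq_of_lt (by omega)
  have hb4 : (i - 1) % M = i - 1 := Nat.mod_eq_of_lt (by omega)
  set m₁ : Memory := ((m.setReg 21 (code (leftChild P.tree i))).setReg 22
    (code (rightChild P.tree i))).setReg 25 (i * (n + 1)) with hm₁
  have hlv : ∀ y, leftChild T v = some y → 1 ≤ y ∧ y ≤ n := fun y hy =>
    (mem_verts_iff hT).1 (leftChild_mem hy)
  have hrv : ∀ y, rightChild T v = some y → 1 ≤ y ∧ y ≤ n := fun y hy =>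
    (mem_verts_iff hT).1 (rightChild_mem hy)
  have v1 : (linkExpr 21 18).val M m₁ =
      ind (LinkAt P.e (OccA P.e P.tree T) (OccB P.e P.tree T) (leftChild P.tree i)
        (leftChild T v)) := by
    refine linkExpr_val (n := n) (k := P.k) (off := off) hM hoff (by simp [hm₁, h26])
      (by simp [hm₁, h14]) (by simp [hm₁]) (by simp [hm₁, h18])
      (fun x hx => (mem_verts_iff P.tree_mem).1 (leftChild_mem hx)) hlv hP.e hl
  have v2 : (linkExpr 22 19).val M m₁ =
      ind (LinkAt P.e (OccA P.e P.tree T) (OccB P.e P.tree T) (rightChild P.tree i)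
        (rightChild T v)) := by
    refine linkExpr_val (n := n) (k := P.k) (off := off) hM hoff (by simp [hm₁, h26])
      (by simp [hm₁, h14]) (by simp [hm₁]) (by simp [hm₁, h19])
      (fun x hx => (mem_verts_iff P.tree_mem).1 (rightChild_mem hx)) hrv hP.e hr
  have hA : ind (LinkAt P.e (OccA P.e P.tree T) (OccB P.e P.tree T) (leftChild P.tree i)
        (leftChild T v)) * ind (LinkAt P.e (OccA P.e P.tree T) (OccB P.e P.tree T)
        (rightChild P.tree i) (rightChild T v)) % M = ind (OccA P.e P.tree T i v) := by
    rw [← ind_and, ← ind_congr (occA_iff hPs hT.1 hiP hvT)]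
    rcases ind_eq (OccA P.e P.tree T i v) with h | h <;> rw [h]
    · exact Nat.zero_mod M
    · exact hM1
  have c1 := child_expr_val (M := M) (k := P.k) (B := OccB P.e P.tree T) (f := m.arr 13) hM hi.2
    hlv (fun y hy => (hl y hy i hi.1 hi.2).2)
  have c2 := child_expr_val (M := M) (k := P.k) (B := OccB P.e P.tree T) (f := m.arr 13) hM hi.2
    hrv (fun y hy => (hr y hy i hi.1 hi.2).2)
  have s1 : dpChildren.run M m = m₁ := by
    simp [dpChildren, Prog.run, Expr.val, h14, h20, h26, hb1, hb3, hP.left i hi.1 hi.2,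
      hP.right i hi.1 hi.2, hm₁]
  have hB : (if 0 < (ind (OccA P.e P.tree T i v) +
      (ind (∃ y, leftChild T v = some y ∧ OccB P.e P.tree T i y) +
        ind (∃ y, rightChild T v = some y ∧ OccB P.e P.tree T i y)) % M) % M then 1 else 0) =
      ind (OccB P.e P.tree T i v) := by
    rw [ind_congr (occB_iff (P := P.tree) (e := P.e) (i := i) hT.1 hvT)]
    have g2 : 2 % M = 2 := Nat.mod_eq_of_lt (by omega)
    have g3 : 3 % M = 3 := Nat.mod_eq_of_lt (by omega)
    by_cases a1 : OccA P.e P.tree T i v <;>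
      by_cases a2 : ∃ y, leftChild T v = some y ∧ OccB P.e P.tree T i y <;>
        by_cases a3 : ∃ y, rightChild T v = some y ∧ OccB P.e P.tree T i y <;>
          simp only [ind, a1, a2, a3, hM1, g2, g3, if_true, if_false, Nat.zero_mod, or_true,
            or_false, zero_add, add_zero, Nat.reduceAdd, lt_irrefl, Nat.ofNat_pos, zero_lt_one]
  have r13 : m₁.reg 13 = v := by simp [hm₁, h13]
  have r18 : m₁.reg 18 = code (leftChild T v) := by simp [hm₁, h18]
  have r19 : m₁.reg 19 = code (rightChild T v) := by simp [hm₁, h19]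
  have r20 : m₁.reg 20 = i := by simp [hm₁, h20]
  have r25 : m₁.reg 25 = i * (n + 1) := by simp [hm₁]
  have a13 : m₁.arr = m.arr := rfl
  rw [Prog.run, s1]
  simp only [dpEntry, Prog.run, Expr.val, Memory.setReg_reg, Memory.setReg_arr, Memory.setArr_reg,
    Memory.setArr_arr, v1, v2, hA, r13, r18, r19, r20, r25, a13, hb2, Nat.zero_mod, c1, c2, hB,
    hM1, hb4, Nat.reduceEqDiff, if_true, if_false]
  simp

/-- One row of the tables: the entries for the vertex of the tree at the position in register `17`
of the preorder, after decrementing this register. -/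
def dpRow : Prog :=
  ((Prog.assign 17 (.sub (.reg 17) (.const 1))).seq <|
   (Prog.assign 13 (.get 10 (.reg 17))).seq <|
   (Prog.assign 18 (.get 5 (.reg 13))).seq <|
   (Prog.assign 19 (.get 6 (.reg 13))).seq <|
   (Prog.assign 20 (.reg 16))).seq <|
  Prog.loop (.reg 20) (dpChildren.seq dpEntry)

/-- The test for one pattern, whose number is in register `15`. -/
def patProg : Prog :=
  ((Prog.assign 16 (.get 0 (.reg 15))).seq (Prog.assign 17 (.reg 0))).seq <|
  (Prog.loop (.reg 17) dpRow).seq <|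
  (Prog.cond (.get 13 (.add (.mul (.get 1 (.reg 15)) (.reg 26)) (.reg 2)))
    (.assign 8 (.const 1)) .skip).seq <|
  (Prog.assign 14 (.add (.reg 14) (.reg 16))).seq <|
  (Prog.assign 15 (.add (.reg 15) (.const 1)))

/-- The program that sets register `8` to `1` if the tree contains one of the patterns, and to `0`
otherwise. -/
def checkProg : Prog :=
  preProg.seq <|
  ((Prog.assign 8 (.const 0)).seq <|
   (Prog.assign 14 (.const 0)).seq <|
   (Prog.assign 15 (.const 0)).seq <|
   (Prog.assign 26 (.add (.reg 0) (.const 1)))).seq <|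
  Prog.loop (.lt (.reg 15) (.reg 1)) patProg

theorem mem_preorder {T : BTree} {v : ℕ} : v ∈ preorder T ↔ v ∈ verts T := by
  induction T with
  | nil => simp [preorder, verts]
  | node a l r ihl ihr => simp [preorder, verts, ihl, ihr]

/-- In the preorder, the children of a vertex come after it. -/
theorem child_mem_of_preorder {T : BTree} (hT : IsSearch T) {as bs : List ℕ} {v : ℕ}
    (h : preorder T = as ++ v :: bs) :
    (∀ w, leftChild T v = some w → w ∈ bs) ∧ (∀ w, rightChild T v = some w → w ∈ bs) := by
  induction T generalizing as bs with
  | nil => simp [preorder] at h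
  | node a l r ihl ihr =>
    rw [preorder] at h
    rw [leftChild_node, rightChild_node]
    cases as with
    | nil =>
      rw [List.nil_append, List.cons.injEq] at h
      obtain ⟨rfl, rfl⟩ := h
      rw [if_pos rfl, if_pos rfl]
      refine ⟨fun w hw => ?_, fun w hw => ?_⟩
      · exact List.mem_append_left _ (mem_preorder.2 (mem_verts_of_root hw))
      · exact List.mem_append_right _ (mem_preorder.2 (mem_verts_of_root hw))
    | cons a' as =>
      rw [List.cons_append, List.cons.injEq] at h
      obtain ⟨-, h⟩ := h
      rcases List.append_eq_append_iff.1 h with ⟨cs, h1, h2⟩ | ⟨cs, h1, h2⟩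
      · have hv : v ∈ verts r := mem_preorder.1 (by rw [h2]; simp)
        have hlt := hT.2.1 v hv
        rw [if_neg hlt.ne', if_neg hlt.not_gt, if_neg hlt.ne', if_neg hlt.not_gt]
        exact ihr hT.2.2.2 h2
      · cases cs with
        | nil =>
          have h2' : preorder r = [] ++ v :: bs := h2.symm
          have hv : v ∈ verts r := mem_preorder.1 (by rw [h2']; simp)
          have hlt := hT.2.1 v hv
          rw [if_neg hlt.ne', if_neg hlt.not_gt, if_neg hlt.ne', if_neg hlt.not_gt]
          exact ihr hT.2.2.2 h2'
        | cons c cs =>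
          rw [List.cons_append, List.cons.injEq] at h2
          obtain ⟨rfl, rfl⟩ := h2
          have hv : v ∈ verts l := mem_preorder.1 (by rw [h1]; simp)
          have hlt := hT.1 v hv
          rw [if_neg hlt.ne, if_pos hlt, if_neg hlt.ne, if_pos hlt]
          obtain ⟨k1, k2⟩ := ihl hT.2.2.1 h1
          exact ⟨fun w hw => List.mem_append_left _ (k1 w hw),
            fun w hw => List.mem_append_left _ (k2 w hw)⟩

theorem PatIn.congr {off : ℕ} {P : TreePattern} {m m' : Memory} (h : PatIn off P m)
    (h2 : m'.arr 2 = m.arr 2) (h3 : m'.arr 3 = m.arr 3) (h4 : m'.arr 4 = m.arr 4) :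
    PatIn off P m' :=
  ⟨h2 ▸ h.left, h3 ▸ h.right, h4 ▸ h.e⟩

theorem dp_time : (dpChildren.seq dpEntry).time ≤ 200 := by decide

/-- What a pattern and the size of words have to satisfy during the test. -/
structure Fits (M n off : ℕ) (P : TreePattern) : Prop where
  table : (n + 1) * (P.k + 1) < M
  off : off + P.k < M
  four : 4 < M
  n_lt : n < M

/-- The preorder is processed backwards, so that the rows for the children of a vertex, which come
later in the preorder, are correct when its own row is computed. -/
theorem dpRow_spec {M n off h : ℕ} {P : TreePattern} {T : BTree} {m : Memory}
    (hM : Fits M n off P) (hT : T ∈ onVertices n) (hP : PatIn off P m) (hTm : TreeIn n m T)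
    (h26 : m.reg 26 = n + 1) (h14 : m.reg 14 = off) (h16 : m.reg 16 = P.k)
    (h17 : m.reg 17 = h + 1) (hh : h < n)
    (hpre : ∀ x < n, m.arr 10 x = (preorder T).getD x 0)
    (hrow : ∀ w ∈ (preorder T).drop (h + 1),
      RowOk n P.k (OccA P.e P.tree T) (OccB P.e P.tree T) m w) :
    ∃ m', Runs M dpRow m m' (202 * P.k + 20) ∧ m'.reg 17 = h ∧
      ∀ w ∈ (preorder T).drop h, RowOk n P.k (OccA P.e P.tree T) (OccB P.e P.tree T) m' w := by
  have hlen := length_preorder_of_mem hT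
  have hhl : h < (preorder T).length := by omega
  set v := (preorder T)[h] with hv
  have hdrop : (preorder T).drop h = v :: (preorder T).drop (h + 1) :=
    List.drop_eq_getElem_cons hhl
  have hsplit : preorder T = (preorder T).take h ++ v :: (preorder T).drop (h + 1) := by
    rw [← hdrop, List.take_append_drop]
  have hvm : v ∈ verts T := mem_preorder.1 (List.getElem_mem hhl)
  have hvn := (mem_verts_iff hT).1 hvm
  have hch := child_mem_of_preorder hT.1 hsplit
  have hmem : ∀ w ∈ (preorder T).drop (h + 1), w ≤ n := fun w hw =>
    ((mem_verts_iff hT).1 (mem_preorder.1 (List.mem_of_mem_drop hw))).2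
  have hM1 : 1 % M = 1 := Nat.mod_eq_of_lt (by have := hM.four; omega)
  have hMh : h % M = h := Nat.mod_eq_of_lt (by have := hM.n_lt; omega)
  have hprev : m.arr 10 h = v := by
    rw [hpre h hh, List.getD_eq_getElem _ _ hhl]
  set p₀ : Prog := (Prog.assign 17 (.sub (.reg 17) (.const 1))).seq <|
   (Prog.assign 13 (.get 10 (.reg 17))).seq <|
   (Prog.assign 18 (.get 5 (.reg 13))).seq <|
   (Prog.assign 19 (.get 6 (.reg 13))).seq <|
   (Prog.assign 20 (.reg 16)) with hp₀
  have hr0 := Runs.of_flat (M := M) (p := p₀) rfl m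
  set m₀ := p₀.run M m with hm₀
  have q13 : m₀.reg 13 = v := by simp [hm₀, hp₀, Prog.run, Expr.val, h17, hM1, hMh, hprev]
  have q17 : m₀.reg 17 = h := by simp [hm₀, hp₀, Prog.run, Expr.val, h17, hM1, hMh]
  have q18 : m₀.reg 18 = code (leftChild T v) := by
    simp [hm₀, hp₀, Prog.run, Expr.val, h17, hM1, hMh, hprev, hTm.left v hvn.1 hvn.2]
  have q19 : m₀.reg 19 = code (rightChild T v) := by
    simp [hm₀, hp₀, Prog.run, Expr.val, h17, hM1, hMh, hprev, hTm.right v hvn.1 hvn.2]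
  have q20 : m₀.reg 20 = P.k := by simp [hm₀, hp₀, Prog.run, Expr.val, h16]
  have q26 : m₀.reg 26 = n + 1 := (hr0.same.reg 26 rfl).trans h26
  have q14 : m₀.reg 14 = off := (hr0.same.reg 14 rfl).trans h14
  have qP : PatIn off P m₀ :=
    hP.congr (hr0.same.arr 2 rfl) (hr0.same.arr 3 rfl) (hr0.same.arr 4 rfl)
  have q12 : m₀.arr 12 = m.arr 12 := hr0.same.arr 12 rfl
  have q13' : m₀.arr 13 = m.arr 13 := hr0.same.arr 13 rfl
  obtain ⟨m', hr, hi, hs⟩ := Runs.loop (M := M) (u := .reg 20) (p := dpChildren.seq dpEntry)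
    (N := P.k) (m₀ := m₀)
    (fun i m => m.reg 20 = i ∧ i ≤ P.k ∧
      (∀ w ∈ (preorder T).drop (h + 1),
        RowOk n P.k (OccA P.e P.tree T) (OccB P.e P.tree T) m w) ∧
      ∀ i', i < i' → i' ≤ P.k → m.arr 12 (i' * (n + 1) + v) = ind (OccA P.e P.tree T i' v) ∧
        m.arr 13 (i' * (n + 1) + v) = ind (OccB P.e P.tree T i' v)) (fun i => i * 202)
    ⟨q20, le_rfl, fun w hw => by rw [RowOk, q12, q13']; exact hrow w hw,
      fun i' h1 h2 => by omega⟩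
    (fun i m _ hi => by simp only [Expr.val, hi.1])
    (fun i m hs hi => by
      obtain ⟨h20, hik, hold, hnew⟩ := hi
      obtain ⟨e1, e2, e3⟩ := dp_entry_spec (i := i + 1) (v := v) hM.table hM.four hM.off hT hvn
        ⟨by omega, hik⟩ (qP.congr (hs.arr 2 rfl) (hs.arr 3 rfl) (hs.arr 4 rfl))
        ((hs.reg 26 rfl).trans q26) ((hs.reg 14 rfl).trans q14) h20
        ((hs.reg 13 rfl).trans q13) ((hs.reg 18 rfl).trans q18) ((hs.reg 19 rfl).trans q19)
        (fun y hy => hold y (hch.1 y hy)) (fun y hy => hold y (hch.2 y hy))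
      have hnew' : ∀ i', i < i' → i' ≤ P.k →
          ((dpChildren.seq dpEntry).run M m).arr 12 (i' * (n + 1) + v) =
            ind (OccA P.e P.tree T i' v) ∧
          ((dpChildren.seq dpEntry).run M m).arr 13 (i' * (n + 1) + v) =
            ind (OccB P.e P.tree T i' v) := by
        intro i' h1 h2
        rw [e2, e3]
        by_cases hii : i' = i + 1
        · subst hii; simp
        · have hne : i' * (n + 1) + v ≠ (i + 1) * (n + 1) + v := fun hc =>
            hii (index_inj hvn.2 hvn.2 hc).1
          rw [if_neg hne, if_neg hne]
          exact hnew i' (by omega) h2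
      refine ⟨_, _, Runs.of_flat rfl m, ⟨e1, by omega, fun w hw i' h1 h2 => ?_, hnew'⟩, ?_⟩
      · by_cases hc : i' * (n + 1) + w = (i + 1) * (n + 1) + v
        · obtain ⟨rfl, rfl⟩ := index_inj (hmem w hw) hvn.2 hc
          exact hnew' _ (by omega) h2
        · rw [e2, e3, if_neg hc, if_neg hc]
          exact hold w hw i' h1 h2
      · have := dp_time
        simp only [Expr.cost]
        omega)
  refine ⟨m', (hr0.seq hr).mono ?_, (hs.reg 17 rfl).trans q17, fun w hw => ?_⟩
  · have : p₀.time ≤ 18 := by decide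
    simp only [Expr.cost]
    omega
  · rw [hdrop, List.mem_cons] at hw
    rcases hw with rfl | hw
    · intro i h1 h2
      exact hi.2.2.2 i (by omega) h2
    · exact hi.2.2.1 w hw

/-- The memory while the patterns are tested. -/
structure CheckMem (n : ℕ) (T : BTree) (m : Memory) : Prop where
  tree : TreeIn n m T
  pre : ∀ x < n, m.arr 10 x = (preorder T).getD x 0
  n_reg : m.reg 0 = n
  n_succ : m.reg 26 = n + 1

theorem CheckMem.congr {n : ℕ} {T : BTree} {m m' : Memory} (h : CheckMem n T m) {p : Prog}
    (hs : Same p m m') (h0 : p.wr 0 = false) (h2 : p.wr 2 = false) (h26 : p.wr 26 = false)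
    (h5 : p.wa 5 = false) (h6 : p.wa 6 = false) (h10 : p.wa 10 = false) : CheckMem n T m' :=
  ⟨h.tree.congr (hs.reg 2 h2) (hs.arr 5 h5) (hs.arr 6 h6), by rw [hs.arr 10 h10]; exact h.pre,
    (hs.reg 0 h0).trans h.n_reg, (hs.reg 26 h26).trans h.n_succ⟩

/-- After all rows have been computed, the second table tells at the two roots whether the pattern
is contained. -/
theorem patProg_spec {M n off idx : ℕ} {P : TreePattern} {T : BTree} {m : Memory}
    (hM : Fits M n off P) (hn : 1 ≤ n) (hk : 1 ≤ P.k) (hidx : idx + 1 < M)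
    (hT : T ∈ onVertices n) (hP : PatIn off P m) (hm : CheckMem n T m)
    (h14 : m.reg 14 = off) (h15 : m.reg 15 = idx) (hk0 : m.arr 0 idx = P.k)
    (hroot : m.arr 1 idx = code (root? P.tree)) :
    ∃ m', Runs M patProg m m' (300 * (n * P.k)) ∧ m'.reg 14 = off + P.k ∧ m'.reg 15 = idx + 1 ∧
      m'.reg 8 = if ind (Contains T P) = 0 then m.reg 8 else 1 := by
  have hlen := length_preorder_of_mem hT
  have hM1 : 1 % M = 1 := Nat.mod_eq_of_lt (by have := hM.four; omega)
  set p₀ : Prog := (Prog.assign 16 (.get 0 (.reg 15))).seq (Prog.assign 17 (.reg 0)) with hp₀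
  have hr0 := Runs.of_flat (M := M) (p := p₀) rfl m
  set m₀ := p₀.run M m with hm₀
  have q16 : m₀.reg 16 = P.k := by simp [hm₀, hp₀, Prog.run, Expr.val, h15, hk0]
  have q17 : m₀.reg 17 = n := by simp [hm₀, hp₀, Prog.run, Expr.val, hm.n_reg]
  have qm : CheckMem n T m₀ := hm.congr hr0.same rfl rfl rfl rfl rfl rfl
  have q14 : m₀.reg 14 = off := (hr0.same.reg 14 rfl).trans h14
  have qP : PatIn off P m₀ :=
    hP.congr (hr0.same.arr 2 rfl) (hr0.same.arr 3 rfl) (hr0.same.arr 4 rfl)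
  obtain ⟨m₁, hr1, hi, hs⟩ := Runs.loop (M := M) (u := .reg 17) (p := dpRow) (N := n) (m₀ := m₀)
    (fun h m => m.reg 17 = h ∧ h ≤ n ∧ ∀ w ∈ (preorder T).drop h,
      RowOk n P.k (OccA P.e P.tree T) (OccB P.e P.tree T) m w) (fun h => h * (202 * P.k + 22))
    ⟨q17, le_rfl, by rw [← hlen, List.drop_length]; simp⟩
    (fun i m _ hi => by simp only [Expr.val, hi.1])
    (fun h m hs hi => by
      have qm' := qm.congr hs rfl rfl rfl rfl rfl rfl
      obtain ⟨m', hr, h17, hrow⟩ := dpRow_spec (h := h) hM hT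
        (qP.congr (hs.arr 2 rfl) (hs.arr 3 rfl) (hs.arr 4 rfl)) qm'.tree qm'.n_succ
        ((hs.reg 14 rfl).trans q14) ((hs.reg 16 rfl).trans q16) hi.1 (by omega) qm'.pre hi.2.2
      refine ⟨m', _, hr, ⟨h17, by omega, hrow⟩, ?_⟩
      simp only [Expr.cost]
      linarith)
  have qm1 : CheckMem n T m₁ := qm.congr hs rfl rfl rfl rfl rfl rfl
  have hPne : P.tree ≠ nil := by
    intro h
    have := (mem_verts_iff (v := 1) P.tree_mem).2 ⟨le_rfl, hk⟩
    rw [h] at this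
    simp [verts] at this
  have hTne : T ≠ nil := by
    intro h
    have := (mem_verts_iff (v := 1) hT).2 ⟨le_rfl, hn⟩
    rw [h] at this
    simp [verts] at this
  obtain ⟨rp, hrp⟩ := exists_root hPne
  obtain ⟨rt, hrt⟩ := exists_root hTne
  have hrp' := (mem_verts_iff P.tree_mem).1 (mem_verts_of_root hrp)
  have hrt' := (mem_verts_iff hT).1 (mem_verts_of_root hrt)
  have hb := hM.table
  have hb2 : rp * (n + 1) + rt < M := by nlinarith
  have hb1 : rp * (n + 1) % M = rp * (n + 1) := Nat.mod_eq_of_lt (by omega)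
  have hfin : m₁.arr 13 (rp * (n + 1) + rt) = ind (Contains T P) := by
    rw [(hi.2.2 rt (by rw [List.drop_zero, mem_preorder]; exact mem_verts_of_root hrt)
      rp hrp'.1 hrp'.2).2]
    refine ind_congr ?_
    rw [contains_iff hT.1 hPne, OccB, subAt_root hrp, subAt_root hrt]
  set p₂ : Prog := (Prog.cond (.get 13 (.add (.mul (.get 1 (.reg 15)) (.reg 26)) (.reg 2)))
    (.assign 8 (.const 1)) .skip).seq <|
    (Prog.assign 14 (.add (.reg 14) (.reg 16))).seq <|
    (Prog.assign 15 (.add (.reg 15) (.const 1))) with hp₂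
  have hr2 := Runs.of_flat (M := M) (p := p₂) rfl m₁
  have w14 : m₁.reg 14 = off := (hs.reg 14 rfl).trans q14
  have w16 : m₁.reg 16 = P.k := (hs.reg 16 rfl).trans q16
  have w15 : m₁.reg 15 = idx := (hs.reg 15 rfl).trans ((hr0.same.reg 15 rfl).trans h15)
  have w8 : m₁.reg 8 = m.reg 8 := (hs.reg 8 rfl).trans (hr0.same.reg 8 rfl)
  have w1 : m₁.arr 1 idx = rp := by
    rw [hs.arr 1 rfl, hr0.same.arr 1 rfl, hroot, hrp]; rfl
  have w2 : m₁.reg 2 = rt := by rw [qm1.tree.root, hrt]; rfl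
  have hoff : (off + P.k) % M = off + P.k := Nat.mod_eq_of_lt hM.off
  have hid : (idx + 1) % M = idx + 1 := Nat.mod_eq_of_lt hidx
  have hcond : (Expr.get 13 (.add (.mul (.get 1 (.reg 15)) (.reg 26)) (.reg 2))).val M m₁ =
      ind (Contains T P) := by
    simp only [Expr.val, w15, w1, qm1.n_succ, hb1, w2, Nat.mod_eq_of_lt hb2, hfin]
  refine ⟨_, (hr0.seq (hr1.seq hr2)).mono ?_, ?_, ?_, ?_⟩
  · have h1 : p₀.time ≤ 20 := by decide
    have h2 : p₂.time ≤ 30 := by decide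
    have h3 : n * (202 * P.k + 22) = 202 * (n * P.k) + 22 * n := by ring
    have h4 : n ≤ n * P.k := Nat.le_mul_of_pos_right n hk
    simp only [Expr.cost]
    omega
  · simp only [hp₂, Prog.run, hcond]
    split_ifs <;> simp [Expr.val, w14, w16, hoff]
  · simp only [hp₂, Prog.run, hcond]
    split_ifs <;> simp [Expr.val, w15, hid, hM1]
  · simp only [hp₂, Prog.run, hcond]
    split_ifs <;> simp [Expr.val, w8, hM1]

/-- The memory holds the input. -/
structure InputIn (n : ℕ) (pats : List TreePattern) (m : Memory) : Prop where
  n_reg : m.reg 0 = n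
  len : m.reg 1 = pats.length
  arr : ∀ a < 5, m.arr a = (inputMemory n pats).arr a

/-- The sum of the sizes of the patterns. -/
def totalSize (pats : List TreePattern) : ℕ := (pats.map (fun P => P.k)).sum

theorem length_flatMap_rows (done : List TreePattern) (g : TreePattern → ℕ → ℕ) :
    (done.flatMap (fun P => (List.range P.k).map (fun v => g P (v + 1)))).length =
      totalSize done := by
  induction done with
  | nil => rfl
  | cons P done ih =>
    rw [List.flatMap_cons, List.length_append, ih]
    simp [totalSize]

/-- The rows of the patterns `done` that precede `P` have total length `totalSize done`. -/
theorem getD_rows {done rest : List TreePattern} {P : TreePattern} (g : TreePattern → ℕ → ℕ)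
    {v : ℕ} (h1 : 1 ≤ v) (h2 : v ≤ P.k) :
    (rows (done ++ P :: rest) g).getD (totalSize done + v) 0 = g P v := by
  obtain ⟨u, rfl⟩ : ∃ u, v = u + 1 := ⟨v - 1, by omega⟩
  rw [rows, ← add_assoc, List.getD_cons_succ, List.flatMap_append, List.getD_append_right,
    length_flatMap_rows, Nat.add_sub_cancel_left, List.flatMap_cons, List.getD_append]
  · rw [List.getD_eq_getElem _ _ (by simpa using h2)]
    simp
  · simpa using h2
  · rw [length_flatMap_rows]; omega

theorem InputIn.patIn {n : ℕ} {done rest : List TreePattern} {P : TreePattern} {m : Memory}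
    (h : InputIn n (done ++ P :: rest) m) : PatIn (totalSize done) P m := by
  constructor
  · intro v h1 h2
    rw [h.arr 2 (by omega)]
    exact getD_rows (fun P v => code (leftChild P.tree v)) h1 h2
  · intro v h1 h2
    rw [h.arr 3 (by omega)]
    exact getD_rows (fun P v => code (rightChild P.tree v)) h1 h2
  · intro v h1 h2
    rw [h.arr 4 (by omega)]
    exact getD_rows (fun P v => (P.e v).toNat) h1 h2

theorem InputIn.size {n : ℕ} {done rest : List TreePattern} {P : TreePattern} {m : Memory}
    (h : InputIn n (done ++ P :: rest) m) : m.arr 0 done.length = P.k := by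
  rw [h.arr 0 (by omega)]
  simp [inputMemory]

theorem InputIn.root {n : ℕ} {done rest : List TreePattern} {P : TreePattern} {m : Memory}
    (h : InputIn n (done ++ P :: rest) m) : m.arr 1 done.length = code (root? P.tree) := by
  rw [h.arr 1 (by omega)]
  simp [inputMemory]

theorem InputIn.congr {n : ℕ} {pats : List TreePattern} {m m' : Memory} (h : InputIn n pats m)
    {p : Prog} (hs : Same p m m') (h0 : p.wr 0 = false) (h1 : p.wr 1 = false)
    (ha : ∀ a < 5, p.wa a = false) : InputIn n pats m' :=
  ⟨(hs.reg 0 h0).trans h.n_reg, (hs.reg 1 h1).trans h.len,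
    fun a h5 => (hs.arr a (ha a h5)).trans (h.arr a h5)⟩

theorem length_le_totalSize {pats : List TreePattern} (hk : ∀ P ∈ pats, 1 ≤ P.k) :
    pats.length ≤ totalSize pats := by
  induction pats with
  | nil => simp
  | cons P pats ih =>
    have h1 := hk P (by simp)
    have h2 := ih (fun P hP => hk P (List.mem_cons_of_mem _ hP))
    simp only [totalSize, List.map_cons, List.sum_cons, List.length_cons] at h2 ⊢
    omega

/-- The test takes time `O(n ∑ kᵢ)`. The bound on `M` ensures that no index exceeds the word
size. -/
theorem checkProg_spec {M n : ℕ} {pats : List TreePattern} {T : BTree} {m : Memory}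
    (hM : 4 * ((n + 1) * (totalSize pats + 1)) < M) (hn : 1 ≤ n) (hne : pats ≠ [])
    (hk : ∀ P ∈ pats, 1 ≤ P.k) (hT : T ∈ onVertices n) (hI : InputIn n pats m)
    (hTm : TreeIn n m T) :
    ∃ m', Runs M checkProg m m' (1000 * (n * totalSize pats)) ∧
      m'.reg 8 = ind (∃ P ∈ pats, Contains T P) := by
  have hlen := length_le_totalSize hk
  have hK : 1 ≤ totalSize pats :=
    (List.length_pos_iff.2 hne).trans_le hlen
  have hM4 : 4 * n + 4 < M := by nlinarith
  have hMK : totalSize pats + 1 < M := by nlinarith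
  have hM1 : 1 % M = 1 := Nat.mod_eq_of_lt (by omega)
  obtain ⟨m₁, hr1, hpre⟩ := preProg_spec hT hM4 hTm
  set p₀ : Prog := (Prog.assign 8 (.const 0)).seq <|
   (Prog.assign 14 (.const 0)).seq <|
   (Prog.assign 15 (.const 0)).seq <|
   (Prog.assign 26 (.add (.reg 0) (.const 1))) with hp₀
  have hr2 := Runs.of_flat (M := M) (p := p₀) rfl m₁
  set m₂ := p₀.run M m₁ with hm₂
  have hI1 := hI.congr hr1.same rfl rfl (by decide)
  have hI2 := hI1.congr hr2.same rfl rfl (by decide)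
  have hn1 : (n + 1) % M = n + 1 := Nat.mod_eq_of_lt (by omega)
  have q8 : m₂.reg 8 = 0 := by simp [hm₂, hp₀, Prog.run, Expr.val]
  have q14 : m₂.reg 14 = 0 := by simp [hm₂, hp₀, Prog.run, Expr.val]
  have q15 : m₂.reg 15 = 0 := by simp [hm₂, hp₀, Prog.run, Expr.val]
  have q26 : m₂.reg 26 = n + 1 := by simp [hm₂, hp₀, Prog.run, Expr.val, hI1.n_reg, hM1, hn1]
  have hC : CheckMem n T m₂ := by
    refine ⟨(hTm.congr (hr1.same.reg 2 rfl) (hr1.same.arr 5 rfl) (hr1.same.arr 6 rfl)).congr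
      (hr2.same.reg 2 rfl) (hr2.same.arr 5 rfl) (hr2.same.arr 6 rfl), ?_, hI2.n_reg, q26⟩
    rw [hr2.same.arr 10 rfl]
    exact hpre
  obtain ⟨m₃, hr3, hi, hs⟩ := Runs.loop (M := M) (u := .lt (.reg 15) (.reg 1)) (p := patProg)
    (N := pats.length) (m₀ := m₂)
    (fun i m => ∃ done rest, pats = done ++ rest ∧ rest.length = i ∧ m.reg 15 = done.length ∧
      m.reg 14 = totalSize done ∧ m.reg 8 = ind (∃ P ∈ done, Contains T P))
    (fun i => 320 * (n * totalSize (pats.drop (pats.length - i))))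
    ⟨[], pats, rfl, rfl, q15, q14, by rw [q8, ind_of_not (by simp)]⟩
    (fun i m hs hi => by
      obtain ⟨done, rest, hpd, hri, h15, -, -⟩ := hi
      have := (hs.reg 1 rfl).trans hI2.len
      simp only [Expr.val, h15, this, hpd, List.length_append, hri]
      by_cases h : i = 0
      · simp [h]
      · simp [h, show 0 < i by omega])
    (fun i m hs hi => by
      obtain ⟨done, rest, hpd, hri, h15, h14, h8⟩ := hi
      cases rest with
      | nil => simp at hri
      | cons P rest =>
        have hri' : rest.length = i := by simpa using hri
        have hIm := hI2.congr hs rfl rfl (by decide)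
        have hkP := hk P (by rw [hpd]; simp)
        have htot : totalSize pats = totalSize done + (P.k + totalSize rest) := by
          rw [hpd]; simp [totalSize]
        have hF : Fits M n (totalSize done) P := by
          refine ⟨?_, by omega, by omega, by omega⟩
          have : (n + 1) * (P.k + 1) ≤ (n + 1) * (totalSize pats + 1) :=
            Nat.mul_le_mul_left _ (by omega)
          omega
        have hdl : done.length + 1 ≤ pats.length := by rw [hpd]; simp
        rw [hpd] at hIm
        obtain ⟨m', hr, e14, e15, e8⟩ := patProg_spec hF hn hkP (idx := done.length) (by omega) hT
          hIm.patIn (hC.congr hs rfl rfl rfl rfl rfl rfl) h14 h15 hIm.size hIm.root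
        refine ⟨m', _, hr, ⟨done ++ [P], rest, by rw [hpd]; simp, hri', ?_, ?_, ?_⟩, ?_⟩
        · rw [e15]; simp
        · rw [e14]; simp [totalSize]
        · rw [e8, h8]
          by_cases c : Contains T P
          · rw [ind_of c, ind_of (p := ∃ Q ∈ done ++ [P], Contains T Q) ⟨P, by simp, c⟩]; simp
          · rw [ind_of_not c, if_pos rfl]
            refine ind_congr ⟨fun ⟨Q, h1, h2⟩ => ⟨Q, List.mem_append_left _ h1, h2⟩, ?_⟩
            rintro ⟨Q, h1, h2⟩
            rw [List.mem_append, List.mem_singleton] at h1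
            rcases h1 with h1 | rfl
            · exact ⟨Q, h1, h2⟩
            · exact absurd h2 c
        · have d1 : pats.drop (pats.length - i) = rest := by
            rw [hpd, ← hri', List.append_cons, List.length_append, Nat.add_sub_cancel,
              List.drop_left]
          have d2 : pats.drop (pats.length - (i + 1)) = P :: rest := by
            rw [hpd, ← hri, List.length_append, Nat.add_sub_cancel, List.drop_left]
          have ht : totalSize (P :: rest) = P.k + totalSize rest := by simp [totalSize]
          have hnk : 1 ≤ n * P.k := Nat.mul_pos hn hkP
          simp only [Expr.cost, d1, d2, ht]
          nlinarith)
  refine ⟨m₃, (hr1.seq (hr2.seq hr3)).mono ?_, ?_⟩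
  · have h0 : p₀.time ≤ 20 := by decide
    have hnK : n ≤ n * totalSize pats := Nat.le_mul_of_pos_right n hK
    simp only [Expr.cost, Nat.sub_self, List.drop_zero]
    omega
  · obtain ⟨done, rest, hpd, hri, -, -, h8⟩ := hi
    rw [List.length_eq_zero_iff] at hri
    rw [hri, List.append_nil] at hpd
    rw [h8, hpd]

/-! ### Rotations on the word RAM -/

/-- The up-rotation of the vertex in register `3`; array `9` holds the parents. -/
def upProg : Prog :=
  (Prog.assign 5 (.get 9 (.reg 3))).seq <|
  (Prog.assign 6 (.get 9 (.reg 5))).seq <|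
  (Prog.assign 7 (.get 5 (.reg 3))).seq <|
  (Prog.put 6 (.reg 5) (.reg 7)).seq <|
  (Prog.put 9 (.reg 7) (.reg 5)).seq <|
  (Prog.put 5 (.reg 3) (.reg 5)).seq <|
  (Prog.put 9 (.reg 5) (.reg 3)).seq <|
  (Prog.put 9 (.reg 3) (.reg 6)).seq <|
  (Prog.cond (.reg 6)
    (.cond (.lt (.reg 6) (.reg 3)) (.put 6 (.reg 6) (.reg 3)) (.put 5 (.reg 6) (.reg 3)))
    (.assign 2 (.reg 3)))

/-- The down-rotation of the vertex in register `3`. -/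
def downProg : Prog :=
  (Prog.assign 5 (.get 5 (.reg 3))).seq <|
  (Prog.assign 6 (.get 9 (.reg 3))).seq <|
  (Prog.assign 7 (.get 6 (.reg 5))).seq <|
  (Prog.put 5 (.reg 3) (.reg 7)).seq <|
  (Prog.put 9 (.reg 7) (.reg 3)).seq <|
  (Prog.put 6 (.reg 5) (.reg 3)).seq <|
  (Prog.put 9 (.reg 3) (.reg 5)).seq <|
  (Prog.put 9 (.reg 5) (.reg 6)).seq <|
  (Prog.cond (.reg 6)
    (.cond (.lt (.reg 6) (.reg 3)) (.put 6 (.reg 6) (.reg 5)) (.put 5 (.reg 6) (.reg 5)))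
    (.assign 2 (.reg 5)))

/-- The memory holds the links and the parents of the tree `T`. -/
structure TreeP (n : ℕ) (m : Memory) (T : BTree) : Prop where
  tree : TreeIn n m T
  par : ∀ v, 1 ≤ v → v ≤ n → m.arr 9 v = code (parent T v)

theorem code_some (v : ℕ) : code (some v) = v := rfl

theorem code_none : code none = 0 := rfl

theorem upProg_spec {M n i j : ℕ} {T T' : BTree} {m : Memory} (hT : T ∈ onVertices n)
    (h : LinkChange i j T T') (hj : j ∈ verts T) (hm : TreeP n m T) (h3 : m.reg 3 = j) :
    TreeP n (upProg.run M m) T' := by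
  have hjn := (mem_verts_iff hT).1 hj
  have hin := (mem_verts_iff hT).1 h.mem
  have p1 : m.arr 9 j = i := by rw [hm.par j hjn.1 hjn.2, h.par_j]; rfl
  have p2 : m.arr 9 i = code (parent T i) := hm.par i hin.1 hin.2
  have p3 : m.arr 5 j = code (leftChild T j) := hm.tree.left j hjn.1 hjn.2
  have hij := h.lt
  have hL := hm.tree.left
  have hR := hm.tree.right
  have hP := hm.par
  have hroot := hm.tree.root
  have hc : ∀ v, 1 ≤ v → (v = code (leftChild T j) ↔ leftChild T j = some v) := by
    intro v hv
    cases leftChild T j with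
    | none => simp [code]; omega
    | some w => simp [code]; exact eq_comm
  have hleft : ∀ v, v ≠ j → ¬ (parent T i = some v ∧ j < v) → 1 ≤ v → v ≤ n →
      m.arr 5 v = code (leftChild T' v) := fun v h1 h2 h4 h5 => by
    rw [h.left_eq v h1 h2]; exact hL v h4 h5
  have hright : ∀ v, v ≠ i → ¬ (parent T i = some v ∧ v < j) → 1 ≤ v → v ≤ n →
      m.arr 6 v = code (rightChild T' v) := fun v h1 h2 h4 h5 => by
    rw [h.right_eq v h1 h2]; exact hR v h4 h5
  have hpar : ∀ v, 1 ≤ v → v ≤ n → (if v = j then code (parent T i) else if v = i then j else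
      if v = code (leftChild T j) then i else m.arr 9 v) = code (parent T' v) := by
    intro v h1 h2
    split_ifs with c1 c2 c3
    · rw [c1, h.par_top]
    · rw [c2, h.par_i]; rfl
    · rw [(h.par_inner v ((hc v h1).1 c3)).2]; rfl
    · rw [h.par_eq v c2 c1 (fun hh => c3 ((hc v h1).2 hh))]; exact hP v h1 h2
  cases hg : parent T i with
  | none =>
    rw [hg, code_none] at p2 hpar
    simp only [hg] at hleft hright
    have hr := h.root hg
    refine ⟨⟨?_, ?_, ?_⟩, ?_⟩
    · simp [upProg, Prog.run, Expr.val, h3, p1, p2, hr.2, code_some]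
    · intro v h1 h2
      have hl := hleft v
      by_cases c : v = j
      · subst c; simp [upProg, Prog.run, Expr.val, h3, p1, p2, h.left_j, code_some]
      · simp [upProg, Prog.run, Expr.val, h3, p1, p2, c, hl c (by simp) h1 h2]
    · intro v h1 h2
      by_cases c : v = i
      · subst c; simp [upProg, Prog.run, Expr.val, h3, p1, p2, p3, h.inner]
      · simp [upProg, Prog.run, Expr.val, h3, p1, p2, c, hright v c (by simp) h1 h2]
    · intro v h1 h2
      rw [← hpar v h1 h2]
      simp [upProg, Prog.run, Expr.val, h3, p1, p2, p3]
  | some g =>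
    rw [hg, code_some] at p2 hpar
    have hgn := (mem_verts_iff hT).1 (parent_mem hg)
    have hg0 : g ≠ 0 := by omega
    have hgne := h.top_ne g hg
    have hre := h.root_eq (by rw [hg]; simp)
    simp only [hg, Option.some.injEq] at hleft hright
    by_cases hgj : g < j
    · have ht := h.right_top g hg hgj
      refine ⟨⟨?_, ?_, ?_⟩, ?_⟩
      · simp [upProg, Prog.run, Expr.val, h3, p1, p2, hre, hg0, hgj, hroot]
      · intro v h1 h2
        by_cases c : v = j
        · subst c; simp [upProg, Prog.run, Expr.val, h3, p1, p2, h.left_j, code_some, hg0, hgj]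
        · simp [upProg, Prog.run, Expr.val, h3, p1, p2, c, hg0, hgj,
            hleft v c (by omega) h1 h2]
      · intro v h1 h2
        by_cases c' : v = g
        · subst c'
          simp [upProg, Prog.run, Expr.val, h3, p1, p2, hg0, hgj, ht.2, code_some]
        by_cases c : v = i
        · subst c; simp [upProg, Prog.run, Expr.val, h3, p1, p2, p3, h.inner, hg0, hgj, c']
        · simp [upProg, Prog.run, Expr.val, h3, p1, p2, c, hg0, hgj, c',
            hright v c (by omega) h1 h2]
      · intro v h1 h2
        rw [← hpar v h1 h2]
        simp [upProg, Prog.run, Expr.val, h3, p1, p2, p3, hg0, hgj]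
    · have ht := h.left_top g hg (by omega)
      refine ⟨⟨?_, ?_, ?_⟩, ?_⟩
      · simp [upProg, Prog.run, Expr.val, h3, p1, p2, hre, hg0, hgj, hroot]
      · intro v h1 h2
        by_cases c' : v = g
        · subst c'
          simp [upProg, Prog.run, Expr.val, h3, p1, p2, hg0, hgj, ht.2, code_some]
        by_cases c : v = j
        · subst c; simp [upProg, Prog.run, Expr.val, h3, p1, p2, h.left_j, code_some, hg0, hgj, c']
        · simp [upProg, Prog.run, Expr.val, h3, p1, p2, c, hg0, hgj, c',
            hleft v c (by omega) h1 h2]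
      · intro v h1 h2
        by_cases c : v = i
        · subst c; simp [upProg, Prog.run, Expr.val, h3, p1, p2, p3, h.inner, hg0, hgj]
        · simp [upProg, Prog.run, Expr.val, h3, p1, p2, c, hg0, hgj,
            hright v c (by omega) h1 h2]
      · intro v h1 h2
        rw [← hpar v h1 h2]
        simp [upProg, Prog.run, Expr.val, h3, p1, p2, p3, hg0, hgj]

theorem downProg_spec {M n i j : ℕ} {T T' : BTree} {m : Memory} (hT' : T' ∈ onVertices n)
    (h : LinkChange i j T' T) (hj : j ∈ verts T') (hm : TreeP n m T) (h3 : m.reg 3 = j) :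
    TreeP n (downProg.run M m) T' := by
  have hjn := (mem_verts_iff hT').1 hj
  have hin := (mem_verts_iff hT').1 h.mem
  have p1 : m.arr 5 j = i := by rw [hm.tree.left j hjn.1 hjn.2, h.left_j]; rfl
  have p2 : m.arr 9 j = code (parent T' i) := by rw [hm.par j hjn.1 hjn.2, h.par_top]
  have p3 : m.arr 6 i = code (leftChild T' j) := by rw [hm.tree.right i hin.1 hin.2, h.inner]
  have hij := h.lt
  have hL := hm.tree.left
  have hR := hm.tree.right
  have hP := hm.par
  have hroot := hm.tree.root
  have hc : ∀ v, 1 ≤ v → (v = code (leftChild T' j) ↔ leftChild T' j = some v) := by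
    intro v hv
    cases leftChild T' j with
    | none => simp [code]; omega
    | some w => simp [code]; exact eq_comm
  have hleft : ∀ v, v ≠ j → ¬ (parent T' i = some v ∧ j < v) → 1 ≤ v → v ≤ n →
      m.arr 5 v = code (leftChild T' v) := fun v h1 h2 h4 h5 => by
    rw [← h.left_eq v h1 h2]; exact hL v h4 h5
  have hright : ∀ v, v ≠ i → ¬ (parent T' i = some v ∧ v < j) → 1 ≤ v → v ≤ n →
      m.arr 6 v = code (rightChild T' v) := fun v h1 h2 h4 h5 => by
    rw [← h.right_eq v h1 h2]; exact hR v h4 h5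
  have hpar : ∀ v, 1 ≤ v → v ≤ n → (if v = i then code (parent T' i) else if v = j then i else
      if v = code (leftChild T' j) then j else m.arr 9 v) = code (parent T' v) := by
    intro v h1 h2
    split_ifs with c1 c2 c3
    · rw [c1]
    · rw [c2, h.par_j]; rfl
    · rw [(h.par_inner v ((hc v h1).1 c3)).1]; rfl
    · rw [← h.par_eq v c1 c2 (fun hh => c3 ((hc v h1).2 hh))]; exact hP v h1 h2
  cases hg : parent T' i with
  | none =>
    rw [hg, code_none] at p2 hpar
    simp only [hg] at hleft hright
    have hr := h.root hg
    refine ⟨⟨?_, ?_, ?_⟩, ?_⟩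
    · simp [downProg, Prog.run, Expr.val, h3, p1, p2, hr.1, code_some]
    · intro v h1 h2
      by_cases c : v = j
      · subst c; simp [downProg, Prog.run, Expr.val, h3, p1, p2, p3]
      · simp [downProg, Prog.run, Expr.val, h3, p1, p2, c, hleft v c (by simp) h1 h2]
    · intro v h1 h2
      by_cases c : v = i
      · subst c; simp [downProg, Prog.run, Expr.val, h3, p1, p2, h.right_i, code_some]
      · simp [downProg, Prog.run, Expr.val, h3, p1, p2, c, hright v c (by simp) h1 h2]
    · intro v h1 h2
      rw [← hpar v h1 h2]
      simp [downProg, Prog.run, Expr.val, h3, p1, p2, p3]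
  | some g =>
    rw [hg, code_some] at p2 hpar
    have hgn := (mem_verts_iff hT').1 (parent_mem hg)
    have hg0 : g ≠ 0 := by omega
    have hgne := h.top_ne g hg
    have hre := h.root_eq (by rw [hg]; simp)
    simp only [hg, Option.some.injEq] at hleft hright
    by_cases hgj : g < j
    · have ht := h.right_top g hg hgj
      refine ⟨⟨?_, ?_, ?_⟩, ?_⟩
      · simp [downProg, Prog.run, Expr.val, h3, p1, p2, ← hre, hg0, hgj, hroot]
      · intro v h1 h2
        by_cases c : v = j
        · subst c; simp [downProg, Prog.run, Expr.val, h3, p1, p2, p3, hg0, hgj]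
        · simp [downProg, Prog.run, Expr.val, h3, p1, p2, c, hg0, hgj,
            hleft v c (by omega) h1 h2]
      · intro v h1 h2
        by_cases c' : v = g
        · subst c'
          simp [downProg, Prog.run, Expr.val, h3, p1, p2, hg0, hgj, ht.1, code_some]
        by_cases c : v = i
        · subst c
          simp [downProg, Prog.run, Expr.val, h3, p1, p2, h.right_i, hg0, hgj, c', code_some]
        · simp [downProg, Prog.run, Expr.val, h3, p1, p2, c, hg0, hgj, c',
            hright v c (by omega) h1 h2]
      · intro v h1 h2
        rw [← hpar v h1 h2]
        simp [downProg, Prog.run, Expr.val, h3, p1, p2, p3, hg0, hgj]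
    · have ht := h.left_top g hg (by omega)
      refine ⟨⟨?_, ?_, ?_⟩, ?_⟩
      · simp [downProg, Prog.run, Expr.val, h3, p1, p2, ← hre, hg0, hgj, hroot]
      · intro v h1 h2
        by_cases c' : v = g
        · subst c'
          simp [downProg, Prog.run, Expr.val, h3, p1, p2, hg0, hgj, ht.1, code_some]
        by_cases c : v = j
        · subst c; simp [downProg, Prog.run, Expr.val, h3, p1, p2, p3, hg0, hgj, c']
        · simp [downProg, Prog.run, Expr.val, h3, p1, p2, c, hg0, hgj, c',
            hleft v c (by omega) h1 h2]
      · intro v h1 h2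
        by_cases c : v = i
        · subst c
          simp [downProg, Prog.run, Expr.val, h3, p1, p2, h.right_i, hg0, hgj, code_some]
        · simp [downProg, Prog.run, Expr.val, h3, p1, p2, c, hg0, hgj,
            hright v c (by omega) h1 h2]
      · intro v h1 h2
        rw [← hpar v h1 h2]
        simp [downProg, Prog.run, Expr.val, h3, p1, p2, p3, hg0, hgj]

/-- The code of a direction. -/
def dirCode : Dir → ℕ
  | .up => 0
  | .down => 1

/-- One rotation of the vertex in register `3` in its current direction. -/
def rotProg : Prog := Prog.cond (.get 7 (.reg 3)) downProg upProg

theorem rotProg_spec {M n j : ℕ} {d : Dir} {T T' : BTree} {m : Memory} (hT : T ∈ onVertices n)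
    (h : rot d j T = some T') (hm : TreeP n m T) (h3 : m.reg 3 = j)
    (h7 : m.arr 7 j = dirCode d) : TreeP n (rotProg.run M m) T' := by
  have hT' := mem_onVertices_of_rot h hT
  cases d with
  | up =>
    have hs := upStep_of_upRot h
    obtain ⟨i, hi⟩ := hs.linkChange hT.1
    simp only [rotProg, Prog.run, Expr.val, h3, h7, dirCode, if_true]
    exact upProg_spec hT hi hs.mem hm h3
  | down =>
    have hs := upStep_of_downRot h
    obtain ⟨i, hi⟩ := hs.linkChange hT'.1
    simp only [rotProg, Prog.run, Expr.val, h3, h7, dirCode, one_ne_zero, if_false]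
    exact downProg_spec hT' hi hs.mem hm h3

/-! ### The number of rotations in a slide -/

/-- The number of vertices in the left subtree of `j`. -/
def leftSize (T : BTree) (j : ℕ) : ℕ := (verts (leftSub (subAt T j))).card

theorem UpStep.leftSize_lt {j : ℕ} {T T' : BTree} (h : UpStep j T T') (hs : IsSearch T) :
    leftSize T j < leftSize T' j := by
  induction h with
  | here i l y z =>
    have hij : i < j := hs.2.1 j (by simp [verts])
    have hi : i ∉ verts y := fun hy => lt_irrefl i (hs.2.1 i (by simp [verts, hy]))
    have e1 : subAt (node i l (node j y z)) j = node j y z := by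
      rw [subAt, if_neg hij.ne', if_neg hij.not_gt, subAt, if_pos rfl]
    have e2 : subAt (node j (node i l y) z) j = node j (node i l y) z := by
      rw [subAt, if_pos rfl]
    rw [leftSize, leftSize, e1, e2]
    refine Finset.card_lt_card (Finset.ssubset_iff.2 ⟨i, hi, fun x hx => ?_⟩)
    rw [Finset.mem_insert] at hx
    exact mem_verts_node.2 (hx.imp id Or.inr)
  | left r ha h ih =>
    have := ih hs.2.2.1
    rwa [leftSize, leftSize, subAt, subAt, if_neg ha.ne, if_neg ha.ne, if_pos ha, if_pos ha]
  | right l ha h ih =>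
    have := ih hs.2.2.2
    rwa [leftSize, leftSize, subAt, subAt, if_neg ha.ne', if_neg ha.ne', if_neg ha.not_gt,
      if_neg ha.not_gt]

theorem leftSize_le {n : ℕ} {T : BTree} (hT : T ∈ onVertices n) (j : ℕ) : leftSize T j ≤ n := by
  have h := Finset.card_le_card ((verts_leftSub_subset (subAt T j)).trans
    (verts_subAt_subset T j))
  rw [hT.2, Nat.card_Icc, Nat.add_sub_cancel] at h
  exact h

/-- A slide by `s` steps needs `s ≤ n`, since each step changes the size of the left subtree. -/
theorem le_of_slide {d : Dir} {j s n : ℕ} {T T' : BTree} (hT : T ∈ onVertices n)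
    (h : slide d j s T = some T') : s ≤ n := by
  have key : match d with
      | .up => leftSize T j + s ≤ leftSize T' j
      | .down => leftSize T' j + s ≤ leftSize T j := by
    induction s generalizing T with
    | zero =>
      rw [slide, Option.some.injEq] at h
      subst h
      cases d <;> simp
    | succ s ih =>
      rw [slide, Option.bind_eq_some_iff] at h
      obtain ⟨T₁, h1, h2⟩ := h
      have hT1 := mem_onVertices_of_rot h1 hT
      have := ih hT1 h2
      cases d with
      | up =>
        have hlt := (upStep_of_upRot h1).leftSize_lt hT.1
        simp only at this ⊢
        omega
      | down =>
        have hlt := (upStep_of_downRot h1).leftSize_lt hT1.1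
        simp only at this ⊢
        omega
  have h1 := leftSize_le hT j
  have h2 := leftSize_le (mem_onVertices_of_slide h hT) j
  cases d <;> simp only at key <;> omega

/-! ### One iteration of the history-free algorithm on the word RAM -/

theorem slide_succ_last (d : Dir) (j u : ℕ) (T : BTree) :
    slide d j (u + 1) T = (slide d j u T).bind (rot d j) := by
  induction u generalizing T with
  | zero => simp [slide]
  | succ u ih =>
    rw [slide_succ', slide_succ', Option.bind_assoc]
    exact Option.bind_congr fun T₁ _ => ih T₁

/-- The minimal slide of the vertex in register `3` in its current direction: rotations until the
tree avoids all patterns. -/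
def slideProg : Prog :=
  (Prog.assign 8 (.const 1)).seq (Prog.loop (.reg 8) (rotProg.seq checkProg))

theorem TreeP.congr {n : ℕ} {T : BTree} {m m' : Memory} (h : TreeP n m T)
    (h2 : m'.reg 2 = m.reg 2) (h5 : m'.arr 5 = m.arr 5) (h6 : m'.arr 6 = m.arr 6)
    (h9 : m'.arr 9 = m.arr 9) : TreeP n m' T :=
  ⟨h.tree.congr h2 h5 h6, by rw [h9]; exact h.par⟩

/-- A slide has at most `n` rotations, each followed by one test. The minimality of the slide says
that the test succeeds after the last rotation and not before. -/
theorem slideProg_spec {M n j : ℕ} {pats : List TreePattern} {d : Dir} {T T' : BTree} {m : Memory}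
    (hM : 4 * ((n + 1) * (totalSize pats + 1)) < M) (hn : 1 ≤ n) (hne : pats ≠ [])
    (hk : ∀ P ∈ pats, 1 ≤ P.k) (hT : T ∈ onVertices n) (hT' : T' ∈ avoiders n pats)
    (hslide : IsMinSlide (avoiders n pats) d j T T') (hI : InputIn n pats m)
    (hTm : TreeP n m T) (h3 : m.reg 3 = j) (h7 : m.arr 7 j = dirCode d) :
    ∃ m', Runs M slideProg m m' (n * (1000 * (n * totalSize pats) + 200) + 10) ∧
      TreeP n m' T' := by
  obtain ⟨s, hs1, hs, hmin⟩ := hslide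
  have hsn := le_of_slide hT hs
  have hM1 : 1 % M = 1 := Nat.mod_eq_of_lt (by nlinarith)
  have hr0 := Runs.of_flat (M := M) (p := .assign 8 (.const 1)) rfl m
  set m₀ := (Prog.assign 8 (.const 1)).run M m with hm₀
  have q8 : m₀.reg 8 = 1 := by simp [hm₀, Prog.run, Expr.val, hM1]
  have hI0 := hI.congr hr0.same rfl rfl (by decide)
  have hT0 : TreeP n m₀ T :=
    hTm.congr (hr0.same.reg 2 rfl) (hr0.same.arr 5 rfl) (hr0.same.arr 6 rfl) (hr0.same.arr 9 rfl)
  have q3 : m₀.reg 3 = j := (hr0.same.reg 3 rfl).trans h3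
  have q7 : m₀.arr 7 j = dirCode d := by rw [hr0.same.arr 7 rfl, h7]
  obtain ⟨m₁, hr1, hi, -⟩ := Runs.loop (M := M) (u := .reg 8) (p := rotProg.seq checkProg)
    (N := s) (m₀ := m₀)
    -- `u` rotations have led to the tree `Tc`, and `i` rotations remain
    (fun i m => ∃ Tc u, u + i = s ∧ slide d j u T = some Tc ∧ slide d j i Tc = some T' ∧
      TreeP n m Tc ∧ m.reg 8 = if i = 0 then 0 else 1)
    (fun i => i * (1000 * (n * totalSize pats) + 200))
    ⟨T, 0, by omega, rfl, hs, hT0, by rw [q8, if_neg (by omega)]⟩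
    (fun i m _ hi => by
      obtain ⟨_, _, _, _, _, _, h8⟩ := hi
      simp only [Expr.val, h8]
      split_ifs <;> simp_all)
    (fun i m hsm hi => by
      obtain ⟨Tc, u, hu, hsu, hsi, hTP, -⟩ := hi
      rw [slide_succ', Option.bind_eq_some_iff] at hsi
      obtain ⟨T₁, hrot, hsi⟩ := hsi
      have hTc := mem_onVertices_of_slide hsu hT
      have hT1 := mem_onVertices_of_rot hrot hTc
      have hsu1 : slide d j (u + 1) T = some T₁ := by rw [slide_succ_last, hsu]; exact hrot
      have hra := Runs.of_flat (M := M) (p := rotProg) rfl m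
      have hTPa := rotProg_spec (M := M) hTc hrot hTP ((hsm.reg 3 rfl).trans q3)
        ((congrFun (hsm.arr 7 rfl) j).trans q7)
      have hIa := (hI0.congr hsm rfl rfl (by decide)).congr hra.same rfl rfl (by decide)
      obtain ⟨m', hrb, h8⟩ := checkProg_spec hM hn hne hk hT1 hIa hTPa.tree
      have htime : rotProg.time ≤ 100 := by decide
      refine ⟨m', _, hra.seq hrb, ⟨T₁, u + 1, by omega, hsu1, hsi,
        hTPa.congr (hrb.same.reg 2 rfl) (hrb.same.arr 5 rfl) (hrb.same.arr 6 rfl)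
          (hrb.same.arr 9 rfl), ?_⟩, ?_⟩
      · rw [h8]
        by_cases hi0 : i = 0
        · subst hi0
          rw [slide, Option.some.injEq] at hsi
          rw [if_pos rfl, ind_of_not]
          rintro ⟨P, hP, hc⟩
          exact hT'.2 P hP (hsi ▸ hc)
        · rw [if_neg hi0, ind_of]
          by_contra hcon
          push Not at hcon
          exact hmin (u + 1) (by omega) (by omega) T₁ hsu1 ⟨hT1, hcon⟩
      · simp only [Expr.cost]
        nlinarith)
  obtain ⟨Tc, u, hu, hsu, hsi, hTP, -⟩ := hi
  rw [slide, Option.some.injEq] at hsi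
  refine ⟨m₁, (hr0.seq hr1).mono ?_, hsi ▸ hTP⟩
  have := Nat.mul_le_mul_right (1000 * (n * totalSize pats) + 200) hsn
  have h0 : (Prog.assign 8 (.const 1)).time = 2 := rfl
  simp only [Expr.cost]
  omega

/-- The update of the auxiliary arrays after a slide of the vertex `j` in register `3`. Register `7`
receives the information whether `j` is blocked. -/
def updateProg : Prog :=
  (Prog.put 8 (.reg 0) (.reg 0)).seq <|
  (Prog.cond (.get 7 (.reg 3))
    (.assign 7 (.eq (.get 5 (.reg 3)) (.const 0)))
    ((Prog.assign 5 (.get 9 (.reg 3))).seq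
      (Prog.assign 7 (.add (.eq (.reg 5) (.const 0)) (.lt (.reg 3) (.reg 5)))))).seq <|
  Prog.cond (.reg 7)
    ((Prog.put 7 (.reg 3) (.sub (.const 1) (.get 7 (.reg 3)))).seq <|
     (Prog.put 8 (.reg 3) (.get 8 (.sub (.reg 3) (.const 1)))).seq <|
     (Prog.put 8 (.sub (.reg 3) (.const 1)) (.sub (.reg 3) (.const 1))))
    .skip

/-- The memory holds a state of the history-free algorithm, including the parents of all vertices,
which the rotations use. -/
structure StateIn (n : ℕ) (m : Memory) (x : HState) : Prop where
  tree : TreeP n m x.tree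
  o : ∀ v, 1 ≤ v → v ≤ n → m.arr 7 v = dirCode (x.o v)
  s : ∀ v, 1 ≤ v → v ≤ n → m.arr 8 v = x.s v

theorem StateIn.holds {n : ℕ} {m : Memory} {x : HState} (h : StateIn n m x) : Holds n m x := by
  refine ⟨h.tree.tree.root, fun v h1 h2 => ⟨h.tree.tree.left v h1 h2, h.tree.tree.right v h1 h2,
    ?_, h.s v h1 h2⟩⟩
  rw [h.o v h1 h2]
  cases x.o v <;> rfl

/-- Since `2 ≤ j`, the index `j - 1` is a vertex, so that truncated subtraction plays no role. -/
theorem updateProg_spec {M n j : ℕ} {x : HState} {T' : BTree} {m : Memory} (hM : n + 2 < M)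
    (hT' : T' ∈ onVertices n) (h0 : m.reg 0 = n) (h3 : m.reg 3 = j) (hj2 : 2 ≤ j) (hjn : j ≤ n)
    (hTm : TreeP n m T') (ho : ∀ v, 1 ≤ v → v ≤ n → m.arr 7 v = dirCode (x.o v))
    (hs : ∀ v, 1 ≤ v → v ≤ n → m.arr 8 v = x.s v) :
    StateIn n (updateProg.run M m) (x.update n j T') := by
  have hM1 : 1 % M = 1 := Nat.mod_eq_of_lt (by omega)
  have hj1 : (j - 1) % M = j - 1 := Nat.mod_eq_of_lt (by omega)
  have hoj := ho j (by omega) hjn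
  have hr := Runs.of_flat (M := M) (p := updateProg) rfl m
  have htree : TreeP n (updateProg.run M m) T' :=
    hTm.congr (hr.same.reg 2 rfl) (hr.same.arr 5 rfl) (hr.same.arr 6 rfl) (hr.same.arr 9 rfl)
  set p₁ : Prog := (Prog.put 8 (.reg 0) (.reg 0)).seq <|
    (Prog.cond (.get 7 (.reg 3))
      (.assign 7 (.eq (.get 5 (.reg 3)) (.const 0)))
      ((Prog.assign 5 (.get 9 (.reg 3))).seq
        (Prog.assign 7 (.add (.eq (.reg 5) (.const 0)) (.lt (.reg 3) (.reg 5)))))) with hp₁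
  set p₂ : Prog := (Prog.put 7 (.reg 3) (.sub (.const 1) (.get 7 (.reg 3)))).seq <|
     (Prog.put 8 (.reg 3) (.get 8 (.sub (.reg 3) (.const 1)))).seq <|
     (Prog.put 8 (.sub (.reg 3) (.const 1)) (.sub (.reg 3) (.const 1))) with hp₂
  have hrun : updateProg.run M m =
      if (p₁.run M m).reg 7 = 0 then p₁.run M m else p₂.run M (p₁.run M m) := rfl
  set m₁ := p₁.run M m with hm₁
  have hsame := (Runs.of_flat (M := M) (p := p₁) rfl m).same
  have h7 : m₁.arr 7 = m.arr 7 := hsame.arr 7 rfl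
  have h31 : m₁.reg 3 = j := (hsame.reg 3 rfl).trans h3
  have h8 : ∀ v, m₁.arr 8 v = if v = n then n else m.arr 8 v := by
    intro v
    simp only [hm₁, hp₁, Prog.run]
    split_ifs <;> simp_all [Expr.val]
  -- the code of `ε` is `0`, so a missing parent or left child is recognized by comparison with `0`
  have hb : m₁.reg 7 = 0 ↔ blocked T' j (x.o j) = false := by
    cases hd : x.o j with
    | up =>
      have hp := hTm.par j (by omega) hjn
      rw [hd] at hoj
      simp only [hm₁, hp₁, Prog.run, Expr.val, blocked]
      cases hpj : parent T' j with
      | none =>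
        rw [hpj] at hp
        simp [h3, hoj, hp, dirCode, code, hM1]
      | some p =>
        rw [hpj] at hp
        have := (mem_verts_iff hT').1 (parent_mem hpj)
        have hp0 : p ≠ 0 := by omega
        by_cases hjp : j < p <;> simp [h3, hoj, hp, dirCode, code, hM1, hp0, hjp]
    | down =>
      have hp := hTm.tree.left j (by omega) hjn
      rw [hd] at hoj
      simp only [hm₁, hp₁, Prog.run, Expr.val, blocked]
      cases hpj : leftChild T' j with
      | none =>
        rw [hpj] at hp
        simp [h3, hoj, hp, dirCode, code]
      | some p =>
        rw [hpj] at hp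
        have := (mem_verts_iff hT').1 (leftChild_mem hpj)
        have hp0 : p ≠ 0 := by omega
        simp [h3, hoj, hp, dirCode, code, hp0]
  have hx : ∀ v, Function.update x.s n n v = if v = n then n else x.s v := fun v => by
    rw [Function.update_apply]
  by_cases hblk : blocked T' j (x.o j) = true
  · have hne : m₁.reg 7 ≠ 0 := fun h => by rw [hb.1 h] at hblk; simp at hblk
    have hup : x.update n j T' =
        { tree := T'
          o := Function.update x.o j (x.o j).flip
          s := Function.update (Function.update (Function.update x.s n n) j
            (Function.update x.s n n (j - 1))) (j - 1) (j - 1) } := by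
      rw [HState.update, if_pos hblk]
    rw [hup]
    refine ⟨htree, ?_, ?_⟩
    · intro v hv1 hv2
      have hflip : (1 - dirCode (x.o j)) % M = dirCode (x.o j).flip := by
        cases x.o j <;> simp [dirCode, Dir.flip, hM1]
      rw [hrun, if_neg hne]
      by_cases hvj : v = j
      · simp [hp₂, Prog.run, Expr.val, h31, hvj, h7, hoj, hM1, hflip]
      · simp [hp₂, Prog.run, Expr.val, h31, hvj, h7, ho v hv1 hv2, hM1]
    · intro v hv1 hv2
      rw [hrun, if_neg hne]
      have hjn' : j - 1 ≠ n := by omega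
      have hsj := hs (j - 1) (by omega) (by omega)
      have hsv := hs v hv1 hv2
      simp only [Function.update_apply, if_neg hjn']
      simp [hp₂, Prog.run, Expr.val, h31, hM1, hj1, hjn', h8, hsj, hsv]
  · rw [Bool.not_eq_true] at hblk
    have hup : x.update n j T' =
        { tree := T', o := x.o, s := Function.update x.s n n } := by
      rw [HState.update, if_neg (by rw [hblk]; simp)]
    rw [hup]
    refine ⟨htree, ?_, ?_⟩
    · intro v hv1 hv2
      rw [hrun, if_pos (hb.2 hblk), h7]
      exact ho v hv1 hv2
    · intro v hv1 hv2
      rw [hrun, if_pos (hb.2 hblk), h8, hs v hv1 hv2]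
      exact (hx v).symm

/-- One iteration: the minimal slide of the vertex in register `3` and the update of the auxiliary
arrays. -/
def stepProg : Prog := slideProg.seq updateProg

theorem stepProg_spec {M n : ℕ} {pats : List TreePattern} {x y : HState} {m : Memory}
    (hM : 4 * ((n + 1) * (totalSize pats + 1)) < M) (hn : 1 ≤ n) (hne : pats ≠ [])
    (hk : ∀ P ∈ pats, 1 ≤ P.k) (hx : x.tree ∈ onVertices n) (hI : InputIn n pats m)
    (hm : StateIn n m x) (h3 : m.reg 3 = x.s n) (h : HStep (avoiders n pats) n x y) :
    ∃ m', Runs M stepProg m m' (n * (1000 * (n * totalSize pats) + 200) + 100) ∧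
      StateIn n m' y := by
  obtain ⟨hs1, T', hT', hslide, rfl⟩ := h
  have hj := (mem_verts_iff hx).1 (mem_of_isMinSlide hslide)
  obtain ⟨m₁, hr1, hT1⟩ := slideProg_spec hM hn hne hk hx hT' hslide hI hm.tree h3
    (hm.o _ hj.1 hj.2)
  have hr2 := Runs.of_flat (M := M) (p := updateProg) rfl m₁
  refine ⟨_, (hr1.seq hr2).mono ?_, updateProg_spec (by nlinarith) hT'.1
    ((hr1.same.reg 0 rfl).trans hI.n_reg) ((hr1.same.reg 3 rfl).trans h3) (by omega) hj.2 hT1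
    ?_ ?_⟩
  · have : updateProg.time ≤ 80 := by decide
    omega
  · rw [hr1.same.arr 7 rfl]; exact hm.o
  · rw [hr1.same.arr 8 rfl]; exact hm.s

/-! ### The complete word RAM program -/

theorem verts_rightPath (a m : ℕ) : ∀ v ∈ verts (rightPath a m), a ≤ v := by
  induction m generalizing a with
  | zero => simp [rightPath, verts]
  | succ m ih =>
    intro v hv
    rcases mem_verts_node.1 hv with rfl | hv | hv
    · exact le_rfl
    · simp [verts] at hv
    · have := ih _ v hv; omega

theorem subAt_rightPath {a m v : ℕ} (h1 : a ≤ v) (h2 : v < a + m) :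
    subAt (rightPath a m) v = node v nil (rightPath (v + 1) (a + m - v - 1)) := by
  induction m generalizing a with
  | zero => omega
  | succ m ih =>
    rw [rightPath, subAt]
    split_ifs with h h'
    · subst h
      congr 2
      omega
    · omega
    · rw [ih (by omega) (by omega)]
      congr 2
      omega

theorem root?_rightPath (a m : ℕ) : code (root? (rightPath a m)) = if m = 0 then 0 else a := by
  cases m <;> rfl

theorem leftChild_rightPath (a m v : ℕ) : leftChild (rightPath a m) v = none := by
  rw [leftChild]
  induction m generalizing a with
  | zero => rfl
  | succ m ih =>
    rw [rightPath, subAt]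
    split_ifs
    · rfl
    · rfl
    · exact ih _

theorem rightChild_rightPath {m v : ℕ} (h1 : 1 ≤ v) (h2 : v ≤ m) :
    code (rightChild (rightPath 1 m) v) = if v < m then v + 1 else 0 := by
  rw [rightChild, subAt_rightPath h1 (by omega), rightSub, root?_rightPath]
  split_ifs <;> omega

theorem parent_rightPath {a m v : ℕ} (h1 : a ≤ v) (h2 : v < a + m) :
    parent (rightPath a m) v = if v = a then none else some (v - 1) := by
  split_ifs with h
  · subst h
    cases m with
    | zero => omega
    | succ m =>
      rw [rightPath, parent, if_neg, if_neg (lt_irrefl _)]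
      · exact parent_of_notMem fun h => by have := verts_rightPath _ _ _ h; omega
      · rintro (h | h)
        · cases h
        · have := verts_rightPath _ _ _ (mem_verts_of_root h); omega
  · induction m generalizing a with
    | zero => omega
    | succ m ih =>
      rw [rightPath, parent]
      cases m with
      | zero => omega
      | succ m =>
        by_cases hv : v = a + 1
        · subst hv
          exact if_pos (Or.inr rfl)
        · rw [if_neg, if_neg (by omega), ih (by omega) (by omega) hv]
          rintro (h' | h')
          · cases h'
          · rw [rightPath, root?, Option.some.injEq] at h'
            omega

/-- The initialization: the right path, its parents, and the initial auxiliary arrays. Register `4` says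
whether the main loop continues. -/
def initProg : Prog :=
  (Prog.assign 10 (.reg 0)).seq <|
  (Prog.loop (.reg 10)
    ((Prog.put 6 (.reg 10) (.mul (.add (.reg 10) (.const 1)) (.lt (.reg 10) (.reg 0)))).seq <|
     (Prog.put 9 (.reg 10) (.sub (.reg 10) (.const 1))).seq <|
     (Prog.put 8 (.reg 10) (.reg 10)).seq <|
     (Prog.assign 10 (.sub (.reg 10) (.const 1))))).seq <|
  (Prog.assign 2 (.const 1)).seq (Prog.assign 4 (.const 1))

theorem inputIn_inputMemory (n : ℕ) (pats : List TreePattern) :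
    InputIn n pats (inputMemory n pats) :=
  ⟨rfl, rfl, fun _ _ => rfl⟩

theorem initProg_spec {M n : ℕ} (pats : List TreePattern) (hM : n + 2 < M) (hn : 1 ≤ n) :
    ∃ m', Runs M initProg (inputMemory n pats) m' (30 * n + 20) ∧ m'.reg 4 = 1 ∧
      InputIn n pats m' ∧ StateIn n m' (HState.init n) := by
  have hM1 : 1 % M = 1 := Nat.mod_eq_of_lt (by omega)
  set m := inputMemory n pats with hm
  have hr0 := Runs.of_flat (M := M) (p := .assign 10 (.reg 0)) rfl m
  set m₀ := (Prog.assign 10 (.reg 0)).run M m with hm₀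
  have q10 : m₀.reg 10 = n := by simp [hm₀, Prog.run, Expr.val, hm, inputMemory]
  have q0 : m₀.reg 0 = n := hr0.same.reg 0 rfl
  set p : Prog := (Prog.put 6 (.reg 10)
      (.mul (.add (.reg 10) (.const 1)) (.lt (.reg 10) (.reg 0)))).seq <|
     (Prog.put 9 (.reg 10) (.sub (.reg 10) (.const 1))).seq <|
     (Prog.put 8 (.reg 10) (.reg 10)).seq <|
     (Prog.assign 10 (.sub (.reg 10) (.const 1))) with hp
  obtain ⟨m₁, hr1, hi, hs⟩ := Runs.loop (M := M) (u := .reg 10) (p := p) (N := n) (m₀ := m₀)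
    (fun i m => m.reg 10 = i ∧ i ≤ n ∧ ∀ v, i < v → v ≤ n →
      m.arr 6 v = (if v < n then v + 1 else 0) ∧ m.arr 9 v = v - 1 ∧ m.arr 8 v = v)
    (fun i => 30 * i) ⟨q10, le_rfl, fun v h1 h2 => by omega⟩
    (fun i m _ hi => by simp only [Expr.val, hi.1])
    (fun i m hs hi => by
      have hr := Runs.of_flat (M := M) (p := p) rfl m
      have h10 := hi.1
      have h0 : m.reg 0 = n := (hs.reg 0 rfl).trans q0
      have hi1 : i % M = i := Nat.mod_eq_of_lt (by omega)
      have hi2 : (i + 1 + 1) % M = i + 1 + 1 := Nat.mod_eq_of_lt (by omega)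
      refine ⟨_, _, hr, ⟨?_, by omega, ?_⟩, ?_⟩
      · simp [hp, Prog.run, Expr.val, h10, hM1, hi1]
      · intro v h1 h2
        by_cases hv : v = i + 1
        · subst hv
          by_cases hin : i + 1 < n <;>
            simp [hp, Prog.run, Expr.val, h10, h0, hM1, hi1, hi2, hin]
        · obtain ⟨e1, e2, e3⟩ := hi.2.2 v (by omega) h2
          simp [hp, Prog.run, Expr.val, h10, hv, e1, e2, e3]
      · have : p.time ≤ 25 := by decide
        simp only [Expr.cost]
        omega)
  have hr2 := Runs.of_flat (M := M) (p := (Prog.assign 2 (.const 1)).seq (Prog.assign 4 (.const 1)))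
    rfl m₁
  have hr := hr0.seq (hr1.seq hr2)
  have h5 := hr.same.arr 5 rfl
  have h7 := hr.same.arr 7 rfl
  have hI := (inputIn_inputMemory n pats).congr hr.same rfl rfl (by decide)
  refine ⟨_, hr.mono ?_, ?_, hI, ⟨⟨⟨?_, ?_, ?_⟩, ?_⟩, ?_, ?_⟩⟩
  · simp only [Expr.cost, Prog.time]
    omega
  · simp [Prog.run, Expr.val, hM1]
  · rw [HState.init, root?_rightPath, if_neg (by omega)]
    simp [Prog.run, Expr.val, hM1]
  · intro v _ _
    rw [h5, HState.init, leftChild_rightPath]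
    rfl
  · intro v h1 h2
    rw [HState.init, rightChild_rightPath h1 h2, hr2.same.arr 6 rfl]
    exact (hi.2.2 v h1 h2).1
  · intro v h1 h2
    rw [HState.init, parent_rightPath h1 (by omega), hr2.same.arr 9 rfl, (hi.2.2 v h1 h2).2.1]
    split_ifs with h
    · rw [h]; rfl
    · rfl
  · intro v _ _
    rw [h7]
    rfl
  · intro v h1 h2
    rw [hr2.same.arr 8 rfl]
    exact (hi.2.2 v h1 h2).2.2

/-- The body of the main loop. -/
def mainBody : Prog :=
  Prog.visit.seq <|
  (Prog.assign 3 (.get 8 (.reg 0))).seq <|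
  Prog.cond (.eq (.reg 3) (.const 1)) (.assign 4 (.const 0)) stepProg

/-- The history-free algorithm. -/
def hProg : Prog := initProg.seq (Prog.loop (.reg 4) mainBody)

theorem Runs.cond_false {M : ℕ} {u : Expr} {p q : Prog} {m m' : Memory} {t : ℕ}
    (hu : u.val M m = 0) (h : Runs M q m m' t) : Runs M (.cond u p q) m m' (u.cost + 1 + t) :=
  fun clk log => by
    obtain ⟨c, hc, h⟩ := h (clk + (u.cost + 1)) log
    exact ⟨c, by omega, .cond_false hu h⟩

theorem Runs.cond_true {M : ℕ} {u : Expr} {p q : Prog} {m m' : Memory} {t : ℕ}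
    (hu : u.val M m ≠ 0) (h : Runs M p m m' t) : Runs M (.cond u p q) m m' (u.cost + 1 + t) :=
  fun clk log => by
    obtain ⟨c, hc, h⟩ := h (clk + (u.cost + 1)) log
    exact ⟨c, by omega, .cond_true hu h⟩

/-- The main loop, started in a state `x` that is followed by the states in `xs` in a run of the
history-free algorithm. The time of the previous event is `t₀`. -/
theorem exec_mainLoop {M n B : ℕ} {pats : List TreePattern}
    (hM : 4 * ((n + 1) * (totalSize pats + 1)) < M) (hn : 1 ≤ n) (hne : pats ≠ [])
    (hk : ∀ P ∈ pats, 1 ≤ P.k) (hB : n * (1000 * (n * totalSize pats) + 200) + 200 ≤ B)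
    (xs : List HState) (x : HState) (m : Memory) (clk t₀ : ℕ) (log : List (ℕ × Memory))
    (hmem : ∀ y ∈ x :: xs, y.tree ∈ onVertices n)
    (hchain : (x :: xs).IsChain (HStep (avoiders n pats) n))
    (hlast : ∀ y ∈ (x :: xs).getLast?, y.s n = 1) (hI : InputIn n pats m) (hx : StateIn n m x)
    (h4 : m.reg 4 = 1) (ht : clk + 10 ≤ t₀ + B) :
    ∃ m' clk' new, Exec M (.loop (.reg 4) mainBody) ⟨m, clk, log⟩ ⟨m', clk', log ++ new⟩ ∧
      List.Forall₂ (fun (r : ℕ × Memory) (x : HState) => Holds n r.2 x) new (x :: xs) ∧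
      List.IsChain (fun t t' : ℕ => t' ≤ t + B) (t₀ :: (new.map Prod.fst ++ [clk'])) := by
  induction xs generalizing x m clk t₀ log with
  | nil =>
    have hs1 : x.s n = 1 := hlast x rfl
    have hM1 : 1 % M = 1 := Nat.mod_eq_of_lt (by nlinarith)
    set p : Prog := (Prog.assign 3 (.get 8 (.reg 0))).seq <|
      Prog.cond (.eq (.reg 3) (.const 1)) (.assign 4 (.const 0)) stepProg with hp
    have hr0 := Runs.of_flat (M := M) (p := .assign 3 (.get 8 (.reg 0))) rfl m
    set m₁ := (Prog.assign 3 (.get 8 (.reg 0))).run M m with hm₁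
    have h3 : m₁.reg 3 = 1 := by
      simp [hm₁, Prog.run, Expr.val, hI.n_reg, hx.s n hn le_rfl, hs1]
    have hr1 := Runs.of_flat (M := M) (p := .assign 4 (.const 0)) rfl m₁
    have hr := hr0.seq (Runs.cond_true (u := .eq (.reg 3) (.const 1)) (q := stepProg)
      (by simp [Expr.val, h3, hM1]) hr1)
    obtain ⟨c, hc, he⟩ := hr (clk + 2 + 1) (log ++ [(clk + 2 + 1, m)])
    refine ⟨_, c + 2, [(clk + 2 + 1, m)], .loop_true (by simp [Expr.val, h4])
      (.seq (.visit _) he) (.loop_false (by simp [Prog.run, Expr.val])), ?_, ?_⟩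
    · exact .cons hx.holds .nil
    · simp only [Prog.time, Expr.cost] at hc
      simp only [List.map_cons, List.map_nil, List.cons_append, List.nil_append,
        List.isChain_cons_cons, List.isChain_singleton, and_true]
      omega
  | cons y ys ih =>
    rw [List.isChain_cons_cons] at hchain
    have hM1 : 1 % M = 1 := Nat.mod_eq_of_lt (by nlinarith)
    have hs1 : x.s n ≠ 1 := hchain.1.1
    have hr0 := Runs.of_flat (M := M) (p := .assign 3 (.get 8 (.reg 0))) rfl m
    set m₁ := (Prog.assign 3 (.get 8 (.reg 0))).run M m with hm₁
    have h3 : m₁.reg 3 = x.s n := by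
      simp [hm₁, Prog.run, Expr.val, hI.n_reg, hx.s n hn le_rfl]
    have hI1 := hI.congr hr0.same rfl rfl (by decide)
    have hx1 : StateIn n m₁ x :=
      ⟨hx.tree.congr (hr0.same.reg 2 rfl) (hr0.same.arr 5 rfl) (hr0.same.arr 6 rfl)
        (hr0.same.arr 9 rfl), by rw [hr0.same.arr 7 rfl]; exact hx.o,
        by rw [hr0.same.arr 8 rfl]; exact hx.s⟩
    obtain ⟨m₂, hr1, hy⟩ := stepProg_spec hM hn hne hk (hmem x (by simp)) hI1 hx1 h3 hchain.1
    have hr := hr0.seq (Runs.cond_false (u := .eq (.reg 3) (.const 1)) (p := .assign 4 (.const 0))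
      (by simp [Expr.val, h3, hM1, hs1]) hr1)
    have h42 : m₂.reg 4 = 1 := (hr1.same.reg 4 rfl).trans ((hr0.same.reg 4 rfl).trans h4)
    obtain ⟨c, hc, he⟩ := hr (clk + 2 + 1) (log ++ [(clk + 2 + 1, m)])
    simp only [Prog.time, Expr.cost] at hc
    obtain ⟨m', clk', new, hex, hf, hch⟩ := ih y m₂ c (clk + 2 + 1) (log ++ [(clk + 2 + 1, m)])
      (fun z hz => hmem z (List.mem_cons_of_mem _ hz)) hchain.2
      (fun z hz => hlast z (by rw [List.getLast?_cons_cons]; exact hz))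
      (hI1.congr hr1.same rfl rfl (by decide)) hy h42 (by omega)
    refine ⟨m', clk', (clk + 2 + 1, m) :: new, .loop_true (by simp [Expr.val, h4])
      (.seq (.visit _) he) ?_, .cons hx.holds hf, ?_⟩
    · rw [List.append_assoc] at hex
      exact hex
    · rw [List.map_cons, List.cons_append, List.isChain_cons_cons]
      exact ⟨by omega, hch⟩

/-- The delay `B` is that of one step of the history-free algorithm; the time of the initialization
is linear in `n`. -/
theorem runsWithDelay_hProg {M n B : ℕ} {pats : List TreePattern} {xs : List HState}
    (hM : 4 * ((n + 1) * (totalSize pats + 1)) < M) (hn : 1 ≤ n) (hne : pats ≠ [])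
    (hk : ∀ P ∈ pats, 1 ≤ P.k) (hB : n * (1000 * (n * totalSize pats) + 200) + 200 ≤ B)
    (hmem : ∀ y ∈ xs, y.tree ∈ onVertices n) (hrun : IsHRun (avoiders n pats) n xs) :
    RunsWithDelay M hProg n pats xs B := by
  obtain ⟨hhead, hchain, hlast⟩ := hrun
  obtain ⟨x, xs, rfl⟩ : ∃ x ys, xs = x :: ys := by
    cases xs with
    | nil => simp at hhead
    | cons x ys => exact ⟨x, ys, rfl⟩
  rw [List.head?_cons, Option.some.injEq] at hhead
  obtain ⟨m, hr, h4, hI, hx⟩ := initProg_spec (M := M) pats (by nlinarith) hn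
  obtain ⟨c, hc, he⟩ := hr 0 []
  obtain ⟨m', clk', new, hex, hf, hch⟩ := exec_mainLoop hM hn hne hk hB xs x m c 0 [] hmem hchain
    hlast hI (hhead ▸ hx) h4 (by
      have := Nat.mul_le_mul_left n (Nat.le_add_left 200 (1000 * (n * totalSize pats)))
      omega)
  exact ⟨_, .seq he hex, hf, hch⟩

theorem TreePattern.Friendly.one_le_k {P : TreePattern} (h : P.Friendly) : 1 ≤ P.k := by
  obtain ⟨i, pl, pr, hP, -⟩ := h.tame
  have hi := (mem_verts_iff (v := i) P.tree_mem).1 (by rw [hP]; simp [verts])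
  omega

theorem totalSize_le_sum_sq (pats : List TreePattern) :
    totalSize pats ≤ (pats.map (fun P => P.k ^ 2)).sum := by
  induction pats with
  | nil => exact le_rfl
  | cons P pats ih =>
    rw [totalSize, List.map_cons, List.map_cons, List.sum_cons, List.sum_cons]
    exact Nat.add_le_add (Nat.le_self_pow (by omega) P.k) ih

/-- All indices into the table of the dynamic program fit into a word. -/
theorem table_lt {n K C M : ℕ} (hC : 6 ≤ C) (hn : 1 ≤ n) (hK : 1 ≤ K) (hM : (n + K) ^ C ≤ M) :
    4 * ((n + 1) * (K + 1)) < M := by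
  refine lt_of_lt_of_le ?_ ((Nat.pow_le_pow_right (by omega) hC).trans hM)
  have h2 : (n + 1) * (K + 1) ≤ (n + K) * (n + K) := Nat.mul_le_mul (by omega) (by omega)
  have h4 : 2 * 2 ≤ (n + K) * (n + K) := Nat.mul_le_mul (by omega) (by omega)
  generalize hq : (n + K) * (n + K) = q at *
  have h5 := Nat.mul_le_mul_right q (Nat.mul_le_mul h4 h4)
  rw [show (n + K) ^ 6 = q * q * q by rw [← hq]; ring]
  omega

/-- The constant `C` serves as exponent of the word size, where `6` would do, and as factor of the
delay, which is at most `1000 n² ∑ kᵢ` plus lower order terms. -/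
theorem runsWithDelay_of_pow_le {M n C : ℕ} {pats : List TreePattern} {xs : List HState}
    (hC : 2000 ≤ C) (hn : 1 ≤ n) (hne : pats ≠ []) (hp : ∀ P ∈ pats, P.Friendly)
    (hM : (n + (pats.map (fun P => P.k)).sum) ^ C ≤ M)
    (hmem : ∀ y ∈ xs, y.tree ∈ onVertices n) (hrun : IsHRun (avoiders n pats) n xs) :
    RunsWithDelay M hProg n pats xs (C * (n ^ 2 * (pats.map (fun P => P.k ^ 2)).sum)) := by
  have hk : ∀ P ∈ pats, 1 ≤ P.k := fun P hP => (hp P hP).one_le_k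
  have hK : 1 ≤ totalSize pats := (List.length_pos_iff.2 hne).trans_le (length_le_totalSize hk)
  refine runsWithDelay_hProg (table_lt (by omega) hn hK hM) hn hne hk ?_ hmem hrun
  have h1 : n ^ 2 * totalSize pats ≤ n ^ 2 * (pats.map (fun P => P.k ^ 2)).sum :=
    Nat.mul_le_mul_left _ (totalSize_le_sum_sq pats)
  have h2 : n ≤ n ^ 2 := Nat.le_self_pow (by omega) n
  have h3 : n ^ 2 ≤ n ^ 2 * totalSize pats := Nat.le_mul_of_pos_right _ hK
  have h4 : n * (1000 * (n * totalSize pats) + 200) = 1000 * (n ^ 2 * totalSize pats) + 200 * n :=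
    by ring
  refine le_trans ?_ (Nat.mul_le_mul_right _ hC)
  omega

end FriendlyTrees

/-- The history-free algorithm visits every avoiding tree exactly once, in the order of the greedy
algorithm, and it has an implementation on the word RAM, with words of logarithmic length, which
takes time `O(n² ∑ kᵢ²)` per tree. -/
theorem mainTheorem3 :
    ∃ (prog : Prog) (C : ℕ), ∀ (n : ℕ) (pats : List TreePattern),
      1 ≤ n → (∀ P ∈ pats, P.Friendly) →
      ∃ xs : List HState,
        (∀ ys : List HState, IsHRun (avoiders n pats) n ys ↔ ys = xs) ∧
        (xs.map HState.tree).Nodup ∧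
        (∀ T : BTree, T ∈ xs.map HState.tree ↔ T ∈ avoiders n pats) ∧
        (∀ vs : List BTree, IsSRun (avoiders n pats) (BTree.rightPath 1 n) vs ↔
          vs = xs.map HState.tree) ∧
        (pats ≠ [] → ∀ M : ℕ, (n + (pats.map (fun P => P.k)).sum) ^ C ≤ M →
          RunsWithDelay M prog n pats xs (C * (n ^ 2 * (pats.map (fun P => P.k ^ 2)).sum))) := by
  refine ⟨hProg, 2000, fun n pats hn hp => ?_⟩
  have hL : Zigzag fun n => avoiders n pats := zigzag_avoiders hp
  obtain ⟨hok, -, hnodup, hmem, -⟩ := hRun_spec hL (n - 1)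
  rw [Nat.sub_add_cancel hn] at hok hnodup hmem
  refine ⟨hRun (fun n => avoiders n pats) n, isHRun_iff hL hn, hnodup, hmem,
    isSRun_iff_eq hL hn, fun hne M hM => ?_⟩
  exact runsWithDelay_of_pow_le le_rfl hn hne hp hM (fun x hx => (hok.mem x hx).1)
    ((isHRun_iff hL hn _).2 rfl)
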